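/- The ultra-discrete Toda equation for $(Q_n^t,E_n^t,U_n^t)_{n,t\in\mathbb{Z}}\in(\mathbb{R}^3)^{\mathbb{Z}^2}$ is \[Q_n^{t+1}=\min\{U_n^t,E_n^t\},\qquad E_n^{t+1}=Q_{n+1}^t+E_n^t-Q_n^{t+1},\qquad U_{n+1}^t=U_n^t+Q_{n+1}^t-Q_n^{t+1}\qquad(n,t\in\mathbb{Z}).\] Let $\mathcal{X}^*$ be the set of $(Q^0,E^0)\in(\mathbb{R}^2)^{\mathbb{Z}}$ for which there is exactly one solution $(Q_n^t,E_n^t,U_n^t)_{n,t\in\mathbb{Z}}$ with the given values at $t=0$, and for $(Q^0,E^0)\in\mathcal{X}^*$ put $\mathcal{T}_{udT}(Q^0,E^0):=(Q^1,E^1)$. For $\lambda>0$, $c\in\mathbb{R}$, let $\mathrm{sExp}(\lambda,c)$ be the law with density proportional to $e^{-\lambda x}\mathbf{1}_{[c,\infty)}(x)$; for $\theta\in(0,1)$, $M\in\mathbb{R}$, $m>0$, let $\mathrm{ssGeo}(1-\theta,M,m)$ be the law with mass proportional to $\theta^{k}$ at $m(M+k)$, $k=0,1,2,\dots$. Theorem.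 Let $(Q_n^0,E_n^0)_{n\in\mathbb{Z}}$ be an i.i.d. sequence with marginal $\tilde\mu\times\mu$ (so that $Q_n^0$ and $E_n^0$ are independent), where one of the following holds: (a) for some $\lambda_1,\lambda_2>0$ and $c\in\mathbb{R}$, $\tilde\mu\times\mu=\mathrm{sExp}(\lambda_1+\lambda_2,c)\times\mathrm{sExp}(\lambda_1,c)$; (b) for some $\theta_1,\theta_2\in(0,1)$, $M\in\mathbb{R}$ and $m>0$, $\tilde\mu\times\mu=\mathrm{ssGeo}(1-\theta_1\theta_2,M,m)\times\mathrm{ssGeo}(1-\theta_1,M,m)$; (c) for some $c\in\mathbb{R}$ and some probability measure $m$ supported on $[0,\infty)$ with $m\neq\delta_0$, $\tilde\mu\times\mu=\delta_c\times m(\cdot-c)$. Then $(Q^0,E^0)\in\mathcal{X}^*$ almost surely and $\mathcal{T}_{udT}(Q^0,E^0)$ has the same law as $(Q^0,E^0)$. Conversely, if $(Q_n^0,E_n^0)_{n\in\mathbb{Z}}$ is an i.i.d. sequence with $Q_n^0$ independent of $E_n^0$, such that $(Q^0,E^0)\in\mathcal{X}^*$ almost surely and $\mathcal{T}_{udT}(Q^0,E^0)$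 has the same law as $(Q^0,E^0)$, then its marginal is of the form (a), (b) or (c). -/

import Mathlib

open MeasureTheory ProbabilityTheory

noncomputable section

namespace UDToda

/-- A configuration `(Q_n, E_n)_{n ∈ ℤ}` of the ultra-discrete Toda lattice. -/
abbrev Config : Type := ℤ → ℝ × ℝ

/-- The functions `Q`, `E`, `U`, written `Q t n` for the value at time `t` and site `n`, solve
the ultra-discrete Toda equation at all sites and all (positive and negative) times, and
`(Q, E)` at time `0` is the given configuration. -/
structure IsSolution (x : Config) (Q E U : ℤ → ℤ → ℝ) : Prop where
  init_Q : ∀ n, Q 0 n = (x n).1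
  init_E : ∀ n, E 0 n = (x n).2
  step_Q : ∀ t n, Q (t + 1) n = min (U t n) (E t n)
  step_E : ∀ t n, E (t + 1) n = Q t (n + 1) + E t n - Q (t + 1) n
  step_U : ∀ t n, U t (n + 1) = U t n + Q t (n + 1) - Q (t + 1) n

/-- The configurations from which the initial value problem of the ultra-discrete Toda equation
has one and only one solution `s = (Q, E, U)` on the whole of `ℤ × ℤ`. -/
def uniquelySolvable : Set Config :=
  {x | ∃! s : (ℤ → ℤ → ℝ) × (ℤ → ℤ → ℝ) × (ℤ → ℤ → ℝ), IsSolution x s.1 s.2.1 s.2.2}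

open Classical in
/-- The one time-step dynamics `(Q⁰, E⁰) ↦ (Q¹, E¹)`, read off from the unique solution of the
initial value problem. Outside `uniquelySolvable` the dynamics are not defined; the value `0`
there is a placeholder. -/
def dynamics (x : Config) : Config :=
  if h : x ∈ uniquelySolvable then
    fun n => (h.exists.choose.1 1 n, h.exists.choose.2.1 1 n)
  else 0

/-- The shifted exponential distribution: density proportional to `exp (-l * y)` on `[c, ∞)`. -/
def sExp (l c : ℝ) : Measure ℝ :=
  volume.withDensity
    (fun y => ENNReal.ofReal (if c ≤ y then l * Real.exp (-(l * (y - c))) else 0))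

/-- The shifted scaled geometric distribution: the law of `m * (M + k)` where
`k = 0, 1, 2, …` has probability `p * (1 - p) ^ k`. -/
def ssGeo (p M m : ℝ) : Measure ℝ :=
  Measure.sum (fun k : ℕ =>
    ENNReal.ofReal (p * (1 - p) ^ k) • Measure.dirac (m * (M + (k : ℝ))))

end UDToda

end

open MeasureTheory ProbabilityTheory

noncomputable section

namespace UDToda

open Filter Topology

set_option linter.unusedSectionVars false

/-! ### Deterministic theory of the carrier recursion. -/

section

/-! In the environment `(Q_{n+1}, E_n)` the unknown `U` of one time step is a carrier moving to the
right by `U ↦ Q + (U - E)⁺`, and it determines the new configuration. The local map `((Q, E), U) ↦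
((Q', E'), U')` is an involution, so a backward time step is a forward one seen in a mirror.

Uniqueness. Updates are monotone and of the form `u ↦ max (u + a) b`. Every carrier therefore
dominates the runs restarted at a reset, and it equals their supremum `carrier` once resets `U ≤ E`
recur towards `-∞`. Without resets the step merely exchanges entries of the environment. A carrier
for the following step then bounds the walk with increments `Q_{n+1} - E_n` above on the left, while
`U` bounds it below wherever `Q` is not very negative. Long blocks of increments of one sign exclude
this (`IsCarrier.hasResets`), and an i.i.d. sequence has such blocks unless `Q = E` almost surely.
Thus the mere existence of a next and of a previous step makes the carriers canonical in both
directions of time, whatever the means are.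

Sufficiency. In each family some law `ρ` (`sExp l₂ c`, `ssGeo (1 - θ₂) M m` or `δ_c`) makes `μ × ν ×
ρ` invariant under the local map (`Balanced`). A carrier started far to the left with law `ρ` then
produces i.i.d. outputs, as in Burke's theorem. Since `Q` is smaller than `E` in mean, the start is
forgotten and the canonical step preserves the law (`Balanced.measurePreserving`). All forward and
backward iterates then have the same law, and the canonical trajectory exists and is the only
solution.

Necessity. `U_0` is a function of the environment strictly to the left, hence independent of `E_0`.
Read backwards, `U_1` is a function of the new configuration to the right of the origin, which by
invariance is again i.i.d. Now `Q'_0 = min E_0 U_0` and `E'_0 - U_1 = E_0 - U_0`, so the minimum and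
the difference of the independent variables `E_0`, `U_0` are independent. This forces tails that are
multiplicative at almost every value of the other variable, so both laws are exponential or both
geometric, unless one is a point mass (`MinDiffIndep.classification`); `Q_0` has the law of the
minimum. -/

/-- One step of the carrier recursion `u ↦ a + (u - b)⁺`. -/
def upd (p : ℝ × ℝ) (u : ℝ) : ℝ := p.1 + max (u - p.2) 0

/-- The pair `(Q', E')` produced at a site with environment `p = (Q_{n+1}, E_n)` and carrier `u`. -/
def out (p : ℝ × ℝ) (u : ℝ) : ℝ × ℝ := (min u p.2, p.1 + p.2 - min u p.2)

lemma upd_eq_max (p : ℝ × ℝ) (u : ℝ) : upd p u = max (u + (p.1 - p.2)) p.1 := by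
  rw [upd, ← max_add_add_left]; congr 1 <;> ring

lemma fst_le_upd (p : ℝ × ℝ) (u : ℝ) : p.1 ≤ upd p u := by
  rw [upd_eq_max]; exact le_max_right _ _

lemma add_sub_le_upd (p : ℝ × ℝ) (u : ℝ) : u + (p.1 - p.2) ≤ upd p u := by
  rw [upd_eq_max]; exact le_max_left _ _

lemma upd_of_le {p : ℝ × ℝ} {u : ℝ} (h : u ≤ p.2) : upd p u = p.1 := by
  rw [upd_eq_max]; exact max_eq_right (by linarith)

lemma upd_mono (p : ℝ × ℝ) : Monotone (upd p) := fun u v h => by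
  unfold upd; gcongr

/-- The local update is an involution. -/
lemma upd_out (p : ℝ × ℝ) (u : ℝ) : upd (out p u) (upd p u) = u := by
  simp only [upd, out]
  rcases le_total u p.2 with h | h
  · rw [min_eq_left h, max_eq_right (by linarith : u - p.2 ≤ 0), max_eq_right (by linarith)]; ring
  · rw [min_eq_right h, max_eq_left (by linarith : 0 ≤ u - p.2), max_eq_left (by linarith)]; ring

lemma out_out (p : ℝ × ℝ) (u : ℝ) : out (out p u) (upd p u) = p := by
  simp only [upd, out]
  rcases le_total u p.2 with h | h
  · rw [min_eq_left h, max_eq_right (by linarith : u - p.2 ≤ 0), min_eq_left (by linarith)]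
    ext <;> simp
  · rw [min_eq_right h, max_eq_left (by linarith : 0 ≤ u - p.2), min_eq_right (by linarith)]
    ext <;> simp

/-- `U` solves the carrier recursion in the environment `w`. -/
def IsCarrier (w : Config) (U : ℤ → ℝ) : Prop := ∀ n, U (n + 1) = upd (w n) (U n)

/-- The state at site `n` of the carrier recursion started from `u` at site `n - N`. -/
def run (w : Config) (u : ℝ) : ℤ → ℕ → ℝ
  | _, 0 => u
  | n, N + 1 => upd (w (n - 1)) (run w u (n - 1) N)

lemma run_succ_start (w : Config) (u : ℝ) (N : ℕ) : ∀ n : ℤ,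
    run w u n (N + 1) = run w (upd (w (n - N - 1)) u) n N := by
  induction N with
  | zero => intro n; simp [run]
  | succ N ih =>
    intro n
    rw [run, ih (n - 1), run]
    congr 3
    push_cast; ring_nf

lemma run_mono (w : Config) (N : ℕ) : ∀ n, Monotone (fun u => run w u n N) := by
  induction N with
  | zero => intro n u v h; simpa [run] using h
  | succ N ih => intro n u v h; exact upd_mono _ (ih _ h)

lemma IsCarrier.eq_run {w : Config} {U : ℤ → ℝ} (h : IsCarrier w U) (N : ℕ) :
    ∀ n : ℤ, U n = run w (U (n - N)) n N := by
  induction N with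
  | zero => intro n; simp [run]
  | succ N ih =>
    intro n
    have := h (n - 1)
    rw [sub_add_cancel] at this
    rw [run, this, ih (n - 1)]
    congr 3; push_cast; ring_nf

/-- The state at site `n` of the carrier recursion started from a reset at site `n - N - 1`. -/
def resetRun (w : Config) (n : ℤ) (N : ℕ) : ℝ := run w (w (n - N - 1)).2 n (N + 1)

/-- The canonical carrier. -/
def carrier (w : Config) (n : ℤ) : ℝ := ⨆ N, resetRun w n N

/-- The new configuration produced by the canonical carrier. -/
def canonicalOut (w : Config) : Config := fun n => out (w n) (carrier w n)

/-- A start at `E` makes the first update land on `Q`, the least value that any start can give. -/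
lemma resetRun_eq (w : Config) (n : ℤ) (N : ℕ) :
    resetRun w n N = run w (w (n - N - 1)).1 n N := by
  rw [resetRun, run_succ_start, upd_of_le le_rfl]

lemma resetRun_le_run (w : Config) (n : ℤ) (N : ℕ) (u : ℝ) :
    resetRun w n N ≤ run w u n (N + 1) := by
  rw [resetRun_eq, run_succ_start]
  exact run_mono w N n (fst_le_upd _ _)

/-- The carrier is reset to its minimal value at arbitrarily negative sites. -/
def HasResets (w : Config) (U : ℤ → ℝ) : Prop := ∀ N : ℤ, ∃ k ≤ N, U k ≤ (w k).2

/-- A squeeze by monotonicity: `U` dominates every reset run, and a run begun at a site where `U` is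
reset dominates `U`. -/
lemma IsCarrier.eq_carrier {w : Config} {U : ℤ → ℝ} (h : IsCarrier w U) (hr : HasResets w U) :
    U = carrier w := by
  funext n
  have hle : ∀ N, resetRun w n N ≤ U n := fun N => by
    rw [h.eq_run (N + 1) n]; exact resetRun_le_run _ _ _ _
  obtain ⟨k, hk, hkU⟩ := hr (n - 1)
  obtain ⟨N, hN⟩ := Int.eq_ofNat_of_zero_le (sub_nonneg.2 hk)
  refine le_antisymm ?_ (ciSup_le hle)
  refine le_trans ?_ (le_ciSup (f := resetRun w n) ⟨U n, by rintro _ ⟨N, rfl⟩; exact hle N⟩ N)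
  rw [h.eq_run (N + 1) n, resetRun]
  apply run_mono
  have h1 : n - ((N + 1 : ℕ) : ℤ) = k := by push_cast; linarith
  have h2 : n - N - 1 = k := by linarith
  rw [h1, h2]; exact hkU

/-- The increment of the environment over the `N` sites to the left of `n`. -/
def drift (w : Config) (n : ℤ) (N : ℕ) : ℝ :=
  ∑ i ∈ Finset.range N, ((w (n - 1 - i)).1 - (w (n - 1 - i)).2)

/-- The environment drains the carrier from the far left. -/
def Draining (w : Config) : Prop := ∀ n : ℤ, Tendsto (drift w n) atTop atBot ∧
  Tendsto (fun N : ℕ => (w (n - N - 1)).1 + drift w n N) atTop atBot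

/-- Maps `u ↦ max (u + a) b` are closed under composition. The start enters only through the drift,
and the other term does not depend on it. -/
lemma run_eq_max (w : Config) (n : ℤ) (N : ℕ) : ∀ u,
    run w u n (N + 1) = max (u + drift w n (N + 1)) (resetRun w n N) := by
  induction N with
  | zero => intro u; simp [resetRun, run, drift, upd_eq_max]
  | succ N ih =>
    intro u
    have e : n - ((N + 1 : ℕ) : ℤ) - 1 = n - 1 - ((N + 1 : ℕ) : ℤ) := by ring
    have hd : drift w n (N + 1 + 1) = drift w n (N + 1) +
      ((w (n - ((N + 1 : ℕ) : ℤ) - 1)).1 - (w (n - ((N + 1 : ℕ) : ℤ) - 1)).2) := by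
      rw [drift, Finset.sum_range_succ, e]; rfl
    rw [resetRun_eq, run_succ_start, ih, ih, hd, upd_eq_max, ← max_add_add_right, max_assoc]
    congr 1; ring

lemma resetRun_succ (w : Config) (n : ℤ) (N : ℕ) :
    resetRun w n (N + 1) =
      max ((w (n - (N + 1 : ℕ) - 1)).1 + drift w n (N + 1)) (resetRun w n N) := by
  rw [resetRun_eq, run_eq_max]

lemma resetRun_mono (w : Config) (n : ℤ) : Monotone (resetRun w n) :=
  monotone_nat_of_le_succ fun N => by rw [resetRun_succ]; exact le_max_right _ _

/-- By `resetRun_succ` each further reset run adds one term to a maximum. The second clause of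
`Draining` pushes these terms below `resetRun w n 0`, so the sequence becomes constant and the
supremum is attained. -/
lemma Draining.eventually_resetRun {w : Config} (h : Draining w) (n : ℤ) :
    ∀ᶠ N in atTop, resetRun w n N = carrier w n := by
  obtain ⟨N₀, hN₀⟩ := eventually_atTop.1 ((h n).2.eventually (eventually_le_atBot (resetRun w n 0)))
  have hc : ∀ N, N₀ ≤ N → resetRun w n N = resetRun w n N₀ := fun N hN => by
    induction N, hN using Nat.le_induction with
    | base => rfl
    | succ N hN ih =>
      rw [resetRun_succ, max_eq_right, ih]
      exact (hN₀ (N + 1) (by omega)).trans (resetRun_mono w n (Nat.zero_le N))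
  have hle : ∀ N, resetRun w n N ≤ resetRun w n N₀ := fun N => by
    rcases le_total N N₀ with h | h
    · exact resetRun_mono w n h
    · exact (hc N h).le
  filter_upwards [eventually_ge_atTop N₀] with N hN
  rw [hc N hN]
  exact le_antisymm (le_ciSup (f := resetRun w n) ⟨_, by rintro _ ⟨N, rfl⟩; exact hle N⟩ N₀)
    (ciSup_le hle)

/-- Coupling from the past: the first clause of `Draining` makes the term carrying the start `u`
lose in `run_eq_max`. -/
lemma Draining.eventually_run {w : Config} (h : Draining w) (n : ℤ) (u : ℝ) :
    ∀ᶠ N in atTop, run w u n N = carrier w n := by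
  have h1 := (h n).1.eventually (eventually_le_atBot (resetRun w n 0 - u))
  rw [← map_add_atTop_eq_nat 1, eventually_map]
  filter_upwards [h.eventually_resetRun n, (tendsto_add_atTop_nat 1).eventually h1] with N h2 h3
  rw [run_eq_max, h2, max_eq_right]
  have := resetRun_mono w n (Nat.zero_le N)
  linarith

lemma Draining.isCarrier {w : Config} (h : Draining w) : IsCarrier w (carrier w) := fun n => by
  obtain ⟨N, h1, h2⟩ := (((tendsto_add_atTop_nat 1).eventually
    (h.eventually_resetRun (n + 1))).and (h.eventually_resetRun n)).exists
  rw [← h1, ← h2, resetRun, run, add_sub_cancel_right, resetRun]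
  congr 3; push_cast; ring_nf

/-- Arbitrarily long runs of sites with values in `B` occur arbitrarily far to the left. -/
def HasBlocks (B : Set (ℝ × ℝ)) (w : Config) : Prop :=
  ∀ (L : ℕ) (N : ℤ), ∃ j : ℤ, j + L ≤ N ∧ ∀ i : ℕ, i ≤ L → w (j + i) ∈ B

/-- Long runs of increments bounded away from zero with a fixed sign. -/
def Oscillating (w : Config) : Prop := ∃ δ > 0, ∃ K : ℝ,
  HasBlocks {p | -K ≤ p.1 ∧ δ ≤ p.2 - p.1} w ∨ HasBlocks {p | -K ≤ p.1 ∧ δ ≤ p.1 - p.2} w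

/-- The environment `(Q_{n+1}, E_n)` of the carrier in the configuration `(Q_n, E_n)`. -/
def stagger (x : Config) : Config := fun n => ((x (n + 1)).1, (x n).2)

/-- The inverse of `stagger`. -/
def unstagger (w : Config) : Config := fun n => ((w (n - 1)).1, (w n).2)

/-- Spatial reflection. -/
def reflect (w : Config) : Config := fun n => w (-n)

lemma exists_primitive (d : ℤ → ℝ) : ∃ S : ℤ → ℝ, ∀ n, S (n + 1) = S n + d n := by
  refine ⟨fun n => ∑ i ∈ Finset.Ico 0 n, d i - ∑ i ∈ Finset.Ico n 0, d i, fun n => ?_⟩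
  dsimp only
  rcases le_or_gt 0 n with h | h
  · rw [Finset.Ico_eq_empty_of_le h, Finset.Ico_eq_empty_of_le (by omega : (0:ℤ) ≤ n + 1)]
    have : Finset.Ico 0 (n + 1) = insert n (Finset.Ico 0 n) := by
      ext i; simp only [Finset.mem_Ico, Finset.mem_insert]; omega
    rw [this, Finset.sum_insert (by simp)]; simp; ring
  · rw [Finset.Ico_eq_empty_of_le h.le, Finset.Ico_eq_empty_of_le (by omega : n + 1 ≤ (0:ℤ))]
    have : Finset.Ico n 0 = insert n (Finset.Ico (n + 1) 0) := by
      ext i; simp only [Finset.mem_Ico, Finset.mem_insert]; omega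
    rw [this, Finset.sum_insert (by simp)]; simp

/-- If the dynamics can be continued for a second step, the carrier of an oscillating environment
has resets. -/
lemma IsCarrier.hasResets {w : Config} {U V : ℤ → ℝ} (hw : Oscillating w) (h : IsCarrier w U)
    (h' : IsCarrier (stagger fun n => out (w n) (U n)) V) : HasResets w U := by
  by_contra hcon
  unfold HasResets at hcon
  push Not at hcon
  obtain ⟨N, hN⟩ := hcon
  obtain ⟨S, hS⟩ := exists_primitive fun n => (w n).1 - (w n).2
  -- Where the carrier exceeds `E` the new pair is the old one exchanged, so the environment of the
  -- next step has increments opposite to those of `S`, up to a telescoping term.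
  have hout : ∀ k ≤ N, out (w k) (U k) = ((w k).2, (w k).1) := fun k hk => by
    rw [out, min_eq_right (hN k hk).le, add_sub_cancel_right]
  have hmono : Monotone fun n => U n - S n := monotone_int_of_le_succ fun n => by
    have := add_sub_le_upd (w n) (U n)
    rw [h n, hS n]; linarith
  have hV : ∀ i, i + 1 ≤ N → V (i + 1) = upd ((w (i + 1)).2, (w i).1) (V i) := fun i hi => by
    rw [h' i, stagger]; simp only [hout (i + 1) hi, hout i (by omega)]
  have hVb : ∀ i, i ≤ N → (w i).2 ≤ V i := fun i hi => by
    have := hV (i - 1) (by omega)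
    rw [sub_add_cancel] at this
    rw [this]; exact fst_le_upd ((w i).2, (w (i - 1)).1) _
  -- Thus `V - E + S` is nondecreasing in the site. Together with `E ≤ V` this bounds `S` above on
  -- the whole left half-line.
  have hanti : ∀ m : ℕ, V (N - m) - (w (N - m)).2 + S (N - m) ≤ V N - (w N).2 + S N := fun m => by
    induction m with
    | zero => simp
    | succ m ih =>
      refine le_trans ?_ ih
      have e : (N - (m + 1 : ℕ) : ℤ) + 1 = N - m := by push_cast; ring
      have h1 := hV (N - (m + 1 : ℕ)) (by omega)
      have h2 := hS (N - (m + 1 : ℕ))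
      have h3 := add_sub_le_upd ((w (N - m)).2, (w (N - (m + 1 : ℕ))).1) (V (N - (m + 1 : ℕ)))
      rw [e] at h1 h2
      rw [← h1] at h3
      dsimp only at h3
      linarith
  set C := V N - (w N).2 + S N
  have hSC : ∀ j ≤ N, S j ≤ C := fun j hj => by
    obtain ⟨m, hm⟩ := Int.eq_ofNat_of_zero_le (sub_nonneg.2 hj)
    have e : (N - m : ℤ) = j := by linarith
    have h1 := hanti m
    rw [e] at h1
    have := hVb j hj
    linarith
  -- The lower bound: `Q_{j+1} ≤ U_{j+1}` and `U - S` is nondecreasing, so `S (j + 1) ≥ Q_{j+1} -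
  -- C'`.
  set C' := U N - S N
  have hSC' : ∀ j, j + 1 ≤ N → (w j).1 - S (j + 1) ≤ C' := fun j hj => by
    have h1 := hmono hj
    have h2 := fst_le_upd (w j) (U j)
    rw [← h j] at h2
    dsimp only at h1
    linarith
  obtain ⟨δ, hδ, K, hB | hB⟩ := hw
  -- `S` starts the block at most `C`, falls by `δ` at each step, yet ends it at least `-K - C'`.
  · obtain ⟨L, hL⟩ := exists_nat_gt ((C + C' + K) / δ)
    rw [div_lt_iff₀ hδ] at hL
    obtain ⟨j, hj, hjB⟩ := hB L (N - 1)
    have hs : ∀ i : ℕ, i ≤ L + 1 → S (j + i) ≤ S j - i * δ := fun i => by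
      induction i with
      | zero => intro _; simp
      | succ i ih =>
        intro hi
        have h1 := ih (by omega)
        have h2 := hS (j + i)
        have h3 := (hjB i (by omega)).2
        push_cast
        rw [← add_assoc, h2]; linarith
    have h1 := hs (L + 1) le_rfl
    have h2 := hSC' (j + L) (by omega)
    have h3 := (hjB L le_rfl).1
    have h4 := hSC j (by omega)
    push_cast at h1
    rw [← add_assoc] at h1
    linarith
  -- Here `S` is at least `-K - C'` after the first site of the block and then rises by `L * δ`,
  -- past `C`.
  · obtain ⟨L, hL⟩ := exists_nat_gt ((C + C' + K) / δ)
    rw [div_lt_iff₀ hδ] at hL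
    obtain ⟨j, hj, hjB⟩ := hB L (N - 1)
    have hs : ∀ i : ℕ, i ≤ L → S (j + 1) + i * δ ≤ S (j + 1 + i) := fun i => by
      induction i with
      | zero => intro _; simp
      | succ i ih =>
        intro hi
        have h1 := ih (by omega)
        have h2 := hS (j + 1 + i)
        have h3 := (hjB (i + 1) (by omega)).2
        push_cast at h3 ⊢
        have e : j + (i + 1 : ℤ) = j + 1 + i := by ring
        rw [e] at h3
        rw [← add_assoc, h2]; linarith
    have h1 := hs L le_rfl
    have h2 := hSC' j (by omega)
    have h3 := (hjB 0 (by omega)).1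
    have h4 := hSC (j + 1 + L) (by omega)
    simp only [Nat.cast_zero, add_zero] at h3
    linarith

end

/-! ### I.i.d. configurations: symmetries, blocks and drift. -/

section

section ProductMeasure

variable {α β : Type*} [MeasurableSpace α] [MeasurableSpace β]

/-- A bi-infinite product of product measures is the image of a product measure under zipping. -/
lemma map_zip_infinitePi (μ : Measure α) (ν : Measure α) [IsProbabilityMeasure μ]
    [IsProbabilityMeasure ν] (σ τ : ℤ → ℤ) (hσ : σ.Injective) (hτ : τ.Injective) :
    (Measure.infinitePi (fun p : ℤ × Bool => cond p.2 μ ν)).map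
      (fun w n => (w (σ n, true), w (τ n, false))) =
    Measure.infinitePi (fun _ : ℤ => μ.prod ν) := by
  have hc : ∀ b : Bool, IsProbabilityMeasure (cond b μ ν) := fun b => by
    cases b <;> simpa
  let f : ℤ × Bool → ℤ × Bool := fun p => (cond p.2 (σ p.1) (τ p.1), p.2)
  have hf : f.Injective := by
    rintro ⟨a, b⟩ ⟨a', b'⟩ h
    simp only [f, Prod.mk.injEq] at h
    obtain ⟨h1, rfl⟩ := h
    cases b
    · simp only [cond_false] at h1; rw [hτ h1]
    · simp only [cond_true] at h1; rw [hσ h1]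
  have h1 := Measure.map_infinitePi_infinitePi_of_inj (P := fun p : ℤ × Bool => cond p.2 μ ν) hf
  have h2 := Measure.infinitePi_map_curry (fun (_ : ℤ) (b : Bool) => cond b μ ν)
  have h3 := Measure.infinitePi_map_pi
    (μ := fun _ : ℤ => Measure.infinitePi fun b : Bool => cond b μ ν)
    (f := fun (_ : ℤ) (v : Bool → α) => (v true, v false)) (fun _ => by fun_prop)
  have h4 := Measure.infinitePi_map_eval_prod (P := fun b : Bool => cond b μ ν)
    (i := true) (j := false) (by simp)
  simp only [h4] at h3
  simp only [cond_true, cond_false] at h3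
  have h5 : (Measure.infinitePi (fun p : ℤ × Bool => cond p.2 μ ν)).map (fun ω i => ω (f i)) =
    Measure.infinitePi (fun p : ℤ × Bool => cond p.2 μ ν) := h1
  rw [← h3, ← h2]
  conv_rhs => rw [← h5, Measure.map_map (by fun_prop) (by fun_prop),
    Measure.map_map (by fun_prop) (by fun_prop)]
  rfl

lemma measurePreserving_rezip (μ : Measure α) (ν : Measure α) [IsProbabilityMeasure μ]
    [IsProbabilityMeasure ν] (σ τ : ℤ → ℤ) (hσ : σ.Injective) (hτ : τ.Injective) :
    MeasurePreserving (fun (w : ℤ → α × α) n => ((w (σ n)).1, (w (τ n)).2))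
      (Measure.infinitePi (fun _ : ℤ => μ.prod ν)) (Measure.infinitePi (fun _ : ℤ => μ.prod ν)) := by
  refine ⟨by fun_prop, ?_⟩
  rw [← map_zip_infinitePi μ ν id id Function.injective_id Function.injective_id,
    Measure.map_map (by fun_prop) (by fun_prop)]
  rw [map_zip_infinitePi μ ν id id Function.injective_id Function.injective_id,
    ← map_zip_infinitePi μ ν σ τ hσ hτ]
  rfl

end ProductMeasure

/-- The law of an i.i.d. configuration with marginal `μ.prod ν`. -/
abbrev iidLaw (μ ν : Measure ℝ) [IsProbabilityMeasure μ] [IsProbabilityMeasure ν] :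
    Measure Config := Measure.infinitePi (fun _ : ℤ => μ.prod ν)

variable (μ ν : Measure ℝ) [IsProbabilityMeasure μ] [IsProbabilityMeasure ν]

lemma measurePreserving_stagger : MeasurePreserving stagger (iidLaw μ ν) (iidLaw μ ν) :=
  measurePreserving_rezip μ ν (fun n => n + 1) id (add_left_injective 1) Function.injective_id

lemma measurePreserving_unstagger : MeasurePreserving unstagger (iidLaw μ ν) (iidLaw μ ν) :=
  measurePreserving_rezip μ ν (fun n => n - 1) id (sub_left_injective) Function.injective_id

lemma measurePreserving_reflect : MeasurePreserving reflect (iidLaw μ ν) (iidLaw μ ν) :=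
  measurePreserving_rezip μ ν (fun n => -n) (fun n => -n) neg_injective neg_injective

variable {μ ν}

/-- Blocks of values in a set of positive measure occur almost surely. -/
lemma ae_hasBlocks {B : Set (ℝ × ℝ)} (hB : MeasurableSet B) (hpos : μ.prod ν B ≠ 0) :
    ∀ᵐ w ∂iidLaw μ ν, HasBlocks B w := by
  unfold HasBlocks
  rw [ae_all_iff]; intro L
  rw [ae_all_iff]; intro N
  -- `g (m, i)` is the `i`-th site of the `m`-th block; the blocks are disjoint intervals of `L + 1`
  -- sites to the left of `N`.
  let g : ℕ × ℕ → ℤ := fun p => N - (L + 1) * (p.1 + 1) + p.2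
  let A : ℕ → Set Config := fun m =>
    ((({m} : Finset ℕ) ×ˢ Finset.range (L + 1)).image g : Set ℤ).pi fun _ => B
  have hg : Set.InjOn g {p | p.2 < L + 1} := by
    rintro ⟨a, b⟩ hb ⟨a', b'⟩ hb' h
    simp only [Set.mem_ofPred_eq] at hb hb'
    have h' : (L + 1 : ℤ) * a' + b = (L + 1) * a + b' := by
      simp only [g] at h; linarith
    have : a = a' := by
      rcases lt_trichotomy a a' with h1 | h1 | h1
      · have : (a : ℤ) + 1 ≤ a' := by exact_mod_cast h1
        nlinarith
      · exact h1
      · have : (a' : ℤ) + 1 ≤ a := by exact_mod_cast h1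
        nlinarith
    subst this
    simp only [Prod.mk.injEq, true_and]
    omega
  have hgen : ∀ s : Finset ℕ, (iidLaw μ ν) (⋂ m ∈ s, A m) = (μ.prod ν B ^ (L + 1)) ^ s.card := by
    intro s
    have e : (⋂ m ∈ s, A m) =
        (((s ×ˢ Finset.range (L + 1)).image g : Finset ℤ) : Set ℤ).pi fun _ => B := by
      ext w
      simp only [A, Set.mem_iInter, Set.mem_pi, Finset.coe_image, Set.mem_image, Finset.mem_coe,
        Finset.mem_product, Finset.mem_singleton]
      constructor
      · rintro h i ⟨p, hp, rfl⟩
        exact h p.1 hp.1 _ ⟨p, ⟨rfl, hp.2⟩, rfl⟩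
      · rintro h m hm i ⟨p, hp, rfl⟩
        exact h _ ⟨p, ⟨hp.1 ▸ hm, hp.2⟩, rfl⟩
    rw [e, Measure.infinitePi_pi _ (fun _ _ => hB), Finset.prod_const, Finset.card_image_of_injOn,
      Finset.card_product, Finset.card_range, mul_comm, pow_mul]
    refine hg.mono fun p hp => ?_
    simp only [Finset.coe_product, Set.mem_prod, Finset.mem_coe, Finset.mem_range] at hp
    exact hp.2
  have hA : ∀ m, (iidLaw μ ν) (A m) = μ.prod ν B ^ (L + 1) := fun m => by
    simpa using hgen {m}
  have hmeas : ∀ m, MeasurableSet (A m) := fun m =>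
    MeasurableSet.pi (Set.to_countable _) fun _ _ => hB
  have hind : iIndepSet A (iidLaw μ ν) := by
    rw [iIndepSet_iff_meas_biInter hmeas]
    intro s
    rw [hgen, Finset.prod_congr rfl (fun m _ => hA m), Finset.prod_const]
  -- Second Borel–Cantelli lemma: the block events are independent with the same positive
  -- probability.
  have hlim := measure_limsup_eq_one hmeas hind (by
    simp only [hA]
    exact ENNReal.tsum_const_eq_top_of_ne_zero (pow_ne_zero _ hpos))
  have hae : ∀ᵐ w ∂iidLaw μ ν, w ∈ limsup A atTop :=
    (prob_compl_eq_zero_iff (MeasurableSet.measurableSet_limsup hmeas)).2 hlim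
  filter_upwards [hae] with w hw
  rw [mem_limsup_iff_frequently_mem] at hw
  obtain ⟨m, hm⟩ := hw.exists
  refine ⟨N - (L + 1) * (m + 1), by nlinarith, fun i hi => ?_⟩
  apply hm
  simp only [Finset.coe_image, Set.mem_image, Finset.mem_coe, Finset.mem_product,
    Finset.mem_singleton, Finset.mem_range]
  exact ⟨(m, i), ⟨rfl, by omega⟩, rfl⟩

/-- Countably many sets with a quantitative gap and a lower bound on `Q` exhaust `{Q ≠ E}`, so one
of them has positive mass. No comparison of means enters, which the converse relies on. -/
lemma ae_oscillating (h : μ.prod ν {p | p.1 ≠ p.2} ≠ 0) :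
    ∀ᵐ w ∂iidLaw μ ν, Oscillating w := by
  let B₁ : ℕ → Set (ℝ × ℝ) := fun n => {p | -(n : ℝ) ≤ p.1 ∧ 1 / ((n : ℝ) + 1) ≤ p.2 - p.1}
  let B₂ : ℕ → Set (ℝ × ℝ) := fun n => {p | -(n : ℝ) ≤ p.1 ∧ 1 / ((n : ℝ) + 1) ≤ p.1 - p.2}
  have hcov : {p : ℝ × ℝ | p.1 ≠ p.2} ⊆ ⋃ n, (B₁ n ∪ B₂ n) := by
    rintro ⟨a, b⟩ hab
    have hpos : 0 < |a - b| := abs_pos.2 (sub_ne_zero.2 hab)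
    obtain ⟨n₁, hn₁⟩ := exists_nat_one_div_lt hpos
    obtain ⟨n₂, hn₂⟩ := exists_nat_ge (-a)
    have h1 : 1 / (((max n₁ n₂ : ℕ) : ℝ) + 1) ≤ |a - b| := by
      refine le_trans ?_ hn₁.le
      apply one_div_le_one_div_of_le (by positivity)
      gcongr; exact le_max_left _ _
    have h2 : -((max n₁ n₂ : ℕ) : ℝ) ≤ a := by
      have : (n₂ : ℝ) ≤ (max n₁ n₂ : ℕ) := by exact_mod_cast le_max_right _ _
      linarith
    refine Set.mem_iUnion.2 ⟨max n₁ n₂, ?_⟩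
    rcases le_total a b with hle | hle
    · left; refine ⟨h2, ?_⟩
      rwa [abs_sub_comm, abs_of_nonneg (sub_nonneg.2 hle)] at h1
    · right; refine ⟨h2, ?_⟩
      rwa [abs_of_nonneg (sub_nonneg.2 hle)] at h1
  have : ∃ n, μ.prod ν (B₁ n ∪ B₂ n) ≠ 0 := by
    by_contra! hcon
    exact h (measure_mono_null hcov (measure_iUnion_null hcon))
  obtain ⟨n, hn⟩ := this
  have h1 : MeasurableSet (B₁ n) := by
    simp only [B₁, Set.ofPred_and]
    exact (measurableSet_le (by fun_prop) (by fun_prop)).inter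
      (measurableSet_le (by fun_prop) (by fun_prop))
  have h2 : MeasurableSet (B₂ n) := by
    simp only [B₂, Set.ofPred_and]
    exact (measurableSet_le (by fun_prop) (by fun_prop)).inter
      (measurableSet_le (by fun_prop) (by fun_prop))
  have : μ.prod ν (B₁ n) ≠ 0 ∨ μ.prod ν (B₂ n) ≠ 0 := by
    by_contra! hcon
    exact hn (measure_union_null hcon.1 hcon.2)
  rcases this with h' | h'
  · filter_upwards [ae_hasBlocks h1 h'] with w hw
    exact ⟨1 / (n + 1), by positivity, n, Or.inl hw⟩
  · filter_upwards [ae_hasBlocks h2 h'] with w hw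
    exact ⟨1 / (n + 1), by positivity, n, Or.inr hw⟩

/-- The mean of `μ` is strictly smaller than that of (a function dominated by) `ν`. -/
def HasDrift (μ ν : Measure ℝ) : Prop :=
  Integrable id μ ∧ ∃ g : ℝ → ℝ, Measurable g ∧ (∀ y, g y ≤ y) ∧ Integrable g ν ∧
    ∫ y, y ∂μ < ∫ y, g y ∂ν

lemma HasDrift.prod_ne_zero (h : HasDrift μ ν) : μ.prod ν {p | p.1 ≠ p.2} ≠ 0 := by
  obtain ⟨hμ, g, hg, hle, hν, hlt⟩ := h
  intro h0
  have hae : ∀ᵐ p ∂μ.prod ν, p.1 = p.2 := h0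
  have h1 : ∫ y, y ∂μ = ∫ p, p.1 ∂μ.prod ν := by
    have := integral_fun_fst (μ := μ) (ν := ν) (fun y : ℝ => y)
    simpa using this.symm
  have h2 : ∫ y, g y ∂ν = ∫ p, g p.2 ∂μ.prod ν := by
    have := integral_fun_snd (μ := μ) (ν := ν) g
    simpa using this.symm
  rw [h1, h2] at hlt
  refine hlt.not_ge (integral_mono_ae (hν.comp_snd μ) (hμ.comp_fst ν) ?_)
  filter_upwards [hae] with p hp
  rw [hp]; exact hle _

/-- The strong law is applied to `Q - g E`, which is integrable and dominates `Q - E`; so `E` itself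
needs no first moment. -/
lemma HasDrift.ae_tendsto_drift (h : HasDrift μ ν) (n : ℤ) :
    ∀ᵐ w ∂iidLaw μ ν, Tendsto (drift w n) atTop atBot := by
  obtain ⟨hμ, g, hg, hle, hν, hlt⟩ := h
  let φ : ℝ × ℝ → ℝ := fun p => p.1 - g p.2
  have hφ : Measurable φ := by fun_prop
  have hφi : Integrable φ (μ.prod ν) := (hμ.comp_fst ν).sub (hν.comp_snd μ)
  let X : ℕ → Config → ℝ := fun i w => φ (w (n - 1 - i))
  have hev : ∀ k : ℤ, MeasurePreserving (fun w : Config => w k) (iidLaw μ ν) (μ.prod ν) := fun k =>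
    measurePreserving_eval_infinitePi _ k
  have hind : iIndepFun (fun (k : ℤ) (w : Config) => φ (w k)) (iidLaw μ ν) :=
    iIndepFun_infinitePi (P := fun _ : ℤ => μ.prod ν) (X := fun _ => φ) (fun _ => hφ)
  have hmean : ∫ w, X 0 w ∂iidLaw μ ν < 0 := by
    have e1 : ∫ w, X 0 w ∂iidLaw μ ν = ∫ p, φ p ∂μ.prod ν := by
      rw [← (hev (n - 1 - (0 : ℕ))).map_eq, integral_map (hev _).measurable.aemeasurable (by fun_prop)]
    have e2 : ∫ p, φ p ∂μ.prod ν = ∫ y, y ∂μ - ∫ y, g y ∂ν := by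
      have h1 := integral_fun_fst (μ := μ) (ν := ν) (fun y : ℝ => y)
      have h2 := integral_fun_snd (μ := μ) (ν := ν) g
      simp only [probReal_univ, one_smul] at h1 h2
      rw [← h1, ← h2]
      exact integral_sub (hμ.comp_fst ν) (hν.comp_snd μ)
    rw [e1, e2]; linarith
  have hlln := strong_law_ae_real X ((hev _).integrable_comp_of_integrable hφi)
    (fun i j hij => hind.indepFun (by simpa using hij)) (fun i => ⟨by fun_prop, by fun_prop, by
      have e : ∀ k : ℤ, Measure.map (fun w : Config => φ (w k)) (iidLaw μ ν)
          = (μ.prod ν).map φ := fun k => by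
        rw [← (hev k).map_eq, Measure.map_map hφ (by fun_prop)]; rfl
      exact (e _).trans (e _).symm⟩)
  filter_upwards [hlln] with w hw
  have h1 : Tendsto (fun N : ℕ => (∑ i ∈ Finset.range N, X i w) / N * N) atTop atBot :=
    hw.neg_mul_atTop hmean tendsto_natCast_atTop_atTop
  refine tendsto_atBot_mono' _ ?_ h1
  filter_upwards [eventually_gt_atTop 0] with N hN
  rw [div_mul_cancel₀ _ (by positivity : (N : ℝ) ≠ 0), drift]
  refine Finset.sum_le_sum fun i _ => ?_
  have := hle (w (n - 1 - i)).2
  simp only [X, φ]; linarith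

lemma HasDrift.ae_draining (h : HasDrift μ ν) : ∀ᵐ w ∂iidLaw μ ν, Draining w := by
  unfold Draining
  rw [ae_all_iff]; intro n
  have h2 := (measurePreserving_unstagger μ ν).quasiMeasurePreserving.ae (h.ae_tendsto_drift n)
  filter_upwards [h.ae_tendsto_drift n, h2] with w hw hw2
  refine ⟨hw, ?_⟩
  -- Moving the extra `Q` into the sum pairs each `E` with the `Q` one site further left, which is
  -- the drift of the unstaggered configuration; that configuration has the same law.
  have e : ∀ N : ℕ, (w (n - N - 1)).1 + drift w n N = (w (n - 1)).1 + drift (unstagger w) n N := by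
    intro N
    induction N with
    | zero => simp [drift]
    | succ N ih =>
      have e1 : n - ((N + 1 : ℕ) : ℤ) - 1 = n - 1 - N - 1 := by push_cast; ring
      have e2 : n - (N : ℤ) - 1 = n - 1 - N := by ring
      rw [drift, drift, Finset.sum_range_succ, Finset.sum_range_succ, e1]
      rw [drift, drift, e2] at ih
      simp only [unstagger] at ih ⊢
      linarith
  simp only [e]
  exact tendsto_atBot_add_const_left _ _ hw2

end

/-! ### Detailed balance and a Burke-type theorem. -/

section

/-- The one-site evolution `((Q_{n+1}, E_n), U_n) ↦ ((Q'_n, E'_n), U_{n+1})`. -/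
def site (p : (ℝ × ℝ) × ℝ) : (ℝ × ℝ) × ℝ := (out p.1 p.2, upd p.1 p.2)

@[fun_prop]
lemma measurable_site : Measurable site := by
  unfold site out upd; fun_prop

lemma _root_.Measurable.upd {Ω : Type*} {m : MeasurableSpace Ω} {f : Ω → ℝ × ℝ} {g : Ω → ℝ}
    (hf : Measurable f) (hg : Measurable g) : Measurable fun ω => upd (f ω) (g ω) := by
  unfold UDToda.upd; fun_prop

lemma _root_.Measurable.out {Ω : Type*} {m : MeasurableSpace Ω} {f : Ω → ℝ × ℝ} {g : Ω → ℝ}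
    (hf : Measurable f) (hg : Measurable g) : Measurable fun ω => out (f ω) (g ω) := by
  unfold UDToda.out; fun_prop

lemma _root_.Measurable.run {Ω : Type*} {m : MeasurableSpace Ω} {f : Ω → Config} {g : Ω → ℝ}
    (N : ℕ) : ∀ (n : ℤ), (∀ k, n - N ≤ k → k < n → Measurable fun ω => f ω k) → Measurable g →
    Measurable fun ω => run (f ω) (g ω) n N := by
  induction N with
  | zero => intro n _ hg; simpa [UDToda.run] using hg
  | succ N ih =>
    intro n hf hg
    simp only [UDToda.run]
    push_cast at hf
    exact (hf (n - 1) (by omega) (by omega)).upd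
      (ih (n - 1) (fun k h1 h2 => hf k (by omega) (by omega)) hg)

lemma _root_.Measurable.carrier {Ω : Type*} {m : MeasurableSpace Ω} {f : Ω → Config} (n : ℤ)
    (hf : ∀ k < n, Measurable fun ω => f ω k) : Measurable fun ω => carrier (f ω) n := by
  unfold UDToda.carrier
  refine Measurable.iSup fun N => ?_
  exact Measurable.run (N + 1) n (fun k _ h => hf k h) (hf (n - N - 1) (by omega)).snd

lemma measurable_canonicalOut : Measurable canonicalOut :=
  measurable_pi_iff.2 fun n => (measurable_pi_apply n).out
    (Measurable.carrier n fun k _ => measurable_pi_apply k)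

variable {μ ν ρ : Measure ℝ} [IsProbabilityMeasure μ] [IsProbabilityMeasure ν]
  [IsProbabilityMeasure ρ]

/-- Detailed balance for the one-site evolution. -/
def Balanced (μ ν ρ : Measure ℝ) : Prop :=
  ((μ.prod ν).prod ρ).map site = (μ.prod ν).prod ρ

/-- The law of an i.i.d. configuration together with an independent carrier variable. -/
abbrev extLaw (μ ν ρ : Measure ℝ) [IsProbabilityMeasure μ] [IsProbabilityMeasure ν]
    [IsProbabilityMeasure ρ] : Measure (Option ℤ → ℝ × ℝ) :=
  @Measure.infinitePi (Option ℤ) (fun _ => ℝ × ℝ) _ (fun o => o.elim (ρ.prod ρ) fun _ => μ.prod ν)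

instance (o : Option ℤ) :
    IsProbabilityMeasure (o.elim (ρ.prod ρ) fun _ : ℤ => μ.prod ν : Measure (ℝ × ℝ)) := by
  cases o <;> simp <;> infer_instance

/-- The configuration part of an element of the extended space. -/
def envOf (ω : Option ℤ → ℝ × ℝ) : Config := fun n => ω (some n)

lemma measurable_envOf : Measurable envOf := by unfold envOf; fun_prop

lemma map_envOf : (extLaw μ ν ρ).map envOf = iidLaw μ ν :=
  Measure.map_infinitePi_infinitePi_of_inj (ι := Option ℤ)
    (P := fun o => o.elim (ρ.prod ρ) fun _ => μ.prod ν) (Option.some_injective ℤ)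

/-- The carrier started from the independent variable at site `n₀`, after `k` steps. -/
def carrierFrom (n₀ : ℤ) (k : ℕ) (ω : Option ℤ → ℝ × ℝ) : ℝ := run (envOf ω) (ω none).1 (n₀ + k) k

lemma carrierFrom_succ (n₀ : ℤ) (k : ℕ) (ω : Option ℤ → ℝ × ℝ) :
    carrierFrom n₀ (k + 1) ω = upd (ω (some (n₀ + k))) (carrierFrom n₀ k ω) := by
  have e : n₀ + ((k + 1 : ℕ) : ℤ) - 1 = n₀ + k := by push_cast; ring
  simp only [carrierFrom, run, e]; rfl

/-- The σ-algebra generated by one coordinate of the extended space. -/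
abbrev coordAlg (o : Option ℤ) : MeasurableSpace (Option ℤ → ℝ × ℝ) :=
  MeasurableSpace.comap (fun ω => ω o) inferInstance

/-- The coordinates that influence `carrierFrom n₀ k` for `k ≤ L`. -/
def pastIdx (n₀ : ℤ) (L : ℕ) : Set (Option ℤ) :=
  insert none {o | ∃ k < L, o = some (n₀ + (k : ℕ))}

/-- The σ-algebra generated by the coordinates in `pastIdx n₀ L`. -/
abbrev pastAlg (n₀ : ℤ) (L : ℕ) : MeasurableSpace (Option ℤ → ℝ × ℝ) :=
  ⨆ o ∈ pastIdx n₀ L, coordAlg o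

/-- On any event about the earlier outputs the carrier still has law proportional to `ρ`: this is
the induction hypothesis, for all `B` at once. The environment at the next site is independent of
this past, so `site` acts on a product law and balance returns a product. -/
lemma Balanced.extLaw_eq (hb : Balanced μ ν ρ) (n₀ : ℤ) (t : ℕ → Set (ℝ × ℝ))
    (ht : ∀ k, MeasurableSet (t k)) (L : ℕ) : ∀ (B : Set ℝ), MeasurableSet B →
    extLaw μ ν ρ {ω | (∀ k < L, out (ω (some (n₀ + k))) (carrierFrom n₀ k ω) ∈ t k) ∧
      carrierFrom n₀ L ω ∈ B} = (∏ k ∈ Finset.range L, μ.prod ν (t k)) * ρ B := by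
  induction L with
  | zero =>
    intro B hB
    have h1 := (measurePreserving_eval_infinitePi (ι := Option ℤ) (X := fun _ => ℝ × ℝ)
      (fun o => o.elim (ρ.prod ρ) fun _ => μ.prod ν) none)
    -- The `none` coordinate is a pair only so that all coordinates share one type; its first entry
    -- starts the carrier.
    have h2 := (measurePreserving_fst (μ := ρ) (ν := ρ)).comp h1
    have h3 := h2.measure_preimage hB.nullMeasurableSet
    simp only [carrierFrom, run, Finset.range_zero, Finset.prod_empty, one_mul]
    refine Eq.trans (congrArg _ ?_) h3
    ext; simp
  | succ L ih =>
    intro B hB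
    let A : Set (Option ℤ → ℝ × ℝ) :=
      {ω | ∀ k < L, out (ω (some (n₀ + k))) (carrierFrom n₀ k ω) ∈ t k}
    let z : (Option ℤ → ℝ × ℝ) → ℝ × ℝ := fun ω => ω (some (n₀ + L))
    have hpast_le : (pastAlg n₀ L) ≤ MeasurableSpace.pi :=
      iSup₂_le fun o _ => (measurable_pi_apply o).comap_le
    have hcoord : ∀ o ∈ pastIdx n₀ L, Measurable[pastAlg n₀ L] fun ω : Option ℤ → ℝ × ℝ => ω o := fun o ho =>
      (Measurable.of_comap_le le_rfl).mono (le_iSup₂ (f := fun o (_ : o ∈ pastIdx n₀ L) => coordAlg o) o ho) le_rfl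
    have hcar : ∀ k ≤ L, Measurable[pastAlg n₀ L] (carrierFrom n₀ k) := fun k hk => by
      unfold carrierFrom
      refine @Measurable.run _ (pastAlg n₀ L) _ _ k _ (fun j h1 h2 => ?_)
        (measurable_fst.comp (hcoord none (Set.mem_insert _ _)))
      refine hcoord (some j) (Set.mem_insert_of_mem _ ⟨(j - n₀).toNat, by omega, ?_⟩)
      congr 1; omega
    have hA : MeasurableSet[pastAlg n₀ L] A := by
      have : A = ⋂ k ∈ Finset.range L,
          (fun ω => out (ω (some (n₀ + k))) (carrierFrom n₀ k ω)) ⁻¹' t k := by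
        ext ω; simp [A]
      rw [this]
      refine Finset.measurableSet_biInter _ fun k hk => ?_
      rw [Finset.mem_range] at hk
      exact (@Measurable.out _ (pastAlg n₀ L) _ _ (hcoord _ (Set.mem_insert_of_mem _ ⟨k, hk, rfl⟩))
        (hcar k hk.le)) (ht k)
    have hz : Measurable z := measurable_pi_apply _
    have hU : Measurable (carrierFrom n₀ L) := (hcar L le_rfl).mono hpast_le le_rfl
    have hzlaw : (extLaw μ ν ρ).map z = μ.prod ν :=
      Measure.infinitePi_map_eval (ι := Option ℤ) (X := fun _ => ℝ × ℝ)
        (fun o => o.elim (ρ.prod ρ) fun _ => μ.prod ν) (some (n₀ + L))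
    have hiI : iIndep coordAlg (extLaw μ ν ρ) :=
      iIndepFun_infinitePi (ι := Option ℤ) (P := fun o => o.elim (ρ.prod ρ) fun _ => μ.prod ν)
        (X := fun _ ω => ω) (fun _ => measurable_id)
    have hind : Indep (pastAlg n₀ L) (⨆ o ∈ ({some (n₀ + L)} : Set (Option ℤ)), coordAlg o) (extLaw μ ν ρ) := by
      refine indep_iSup_of_disjoint (fun o => (measurable_pi_apply o).comap_le) hiI ?_
      rw [Set.disjoint_singleton_right]
      rintro (h | ⟨k, hk, h⟩)
      · simp at h
      · simp only [Option.some.injEq, add_right_inj, Nat.cast_inj] at h; omega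
    rw [iSup_singleton] at hind
    have hprod : (μ.prod ν).prod (((extLaw μ ν ρ).restrict A).map (carrierFrom n₀ L)) =
        ((extLaw μ ν ρ).restrict A).map (fun ω => (z ω, carrierFrom n₀ L ω)) := by
      refine Measure.prod_eq fun D B hD hB => ?_
      rw [Measure.map_apply (hz.prodMk hU) (hD.prod hB), Measure.map_apply hU hB,
        Measure.restrict_apply (hU hB), Measure.restrict_apply (hz.prodMk hU (hD.prod hB)),
        ← hzlaw, Measure.map_apply hz hD]
      rw [Indep_iff] at hind
      have := hind (carrierFrom n₀ L ⁻¹' B ∩ A) (z ⁻¹' D) ((hcar L le_rfl hB).inter hA)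
        ⟨D, hD, rfl⟩
      rw [mul_comm, ← this]
      congr 1; ext ω; simp only [Set.mem_inter_iff, Set.mem_preimage, Set.mem_prod]; tauto
    have hmarg : ((extLaw μ ν ρ).restrict A).map (carrierFrom n₀ L) =
        (∏ k ∈ Finset.range L, μ.prod ν (t k)) • ρ := by
      ext B hB
      rw [Measure.map_apply hU hB, Measure.restrict_apply (hU hB), Measure.smul_apply,
        smul_eq_mul, ← ih B hB]
      congr 1; ext ω; simp only [A, Set.mem_inter_iff, Set.mem_preimage, Set.mem_ofPred_eq]
      tauto
    have hC : MeasurableSet (site ⁻¹' (t L ×ˢ B)) := measurable_site ((ht L).prod hB)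
    have e : {ω | (∀ k < L + 1, out (ω (some (n₀ + k))) (carrierFrom n₀ k ω) ∈ t k) ∧
        carrierFrom n₀ (L + 1) ω ∈ B} =
        ((fun ω => (z ω, carrierFrom n₀ L ω)) ⁻¹' (site ⁻¹' (t L ×ˢ B))) ∩ A := by
      ext ω
      simp only [A, z, site, carrierFrom_succ, Order.lt_add_one_iff, Set.mem_inter_iff,
        Set.mem_preimage, Set.mem_prod, Set.mem_ofPred_eq]
      constructor
      · rintro ⟨h1, h2⟩; exact ⟨⟨h1 L le_rfl, h2⟩, fun k hk => h1 k hk.le⟩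
      · rintro ⟨⟨h1, h2⟩, h3⟩
        refine ⟨fun k hk => ?_, h2⟩
        rcases hk.lt_or_eq with h | rfl
        · exact h3 k h
        · exact h1
    rw [e, ← Measure.restrict_apply (hz.prodMk hU hC), ← Measure.map_apply (hz.prodMk hU) hC,
      ← hprod, hmarg, Measure.prod_smul_right, Measure.smul_apply,
      ← Measure.map_apply measurable_site ((ht L).prod hB), hb, Measure.prod_prod,
      Finset.prod_range_succ, smul_eq_mul, mul_assoc]

/-- A Burke-type theorem: under detailed balance the canonical dynamics preserve the i.i.d. law. -/
theorem Balanced.measurePreserving (hb : Balanced μ ν ρ)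
    (hd : ∀ᵐ w ∂iidLaw μ ν, Draining w) :
    MeasurePreserving canonicalOut (iidLaw μ ν) (iidLaw μ ν) := by
  refine ⟨measurable_canonicalOut, Measure.eq_infinitePi _ fun s t ht => ?_⟩
  have hpi : MeasurableSet ((s : Set ℤ).pi t) := MeasurableSet.pi (Set.to_countable _) fun i _ => ht i
  rw [Measure.map_apply measurable_canonicalOut hpi, ← map_envOf (ρ := ρ),
    Measure.map_apply measurable_envOf (measurable_canonicalOut hpi)]
  -- The output event with the canonical carrier replaced by one started at site `-N`, which is `i +
  -- N` steps before `i`.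
  let D : ℕ → Set (Option ℤ → ℝ × ℝ) := fun N =>
    {ω | ∀ i ∈ s, out (ω (some i)) (run (envOf ω) (ω none).1 i (i + N).toNat) ∈ t i}
  have hD : ∀ N, MeasurableSet (D N) := fun N => by
    have : D N = ⋂ i ∈ s,
        (fun ω => out (ω (some i)) (run (envOf ω) (ω none).1 i (i + N).toNat)) ⁻¹' t i := by
      ext ω; simp [D]
    rw [this]
    refine Finset.measurableSet_biInter _ fun i hi => ?_
    exact ((measurable_pi_apply (some i)).out (Measurable.run _ _
      (fun k _ _ => measurable_pi_apply (some k)) (measurable_pi_apply none).fst)) (ht i)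
  have hd' : ∀ᵐ ω ∂extLaw μ ν ρ, Draining (envOf ω) := by
    apply ae_of_ae_map (p := Draining) measurable_envOf.aemeasurable
    rw [map_envOf]; exact hd
  -- By draining, the two carriers agree at the finitely many sites of `s` once `N` is large, so the
  -- indicators converge.
  have hlim := tendsto_measure_of_ae_tendsto_indicator_of_isFiniteMeasure atTop
    (measurable_envOf (measurable_canonicalOut hpi)) hD (μ := extLaw μ ν ρ) (by
      filter_upwards [hd'] with ω hω
      have : ∀ i ∈ s, ∀ᶠ N : ℕ in atTop,
          run (envOf ω) (ω none).1 i (i + N).toNat = carrier (envOf ω) i := fun i _ => by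
        have h1 : Tendsto (fun N : ℕ => (i + N).toNat) atTop atTop :=
          tendsto_atTop_atTop.2 fun b => ⟨(b - i).toNat, fun a ha => by omega⟩
        exact h1.eventually (hω.eventually_run i _)
      filter_upwards [(Finset.eventually_all s).2 this] with N hN
      simp only [D, Set.mem_preimage, Set.mem_pi, Finset.mem_coe, Set.mem_ofPred_eq]
      refine forall₂_congr fun i hi => ?_
      rw [hN i hi]; rfl)
  refine tendsto_nhds_unique hlim (tendsto_const_nhds.congr' ?_)
  have hs : ∀ᶠ N : ℕ in atTop, ∀ i ∈ s, -(N : ℤ) ≤ i ∧ i < N :=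
    (Finset.eventually_all s).2 fun i _ => by
      filter_upwards [eventually_ge_atTop (i.natAbs + 1)] with N hN
      omega
  filter_upwards [hs] with N hN
  classical
  -- The window `[-N, N)` contains `s`; sites of it outside `s` carry no constraint.
  let t' : ℕ → Set (ℝ × ℝ) := fun k => if -(N : ℤ) + k ∈ s then t (-(N : ℤ) + k) else Set.univ
  have ht' : ∀ k, MeasurableSet (t' k) := fun k => by
    simp only [t']; split_ifs
    · exact ht _
    · exact MeasurableSet.univ
  have key := hb.extLaw_eq (-(N : ℤ)) t' ht' (2 * N) Set.univ MeasurableSet.univ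
  have e : D N = {ω | (∀ k < 2 * N, out (ω (some (-(N : ℤ) + k))) (carrierFrom (-(N : ℤ)) k ω) ∈ t' k) ∧
      carrierFrom (-(N : ℤ)) (2 * N) ω ∈ Set.univ} := by
    ext ω
    simp only [D, t', carrierFrom, Set.mem_univ, and_true, Set.mem_ofPred_eq]
    constructor
    · intro h k hk
      split_ifs with hks
      · have := h _ hks
        have e1 : (-(N : ℤ) + k + N).toNat = k := by omega
        rwa [e1] at this
      · trivial
    · intro h i hi
      have := h (i + N).toNat (by have := hN i hi; omega)
      have e1 : -(N : ℤ) + ((i + N).toNat : ℤ) = i := by have := hN i hi; omega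
      rw [e1, if_pos hi] at this
      exact this
  rw [e, key, measure_univ, mul_one]
  symm
  refine Finset.prod_bij_ne_one (fun k _ _ => -(N : ℤ) + k) ?_ ?_ ?_ ?_
  · intro k hk h
    by_contra hks
    simp [t', hks] at h
  · intro k _ _ k' _ _ h; omega
  · intro i hi _
    have := hN i hi
    have e1 : -(N : ℤ) + ((i + N).toNat : ℤ) = i := by omega
    refine ⟨(i + N).toNat, by rw [Finset.mem_range]; omega, ?_, e1⟩
    simp only [t', e1, if_pos hi]; assumption
  · intro k _ h
    by_cases hks : -(N : ℤ) + k ∈ s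
    · simp [t', hks]
    · simp [t', hks] at h

end

/-! ### Trajectories: the canonical solution and its uniqueness. -/

section

@[simp] lemma stagger_unstagger (w : Config) : stagger (unstagger w) = w := by
  funext n; simp [stagger, unstagger]

/-- `(y, U)` is carried to `y'` by one time step of the ultra-discrete Toda equation. -/
def Step (y : Config) (U : ℤ → ℝ) (y' : Config) : Prop :=
  IsCarrier (stagger y) U ∧ y' = fun n => out (stagger y n) (U n)

lemma Step.out_eq {y y' : Config} {U : ℤ → ℝ} (h : Step y U y') (n : ℤ) :
    out (y' n) (U (n + 1)) = stagger y n := by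
  rw [h.2, h.1 n]; exact out_out _ _

lemma Step.upd_eq {y y' : Config} {U : ℤ → ℝ} (h : Step y U y') (n : ℤ) :
    upd (y' n) (U (n + 1)) = U n := by
  rw [h.2, h.1 n]; exact upd_out _ _

/-- The configuration at time `t`. -/
def slice (Q E : ℤ → ℤ → ℝ) (t : ℤ) : Config := fun n => (Q t n, E t n)

lemma isSolution_iff {x : Config} {Q E U : ℤ → ℤ → ℝ} :
    IsSolution x Q E U ↔
      slice Q E 0 = x ∧ ∀ t, Step (slice Q E t) (U t) (slice Q E (t + 1)) := by
  constructor
  · intro h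
    refine ⟨funext fun n => Prod.ext (h.init_Q n) (h.init_E n), fun t => ⟨fun n => ?_, ?_⟩⟩
    · rw [h.step_U, h.step_Q, upd]
      simp only [stagger, slice]
      rcases le_total (U t n) (E t n) with hle | hle
      · rw [min_eq_left hle, max_eq_right (by linarith)]; ring
      · rw [min_eq_right hle, max_eq_left (by linarith)]; ring
    · funext n
      simp only [slice, out, stagger, h.step_E, h.step_Q]
  · rintro ⟨h0, h⟩
    have h1 : ∀ t n, Q (t + 1) n = min (U t n) (E t n) := fun t n =>
      congrArg Prod.fst (congrFun (h t).2 n)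
    have h2 : ∀ t n, E (t + 1) n = Q t (n + 1) + E t n - min (U t n) (E t n) := fun t n =>
      congrArg Prod.snd (congrFun (h t).2 n)
    refine ⟨fun n => congrArg Prod.fst (congrFun h0 n), fun n => congrArg Prod.snd (congrFun h0 n),
      h1, fun t n => ?_, fun t n => ?_⟩
    · rw [h2, h1]
    · rw [(h t).1 n, h1, upd]
      simp only [stagger, slice]
      rcases le_total (U t n) (E t n) with hle | hle
      · rw [min_eq_left hle, max_eq_right (by linarith)]; ring
      · rw [min_eq_right hle, max_eq_left (by linarith)]; ring

/-- One canonical time step forwards. -/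
def fwd (y : Config) : Config := canonicalOut (stagger y)

/-- One canonical time step backwards. -/
def bwd (y : Config) : Config := unstagger (reflect (canonicalOut (reflect y)))

/-- The carrier of the canonical backward time step. -/
def bwdCarrier (y : Config) : ℤ → ℝ := fun n => carrier (reflect y) (1 - n)

lemma step_fwd {y : Config} (h : Draining (stagger y)) : Step y (carrier (stagger y)) (fwd y) :=
  ⟨h.isCarrier, rfl⟩

/-- By the involution, `U` read from right to left is a carrier whose environment is `y` itself,
without stagger. Its outputs are the staggered earlier configuration, hence the `unstagger` in
`bwd`. -/
lemma step_bwd {y : Config} (h : Draining (reflect y)) : Step (bwd y) (bwdCarrier y) y := by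
  have h1 : ∀ n, bwdCarrier y n = upd (y n) (bwdCarrier y (n + 1)) := fun n => by
    have := h.isCarrier (-n)
    simp only [bwdCarrier]
    have e1 : 1 - (n + 1) = -n := by ring
    have e2 : 1 - n = -n + 1 := by ring
    rw [e1, e2, this, reflect, neg_neg]
  have h2 : ∀ n, stagger (bwd y) n = out (y n) (bwdCarrier y (n + 1)) := fun n => by
    have e1 : 1 - (n + 1) = -n := by ring
    simp only [bwd, stagger_unstagger, bwdCarrier, e1]
    simp only [reflect, canonicalOut, neg_neg]
  refine ⟨fun n => ?_, funext fun n => ?_⟩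
  · rw [h2, h1 n, upd_out]
  · rw [h2, h1 n, out_out]

/-- The reflection of a step is a carrier recursion run backwards in time. -/
lemma Step.isCarrier_reflect {y y' : Config} {U : ℤ → ℝ} (h : Step y U y') :
    IsCarrier (reflect y') (fun n => U (1 - n)) := fun n => by
  have := h.upd_eq (-n)
  have e1 : 1 - (n + 1) = -n := by ring
  have e2 : 1 - n = -n + 1 := by ring
  simp only [e1, e2, reflect]
  exact this.symm

/-- In mirrored time the environment met by the next step is `reflect y`, so the step leading to `y`
supplies the second carrier that `IsCarrier.hasResets` requires. -/
lemma Step.reflect_out {y y' : Config} {U : ℤ → ℝ} (h : Step y U y') :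
    (stagger fun n => out (reflect y' n) (U (1 - n))) = reflect y := by
  have h1 : ∀ n, out (reflect y' n) (U (1 - n)) = stagger y (-n) := fun n => by
    have := h.out_eq (-n)
    have e2 : 1 - n = -n + 1 := by ring
    rw [e2]; exact this
  funext n
  simp only [h1]
  simp [stagger, reflect]

/-- Any carrier for the following step excludes the carriers without resets. -/
lemma Step.eq_carrier {y y' : Config} {U V : ℤ → ℝ} (h : Step y U y')
    (hV : IsCarrier (stagger y') V) (ho : Oscillating (stagger y)) : U = carrier (stagger y) :=
  h.1.eq_carrier (h.1.hasResets ho (by rw [← h.2]; exact hV))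

lemma Step.eq_bwdCarrier {z y y' : Config} {U V : ℤ → ℝ} (h : Step y U y') (hV : Step z V y)
    (ho : Oscillating (reflect y')) : U = bwdCarrier y' := by
  have h1 := h.isCarrier_reflect
  have h2 := h1.eq_carrier (h1.hasResets (V := fun n => V (1 - n)) ho
    (by rw [h.reflect_out]; exact hV.isCarrier_reflect))
  funext n
  have := congrFun h2 (1 - n)
  simpa [bwdCarrier] using this

/-- The canonical trajectory through `x`. -/
def orbit (x : Config) : ℤ → Config
  | .ofNat k => fwd^[k] x
  | .negSucc k => bwd^[k + 1] x

/-- The carriers along the canonical trajectory through `x`. -/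
def orbitCarrier (x : Config) : ℤ → ℤ → ℝ
  | .ofNat k => carrier (stagger (fwd^[k] x))
  | .negSucc k => bwdCarrier (bwd^[k] x)

/-- Configurations for which both time directions are determined. -/
def Good (x : Config) : Prop :=
  (Draining (stagger x) ∧ Oscillating (stagger x)) ∧ Draining (reflect x) ∧ Oscillating (reflect x)

/-- All iterates of the canonical dynamics are good. -/
def AllGood (x : Config) : Prop := ∀ k : ℕ, Good (fwd^[k] x) ∧ Good (bwd^[k] x)

lemma AllGood.step_orbit {x : Config} (hx : AllGood x) (t : ℤ) :
    Step (orbit x t) (orbitCarrier x t) (orbit x (t + 1)) := by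
  rcases t with k | k
  · have := step_fwd (hx k).1.1.1
    rw [← Function.iterate_succ_apply' fwd] at this
    exact this
  · have := step_bwd (hx k).2.2.1
    rw [← Function.iterate_succ_apply' bwd] at this
    -- `Int.negSucc k` is the time `-(k + 1)`, so its successor is `-k`.
    have e : orbit x (Int.negSucc k + 1) = bwd^[k] x := by
      cases k <;> rfl
    rw [e]; exact this

lemma IsSolution.eq_orbit {x : Config} {Q E U : ℤ → ℤ → ℝ} (h : IsSolution x Q E U)
    (hx : AllGood x) (t : ℤ) : slice Q E t = orbit x t ∧ U t = orbitCarrier x t := by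
  obtain ⟨h0, hs⟩ := isSolution_iff.1 h
  -- Forwards, the carrier at time `k` is canonical because a step at time `k + 1` exists;
  -- backwards, each step is justified by the one preceding it in time.
  have hf : ∀ k : ℕ, slice Q E k = fwd^[k] x := fun k => by
    induction k with
    | zero => exact h0
    | succ k ih =>
      have h1 := (hs k).eq_carrier (hs (k + 1)).1 (by rw [ih]; exact (hx k).1.1.2)
      rw [Function.iterate_succ_apply', ← ih, Nat.cast_succ, (hs k).2, h1]
      rfl
  have hb' : ∀ k : ℕ, slice Q E (-k) = bwd^[k] x → U (-(k + 1)) = bwdCarrier (bwd^[k] x) ∧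
      slice Q E (-(k + 1)) = bwd^[k + 1] x := fun k ih => by
    have s1 := hs (-(k + 1))
    have s2 := hs (-(k + 1) - 1)
    have e : -((k : ℤ) + 1) + 1 = -k := by ring
    rw [e, ih] at s1
    rw [sub_add_cancel] at s2
    have h1 := s1.eq_bwdCarrier s2 (hx k).2.2.2
    refine ⟨h1, ?_⟩
    have h2 := step_bwd (hx k).2.2.1
    rw [← Function.iterate_succ_apply' bwd] at h2
    have h3 : stagger (slice Q E (-(k + 1))) = stagger (bwd^[k + 1] x) := by
      funext n
      rw [← s1.out_eq n, ← h2.out_eq n, h1]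
    funext n
    have e1 := congrFun h3 (n - 1)
    have e2 := congrFun h3 n
    simp only [stagger, sub_add_cancel, Prod.mk.injEq] at e1 e2
    exact Prod.ext e1.1 e2.2
  have hb : ∀ k : ℕ, slice Q E (-k) = bwd^[k] x := fun k => by
    induction k with
    | zero => simpa using h0
    | succ k ih => push_cast; exact (hb' k ih).2
  rcases t with k | k
  · refine ⟨hf k, ?_⟩
    have h1 := (hs k).eq_carrier (hs (k + 1)).1 (by rw [hf]; exact (hx k).1.1.2)
    rw [hf] at h1
    exact h1
  · have := hb' k (hb k)
    exact ⟨this.2, this.1⟩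

lemma AllGood.uniquelySolvable {x : Config} (hx : AllGood x) : x ∈ uniquelySolvable := by
  refine ⟨(fun t n => (orbit x t n).1, fun t n => (orbit x t n).2, orbitCarrier x), ?_, ?_⟩
  · exact isSolution_iff.2 ⟨rfl, hx.step_orbit⟩
  · rintro ⟨Q, E, U⟩ h
    have := h.eq_orbit hx
    refine Prod.ext ?_ (Prod.ext ?_ ?_)
    · funext t n; exact congrArg Prod.fst (congrFun (this t).1 n)
    · funext t n; exact congrArg Prod.snd (congrFun (this t).1 n)
    · funext t; exact (this t).2

lemma exists_isSolution_dynamics {x : Config} (hx : x ∈ uniquelySolvable) :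
    ∃ Q E U : ℤ → ℤ → ℝ, IsSolution x Q E U ∧ dynamics x = slice Q E 1 := by
  have h : ∃! s : (ℤ → ℤ → ℝ) × (ℤ → ℤ → ℝ) × (ℤ → ℤ → ℝ), IsSolution x s.1 s.2.1 s.2.2 := hx
  refine ⟨_, _, _, h.exists.choose_spec, ?_⟩
  rw [dynamics, dif_pos hx]; rfl

lemma AllGood.dynamics_eq {x : Config} (hx : AllGood x) : dynamics x = fwd x := by
  obtain ⟨Q, E, U, h, he⟩ := exists_isSolution_dynamics hx.uniquelySolvable
  rw [he, (h.eq_orbit hx 1).1]; rfl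

variable {μ ν ρ : Measure ℝ} [IsProbabilityMeasure μ] [IsProbabilityMeasure ν]
  [IsProbabilityMeasure ρ]

lemma HasDrift.ae_good (h : HasDrift μ ν) : ∀ᵐ x ∂iidLaw μ ν, Good x := by
  have h1 := h.ae_draining.and (ae_oscillating h.prod_ne_zero)
  filter_upwards [(measurePreserving_stagger μ ν).quasiMeasurePreserving.ae h1,
    (measurePreserving_reflect μ ν).quasiMeasurePreserving.ae h1] with x h2 h3
  exact ⟨h2, h3⟩

lemma Balanced.measurePreserving_fwd (hb : Balanced μ ν ρ) (h : HasDrift μ ν) :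
    MeasurePreserving fwd (iidLaw μ ν) (iidLaw μ ν) :=
  (hb.measurePreserving h.ae_draining).comp (measurePreserving_stagger μ ν)

lemma Balanced.measurePreserving_bwd (hb : Balanced μ ν ρ) (h : HasDrift μ ν) :
    MeasurePreserving bwd (iidLaw μ ν) (iidLaw μ ν) :=
  (measurePreserving_unstagger μ ν).comp <| (measurePreserving_reflect μ ν).comp <|
    (hb.measurePreserving h.ae_draining).comp (measurePreserving_reflect μ ν)

lemma Balanced.ae_allGood (hb : Balanced μ ν ρ) (h : HasDrift μ ν) :
    ∀ᵐ x ∂iidLaw μ ν, AllGood x := by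
  unfold AllGood
  rw [ae_all_iff]; intro k
  exact (((hb.measurePreserving_fwd h).iterate k).quasiMeasurePreserving.ae h.ae_good).and
    (((hb.measurePreserving_bwd h).iterate k).quasiMeasurePreserving.ae h.ae_good)

/-- An i.i.d. law with drift and detailed balance is invariant. -/
theorem Balanced.invariant (hb : Balanced μ ν ρ) (h : HasDrift μ ν) {Ω : Type*}
    [MeasurableSpace Ω] {P : Measure Ω} {X : Ω → Config} (hX : Measurable X)
    (hlaw : P.map X = iidLaw μ ν) :
    (∀ᵐ ω ∂P, X ω ∈ uniquelySolvable) ∧ IdentDistrib (fun ω => dynamics (X ω)) X P P := by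
  have hg : ∀ᵐ ω ∂P, AllGood (X ω) := by
    apply ae_of_ae_map (p := AllGood) hX.aemeasurable
    rw [hlaw]; exact hb.ae_allGood h
  have hd : (fun ω => dynamics (X ω)) =ᵐ[P] fun ω => fwd (X ω) := by
    filter_upwards [hg] with ω hω using hω.dynamics_eq
  have hm : Measurable fwd := (hb.measurePreserving_fwd h).measurable
  refine ⟨hg.mono fun ω hω => hω.uniquelySolvable, ⟨(hm.comp hX).aemeasurable.congr hd.symm,
    hX.aemeasurable, ?_⟩⟩
  rw [Measure.map_congr hd]
  change P.map (fwd ∘ X) = _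
  rw [← Measure.map_map hm hX, hlaw, (hb.measurePreserving_fwd h).map_eq]

end

/-! ### Multiplicative points of a tail function. -/

section

/-- The nonnegative `a` at which the tail function `f` is multiplicative. -/
def memoryless (f : ℝ → ℝ) : Set ℝ := {a | 0 ≤ a ∧ ∀ t, 0 ≤ t → f (a + t) = f a * f t}

lemma memoryless_zero {f : ℝ → ℝ} (h0 : f 0 = 1) : (0 : ℝ) ∈ memoryless f :=
  ⟨le_rfl, fun t _ => by simp [h0]⟩

lemma memoryless_nsmul {f : ℝ → ℝ} (h0 : f 0 = 1) {a : ℝ} (ha : a ∈ memoryless f) (k : ℕ) :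
    k * a ∈ memoryless f ∧ f (k * a) = f a ^ k := by
  induction k with
  | zero => simpa [h0] using memoryless_zero h0
  | succ k ih =>
    obtain ⟨⟨h1, h2⟩, h3⟩ := ih
    have e : ((k + 1 : ℕ) : ℝ) * a = a + k * a := by push_cast; ring
    have h4 : f (a + k * a) = f a ^ (k + 1) := by rw [ha.2 _ h1, h3]; ring
    rw [e]
    refine ⟨⟨add_nonneg ha.1 h1, fun t ht => ?_⟩, h4⟩
    rw [add_assoc, ha.2 _ (add_nonneg h1 ht), h2 t ht, ha.2 _ h1]; ring

lemma memoryless_sub {f : ℝ → ℝ} {a b : ℝ} (ha : a ∈ memoryless f) (hb : b ∈ memoryless f)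
    (hab : a ≤ b) (hpos : 0 < f a) : b - a ∈ memoryless f := by
  refine ⟨sub_nonneg.2 hab, fun t ht => ?_⟩
  have h1 := ha.2 (b - a + t) (by linarith)
  have h2 := ha.2 (b - a) (by linarith)
  have h3 := hb.2 t ht
  have e1 : a + (b - a + t) = b + t := by ring
  have e2 : a + (b - a) = b := by ring
  rw [e1, h3] at h1
  rw [e2] at h2
  rw [h2, mul_assoc] at h1
  exact (mul_left_cancel₀ hpos.ne' h1).symm

lemma pos_of_memoryless {f : ℝ → ℝ} (hf : Antitone f) (h0 : f 0 = 1) {a : ℝ}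
    (ha : a ∈ memoryless f) (ha0 : 0 < a) (hpos : 0 < f a) (t : ℝ) : 0 < f t := by
  obtain ⟨k, hk⟩ := exists_nat_ge (t / a)
  rw [div_le_iff₀ ha0] at hk
  have := (memoryless_nsmul h0 ha k).2
  exact lt_of_lt_of_le (this ▸ pow_pos hpos k) (hf hk)

/-- Memoryless tails at arbitrarily small scales are exponential. -/
lemma eq_exp_of_memoryless {f : ℝ → ℝ} (hf : Antitone f) (h0 : f 0 = 1)
    (hleft : ∀ t, Tendsto f (𝓝[<] t) (𝓝 (f t))) (hlim : Tendsto f atTop (𝓝 0))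
    (hsmall : ∀ ε > 0, ∃ a ∈ memoryless f, 0 < a ∧ a < ε ∧ 0 < f a) :
    ∃ l : ℝ, 0 < l ∧ ∀ t, 0 ≤ t → f t = Real.exp (-(l * t)) := by
  have hpos : ∀ t, 0 < f t := fun t => by
    obtain ⟨a, ha, ha0, -, hfa⟩ := hsmall 1 one_pos
    exact pos_of_memoryless hf h0 ha ha0 hfa t
  have hmul : ∀ s t, 0 ≤ s → 0 ≤ t → f (s + t) = f s * f t := by
    intro s t hs ht
    rcases hs.eq_or_lt with rfl | hs
    · simp [h0]
    have h1 : Tendsto (fun r => f (r + t)) (𝓝[<] s) (𝓝 (f (s + t))) := by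
      refine (hleft (s + t)).comp ?_
      refine tendsto_nhdsWithin_iff.2 ⟨?_, ?_⟩
      · exact (tendsto_nhdsWithin_of_tendsto_nhds (by
          have : Continuous fun r : ℝ => r + t := by fun_prop
          exact this.tendsto s))
      · filter_upwards [self_mem_nhdsWithin] with r hr
        simpa using hr
    have h2 : Tendsto (fun r => f r * f t) (𝓝[<] s) (𝓝 (f s * f t)) := (hleft s).mul_const _
    refine tendsto_nhds_unique_of_frequently_eq h1 h2 ?_
    rw [Filter.frequently_iff]
    intro V hV
    obtain ⟨l, hl, hlV⟩ := (mem_nhdsLT_iff_exists_Ioo_subset' (show s - 1 < s by linarith)).1 hV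
    -- The multiple of `a` with factor `⌊s / a⌋₊ - 1` lies strictly below `s` and within `2 * a` of
    -- it, hence in the prescribed left neighbourhood.
    obtain ⟨a, ha, ha0, hal, -⟩ := hsmall (min ((s - l) / 2) (s / 2))
      (lt_min (by have : l < s := hl; linarith) (by linarith))
    rw [lt_min_iff] at hal
    have hk := Nat.floor_le (div_nonneg hs.le ha0.le)
    have hk' := Nat.lt_floor_add_one (s / a)
    rw [le_div_iff₀ ha0] at hk
    rw [div_lt_iff₀ ha0] at hk'
    obtain ⟨k, hk0⟩ : ∃ k, ⌊s / a⌋₊ = k + 1 := by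
      refine Nat.exists_eq_succ_of_ne_zero ?_
      have : 1 ≤ ⌊s / a⌋₊ := Nat.le_floor (by rw [Nat.cast_one, le_div_iff₀ ha0]; linarith)
      omega
    rw [hk0] at hk hk'
    push_cast at hk hk'
    have hmem := memoryless_nsmul h0 ha k
    refine ⟨k * a, hlV ⟨by nlinarith, by nlinarith⟩, hmem.1.2 t ht⟩
  have hall : ∀ s, 0 ≤ s → s ∈ memoryless f := fun s hs => ⟨hs, fun t ht => hmul s t hs ht⟩
  have hnat : ∀ k : ℕ, f k = f 1 ^ k := fun k => by
    simpa using (memoryless_nsmul h0 (hall 1 zero_le_one) k).2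
  have hlt : f 1 < 1 := by
    by_contra! hge
    have h1 := hlim.comp tendsto_natCast_atTop_atTop
    have := ge_of_tendsto' (b := (1 : ℝ)) h1 (fun k => by
      simp only [Function.comp_apply, hnat]; exact one_le_pow₀ hge)
    linarith
  have hrat : ∀ q : ℚ, 0 ≤ q → f q = f 1 ^ (q : ℝ) := by
    intro q hq
    have hd : (0 : ℝ) < q.den := by exact_mod_cast q.den_pos
    have h1 := (memoryless_nsmul h0 (hall q (by exact_mod_cast hq)) q.den).2
    have e : (q.den : ℝ) * q = (q.num.toNat : ℝ) := by
      have h2 : (q.den : ℚ) * q = q.num := by rw [mul_comm]; exact Rat.mul_den_eq_num q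
      have h3 : (q.num.toNat : ℤ) = q.num := Int.toNat_of_nonneg (Rat.num_nonneg.2 hq)
      have h4 : (q.den : ℚ) * q = (q.num.toNat : ℚ) := by
        rw [h2, ← Int.cast_natCast, h3]
      exact_mod_cast h4
    rw [e, hnat] at h1
    have h5 : (q : ℝ) = (q.num.toNat : ℝ) * (q.den : ℝ)⁻¹ := by
      rw [← e]; field_simp
    conv_rhs => rw [h5, Real.rpow_mul (hpos 1).le, Real.rpow_natCast, h1]
    rw [Real.pow_rpow_inv_natCast (hpos _).le q.den_pos.ne']
  refine ⟨-Real.log (f 1), by have := Real.log_neg (hpos 1) hlt; linarith, fun t ht => ?_⟩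
  have hexp : ∀ s : ℝ, Real.exp (-(-Real.log (f 1) * s)) = f 1 ^ s := fun s => by
    rw [Real.rpow_def_of_pos (hpos 1)]; ring_nf
  rw [hexp]
  rcases ht.eq_or_lt with rfl | ht
  · simp [h0]
  have hc : Tendsto (fun s : ℝ => f 1 ^ s) (𝓝[<] t) (𝓝 (f 1 ^ t)) :=
    ((Real.continuous_const_rpow (hpos 1).ne').tendsto t).mono_left nhdsWithin_le_nhds
  refine tendsto_nhds_unique_of_frequently_eq (hleft t) hc ?_
  rw [Filter.frequently_iff]
  intro V hV
  obtain ⟨l, hl, hlV⟩ := (mem_nhdsLT_iff_exists_Ioo_subset' ht).1 hV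
  obtain ⟨q, hq1, hq2⟩ := exists_rat_btwn (max_lt (show l < t from hl) ht)
  rw [max_lt_iff] at hq1
  exact ⟨q, hlV ⟨hq1.1, hq2⟩, hrat q (by exact_mod_cast hq1.2.le)⟩

/-- Memoryless points of a tail with a jump at the origin form a lattice. -/
lemma exists_lattice_of_memoryless {f : ℝ → ℝ} (hf : Antitone f) (h0 : f 0 = 1)
    (hpos : ∀ t, 0 < f t) {κ : ℝ} (hκ1 : κ < 1) (hjump : ∀ t, 0 < t → f t ≤ κ)
    {a : ℝ} (ha : a ∈ memoryless f) (ha0 : 0 < a) :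
    ∃ m ∈ memoryless f, 0 < m ∧ ∀ b ∈ memoryless f, ∃ k : ℕ, b = k * m := by
  have hκ0 : 0 < κ := (hpos 1).trans_le (hjump 1 one_pos)
  obtain ⟨K, hK⟩ := exists_pow_lt_of_lt_one (hpos 1) hκ1
  -- A positive multiplicative point `b` with `K * b ≤ 1` would give `f 1 ≤ f b ^ K ≤ κ ^ K < f 1`;
  -- so such points are bounded away from `0`.
  have hsep : ∀ b ∈ memoryless f, 0 < b → 1 / ((K : ℝ) + 1) ≤ b := by
    intro b hb hb0
    by_contra! hlt
    rw [lt_div_iff₀ (by positivity)] at hlt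
    have h1 := (memoryless_nsmul h0 hb K).2
    have h2 : f 1 ≤ f (K * b) := hf (by nlinarith)
    have h3 : f b ^ K ≤ κ ^ K := pow_le_pow_left₀ (hpos b).le (hjump b hb0) K
    linarith
  let Λ : Set ℝ := {b | b ∈ memoryless f ∧ 0 < b}
  have hne : Λ.Nonempty := ⟨a, ha, ha0⟩
  have hbdd : BddBelow Λ := ⟨0, fun b hb => hb.2.le⟩
  -- Differences of multiplicative points are multiplicative, so two distinct ones cannot be closer
  -- than this separation and the infimum is attained. Division with remainder then gives the
  -- lattice.
  have hmin : sInf Λ ∈ Λ := by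
    obtain ⟨b, hb, hblt⟩ := exists_lt_of_csInf_lt hne
      (show sInf Λ < sInf Λ + 1 / ((K : ℝ) + 1) by
        have : (0 : ℝ) < 1 / ((K : ℝ) + 1) := by positivity
        linarith)
    rcases (csInf_le hbdd hb).eq_or_lt with h | h
    · rw [h]; exact hb
    · obtain ⟨b', hb', hb'lt⟩ := exists_lt_of_csInf_lt hne h
      have h1 := hsep _ (memoryless_sub hb'.1 hb.1 hb'lt.le (hpos _)) (by linarith)
      have h2 := csInf_le hbdd hb'
      linarith
  refine ⟨sInf Λ, hmin.1, hmin.2, fun b hb => ?_⟩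
  set m := sInf Λ
  refine ⟨⌊b / m⌋₊, ?_⟩
  have hk := Nat.floor_le (div_nonneg hb.1 hmin.2.le)
  have hk' := Nat.lt_floor_add_one (b / m)
  rw [le_div_iff₀ hmin.2] at hk
  rw [div_lt_iff₀ hmin.2] at hk'
  have hmem := memoryless_sub (memoryless_nsmul h0 hmin.1 ⌊b / m⌋₊).1 hb hk (hpos _)
  by_contra hne'
  have := csInf_le hbdd (show b - ⌊b / m⌋₊ * m ∈ Λ from
    ⟨hmem, lt_of_le_of_ne hmem.1 fun h => hne' (by linarith)⟩)
  change m ≤ _ at this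
  linarith

end

/-! ### Tails of probability laws on the line. -/

section

/-- The tail function `y ↦ μ [y, ∞)`. -/
def tail (μ : Measure ℝ) (y : ℝ) : ℝ := μ.real (Set.Ici y)

section Tail

lemma tail_nonneg (μ : Measure ℝ) (y : ℝ) : 0 ≤ tail μ y := measureReal_nonneg

variable (μ : Measure ℝ) [IsProbabilityMeasure μ]

lemma tail_le_one (y : ℝ) : tail μ y ≤ 1 := measureReal_le_one

lemma ofReal_tail (y : ℝ) : ENNReal.ofReal (tail μ y) = μ (Set.Ici y) :=
  ofReal_measureReal

lemma tail_antitone : Antitone (tail μ) := fun _ _ h =>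
  measureReal_mono (Set.Ici_subset_Ici.2 h)

lemma tail_eq_one_sub (y : ℝ) : tail μ y = 1 - μ.real (Set.Iio y) := by
  rw [tail, ← Set.compl_Iio, probReal_compl_eq_one_sub measurableSet_Iio]

lemma tail_eq_one_iff (y : ℝ) : tail μ y = 1 ↔ μ (Set.Iio y) = 0 := by
  rw [tail_eq_one_sub, sub_eq_self, measureReal_eq_zero_iff]

lemma tendsto_tail_atTop : Tendsto (tail μ) atTop (𝓝 0) := by
  have h1 : Tendsto (fun y => 1 - cdf μ (y - 1)) atTop (𝓝 0) := by
    have := ((tendsto_cdf_atTop μ).comp (tendsto_atTop_add_const_right atTop (-1 : ℝ)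
      tendsto_id)).const_sub 1
    simpa [Function.comp_def, sub_eq_add_neg] using this
  refine tendsto_of_tendsto_of_tendsto_of_le_of_le tendsto_const_nhds h1 (tail_nonneg μ) fun y => ?_
  rw [tail_eq_one_sub, cdf_eq_real]
  have : μ.real (Set.Iic (y - 1)) ≤ μ.real (Set.Iio y) :=
    measureReal_mono fun x (hx : x ≤ y - 1) => show x < y by linarith
  linarith

lemma tendsto_tail_atBot : Tendsto (tail μ) atBot (𝓝 1) := by
  have := (ENNReal.tendsto_toReal (by simp)).comp (tendsto_measure_Ici_atBot μ)
  rw [measure_univ] at this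
  exact this

lemma tendsto_tail_left (t : ℝ) : Tendsto (tail μ) (𝓝[<] t) (𝓝 (tail μ t)) := by
  have h := tendsto_measure_biInter_gt (μ := μ) (s := fun r : ℝ => Set.Ici (-r)) (a := -t)
    (fun r _ => measurableSet_Ici.nullMeasurableSet)
    (fun i j _ hij => Set.Ici_subset_Ici.2 (neg_le_neg hij)) ⟨-t + 1, by linarith, by simp⟩
  have e : ⋂ r > -t, Set.Ici (-r) = Set.Ici t := by
    ext x
    simp only [Set.mem_iInter, Set.mem_Ici]
    refine ⟨fun hx => le_of_forall_lt fun c hc => ?_, fun hx r hr => by linarith⟩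
    have := hx (-((c + t) / 2)) (by linarith)
    linarith
  rw [e] at h
  have h2 := ((ENNReal.tendsto_toReal (by simp)).comp h).comp (tendsto_neg_nhdsLT (a := t))
  refine h2.congr fun r => ?_
  simp [Function.comp_def, tail, Measure.real]

lemma tendsto_tail_right (t : ℝ) : Tendsto (tail μ) (𝓝[>] t) (𝓝 (μ.real (Set.Ioi t))) := by
  have h := tendsto_measure_biInter_gt (μ := μ) (s := fun r : ℝ => Set.Iio r) (a := t)
    (fun r _ => measurableSet_Iio.nullMeasurableSet)
    (fun i j _ hij => Set.Iio_subset_Iio hij) ⟨t + 1, by linarith, by simp⟩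
  have e : ⋂ r > t, Set.Iio r = Set.Iic t := by
    ext x
    simp only [Set.mem_iInter, Set.mem_Iio, Set.mem_Iic]
    exact ⟨fun hx => le_of_forall_gt hx, fun hx r hr => by linarith⟩
  rw [e] at h
  have h2 := ((ENNReal.tendsto_toReal (by simp)).comp h).const_sub 1
  have e2 : μ.real (Set.Ioi t) = 1 - (μ (Set.Iic t)).toReal := by
    rw [← Set.compl_Iic, probReal_compl_eq_one_sub measurableSet_Iic]; rfl
  rw [e2]
  exact h2.congr fun r => (tail_eq_one_sub μ r).symm

end Tail

/-- Left-continuous functions agreeing at the positive rationals agree on the positive reals. -/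
lemma eq_of_left_continuous {f g : ℝ → ℝ} (hf : ∀ t, Tendsto f (𝓝[<] t) (𝓝 (f t)))
    (hg : ∀ t, Tendsto g (𝓝[<] t) (𝓝 (g t))) (h : ∀ q : ℚ, 0 ≤ q → f q = g q) :
    ∀ t, 0 ≤ t → f t = g t := by
  intro t ht
  rcases ht.eq_or_lt with rfl | ht
  · simpa using h 0 le_rfl
  refine tendsto_nhds_unique_of_frequently_eq (hf t) (hg t) ?_
  rw [Filter.frequently_iff]
  intro V hV
  obtain ⟨l, hl, hlV⟩ := (mem_nhdsLT_iff_exists_Ioo_subset' ht).1 hV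
  obtain ⟨q, hq1, hq2⟩ := exists_rat_btwn (max_lt (show l < t from hl) ht)
  rw [max_lt_iff] at hq1
  exact ⟨q, hlV ⟨hq1.1, hq2⟩, h q (by exact_mod_cast hq1.2.le)⟩

lemma eq_dirac_of_ae {α : Type*} [MeasurableSpace α] {μ : Measure α} [IsProbabilityMeasure μ]
    {x : α} (h : ∀ᵐ y ∂μ, y = x) : μ = Measure.dirac x := by
  have h1 : μ.map id = μ.map (fun _ => x) := Measure.map_congr h
  rwa [Measure.map_id, Measure.map_const, measure_univ, one_smul] at h1

/-- A law on the line which is not a point mass charges two ordered points of any set of full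
measure. -/
lemma exists_lt_of_ae {μ : Measure ℝ} [IsProbabilityMeasure μ] (hμ : ∀ x, μ ≠ Measure.dirac x)
    {p : ℝ → Prop} (hp : ∀ᵐ x ∂μ, p x) : ∃ x y, x < y ∧ p x ∧ p y := by
  by_contra! hcon
  obtain ⟨x, hx⟩ := hp.exists
  refine hμ x (eq_dirac_of_ae (hp.mono fun y hy => ?_))
  rcases lt_trichotomy x y with h | h | h
  · exact absurd hy (hcon x y h hx)
  · exact h.symm
  · exact absurd hx (hcon y x h hy)

end

/-! ### Independence of minimum and difference: the tail identity. -/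

section

/-- For independent `X ∼ μ`, `Y ∼ ν`, the variables `min X Y ∼ ρ` and `X - Y ∼ δ` are
independent. -/
def MinDiffIndep (μ ν ρ δ : Measure ℝ) : Prop :=
  (μ.prod ν).map (fun p => (min p.1 p.2, p.1 - p.2)) = ρ.prod δ

variable {μ ν ρ δ : Measure ℝ} [IsProbabilityMeasure μ] [IsProbabilityMeasure ν]
  [IsProbabilityMeasure ρ] [IsProbabilityMeasure δ]

namespace MinDiffIndep

lemma symm (h : MinDiffIndep μ ν ρ δ) : MinDiffIndep ν μ ρ (δ.map Neg.neg) := by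
  unfold MinDiffIndep at *
  have h1 : ρ.prod (δ.map Neg.neg) = (ρ.prod δ).map (Prod.map id Neg.neg) := by
    rw [← Measure.map_prod_map _ _ measurable_id measurable_neg, Measure.map_id]
  rw [h1, ← h, Measure.map_map (by fun_prop) (by fun_prop), ← Measure.prod_swap (μ := μ),
    Measure.map_map (by fun_prop) (by fun_prop)]
  congr 1
  funext p
  simp [min_comm]

/-- For `t ≥ 0` the event `min X Y ∈ A`, `X - Y ≥ t` is `Y ∈ A`, `X ≥ Y + t`; independence factors
its probability. The densities for different `t` are thus proportional to each other. -/
lemma withDensity_eq (h : MinDiffIndep μ ν ρ δ) {t : ℝ} (ht : 0 ≤ t) :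
    ν.withDensity (fun y => ENNReal.ofReal (tail μ (y + t))) =
      ENNReal.ofReal (tail δ t) • ρ := by
  have hmeas : Measurable fun p : ℝ × ℝ => (min p.1 p.2, p.1 - p.2) := by fun_prop
  ext A hA
  rw [withDensity_apply _ hA, Measure.smul_apply, smul_eq_mul, ofReal_tail, mul_comm,
    ← Measure.prod_prod, ← h, Measure.map_apply hmeas (hA.prod measurableSet_Ici),
    Measure.prod_apply_symm (hmeas (hA.prod measurableSet_Ici)), ← lintegral_indicator hA]
  congr 1
  funext y
  by_cases hy : y ∈ A
  · rw [Set.indicator_of_mem hy, ofReal_tail]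
    congr 1
    ext x
    simp only [Set.mem_Ici, Set.mem_preimage, Set.mem_prod]
    constructor
    · intro hx
      rw [min_eq_right (by linarith)]
      exact ⟨hy, by linarith⟩
    · rintro ⟨-, hx⟩; linarith
  · rw [Set.indicator_of_notMem hy]
    symm
    convert measure_empty (μ := μ)
    ext x
    simp only [Set.mem_Ici, Set.mem_preimage, Set.mem_prod, Set.mem_empty_iff_false, iff_false,
      not_and, not_le]
    intro h1
    by_contra! h2
    rw [min_eq_right (by linarith)] at h1
    exact hy h1

lemma measurable_tail_add (t : ℝ) : Measurable fun y => ENNReal.ofReal (tail μ (y + t)) :=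
  ENNReal.measurable_ofReal.comp ((tail_antitone μ).measurable.comp (by fun_prop))

/-- The memoryless identity holds at almost every point. -/
lemma ae_tail_add (h : MinDiffIndep μ ν ρ δ) : ∀ᵐ y ∂ν, ∀ t, 0 ≤ t →
    tail δ 0 * tail μ (y + t) = tail δ t * tail μ y := by
  -- Each `t` has its own exceptional null set; rational `t` and left continuity reduce them to one.
  have key : ∀ q : ℚ, 0 ≤ q → ∀ᵐ y ∂ν,
      tail δ 0 * tail μ (y + q) = tail δ q * tail μ y := by
    intro q hq
    have hq' : (0 : ℝ) ≤ q := by exact_mod_cast hq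
    have e1 : ν.withDensity (ENNReal.ofReal (tail δ 0) •
          fun y => ENNReal.ofReal (tail μ (y + q))) =
        ν.withDensity (ENNReal.ofReal (tail δ q) • fun y => ENNReal.ofReal (tail μ (y + 0))) := by
      rw [withDensity_smul _ (measurable_tail_add _), withDensity_smul _ (measurable_tail_add _),
        h.withDensity_eq hq', h.withDensity_eq le_rfl, smul_smul, smul_smul, mul_comm]
    rw [withDensity_eq_iff ((measurable_tail_add _).const_smul _).aemeasurable
      ((measurable_tail_add _).const_smul _).aemeasurable] at e1
    · filter_upwards [e1] with y hy
      simp only [Pi.smul_apply, smul_eq_mul, add_zero] at hy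
      rw [← ENNReal.ofReal_mul (tail_nonneg _ _), ← ENNReal.ofReal_mul (tail_nonneg _ _),
        ENNReal.ofReal_eq_ofReal_iff (mul_nonneg (tail_nonneg _ _) (tail_nonneg _ _))
          (mul_nonneg (tail_nonneg _ _) (tail_nonneg _ _))] at hy
      exact hy
    · refine ne_of_lt (lt_of_le_of_lt (lintegral_mono (g := fun _ => 1) fun y => ?_) (by simp))
      simp only [Pi.smul_apply, smul_eq_mul]
      exact mul_le_one' (ENNReal.ofReal_le_one.2 (tail_le_one _ _))
        (ENNReal.ofReal_le_one.2 (tail_le_one _ _))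
  filter_upwards [ae_all_iff.2 fun q : ℚ => ae_all_iff.2 fun hq : 0 ≤ q => key q hq] with y hy
  refine eq_of_left_continuous (fun t => ?_) (fun t => (tendsto_tail_left δ t).mul_const _) hy
  refine Tendsto.const_mul _ ((tendsto_tail_left μ (y + t)).comp ?_)
  refine tendsto_nhdsWithin_iff.2 ⟨tendsto_nhdsWithin_of_tendsto_nhds ?_, ?_⟩
  · have : Continuous fun r : ℝ => y + r := by fun_prop
    exact this.tendsto t
  · filter_upwards [self_mem_nhdsWithin] with r hr
    simpa using hr

lemma lintegral_tail (h : MinDiffIndep μ ν ρ δ) :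
    ∫⁻ y, ENNReal.ofReal (tail μ y) ∂ν = ENNReal.ofReal (tail δ 0) := by
  have := congrArg (fun m => m Set.univ) (h.withDensity_eq le_rfl)
  simpa using this

/-- If `X ≥ Y` almost surely, then `tail μ = 1` at almost every value of `Y`. Two such values `x <
y` give `tail δ t = tail μ (x + t) = tail μ (y + t)`, so `tail δ` repeats with step `y - x` and
cannot decay. -/
lemma eq_dirac_of_tail_neg (h : MinDiffIndep μ ν ρ δ) (hδ : tail δ 0 = 1) :
    ∃ y, ν = Measure.dirac y := by
  by_contra! hcon
  have h1 : ∀ᵐ y ∂ν, tail μ y = 1 := by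
    have h2 : (fun y => ENNReal.ofReal (tail μ y)) =ᵐ[ν] fun _ => 1 := by
      refine ae_eq_of_ae_le_of_lintegral_le (ae_of_all _ fun y =>
        ENNReal.ofReal_le_one.2 (tail_le_one _ _)) ?_ (by simp) ?_
      · rw [h.lintegral_tail]; exact ENNReal.ofReal_ne_top
      · rw [h.lintegral_tail, hδ]; simp
    filter_upwards [h2] with y hy
    rw [← ENNReal.ofReal_one, ENNReal.ofReal_eq_ofReal_iff (tail_nonneg _ _) zero_le_one] at hy
    exact hy
  obtain ⟨x, y, hxy, ⟨hx1, hx2⟩, hy1, hy2⟩ := exists_lt_of_ae hcon (h1.and h.ae_tail_add)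
  simp only [hδ, one_mul, hx1, hy1, mul_one] at hx2 hy2
  have hk : ∀ k : ℕ, tail δ (k * (y - x)) = 1 := fun k => by
    induction k with
    | zero => simpa using hδ
    | succ k ih =>
      have h3 : 0 ≤ k * (y - x) := mul_nonneg (Nat.cast_nonneg _) (by linarith)
      rw [← ih, ← hy2 _ h3, ← hx2 _ (mul_nonneg (Nat.cast_nonneg _) (by linarith))]
      congr 1; push_cast; ring
  have hlim := (tendsto_tail_atTop δ).comp
    (tendsto_natCast_atTop_atTop.atTop_mul_const (sub_pos.2 hxy))
  have := tendsto_nhds_unique hlim (tendsto_const_nhds.congr fun k => (hk k).symm)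
  norm_num at this

lemma tail_zero_pos (h : MinDiffIndep μ ν ρ δ) (hμ : ∀ x, μ ≠ Measure.dirac x) :
    0 < tail δ 0 := by
  refine lt_of_le_of_ne (tail_nonneg _ _) fun h0 => ?_
  have : IsProbabilityMeasure (δ.map Neg.neg) := Measure.isProbabilityMeasure_map (by fun_prop)
  obtain ⟨x, hx⟩ := h.symm.eq_dirac_of_tail_neg (by
    rw [tail_eq_one_iff, Measure.map_apply measurable_neg measurableSet_Iio]
    have h1 : δ (Set.Ici 0) = 0 := by rw [← ofReal_tail, ← h0]; simp
    exact measure_mono_null (fun z (hz : -z < 0) => show 0 ≤ z by linarith) h1)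
  exact hμ x hx

/-- Sets of `ρ`-measure zero are `ν`-null where the tail of `μ` is positive. -/
lemma null_of_null (h : MinDiffIndep μ ν ρ δ) {A : Set ℝ} (hA : MeasurableSet A)
    (hpos : ∀ y ∈ A, 0 < tail μ y) (h0 : ρ A = 0) : ν A = 0 := by
  have h1 := congrArg (fun m => m A) (h.withDensity_eq le_rfl)
  simp only [Measure.smul_apply, h0, smul_zero, add_zero] at h1
  rw [withDensity_apply _ hA, setLIntegral_eq_zero_iff hA (by simpa using measurable_tail_add (μ := μ) 0)] at h1
  refine measure_mono_null ?_ h1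
  intro y hy hy'
  have := hy' hy
  simp only [ENNReal.ofReal_eq_zero] at this
  exact absurd (hpos y hy) this.not_gt

lemma null_of_null' (h : MinDiffIndep μ ν ρ δ) (hp : 0 < tail δ 0) {A : Set ℝ}
    (h0 : ν A = 0) : ρ A = 0 := by
  have h1 := withDensity_absolutelyContinuous ν (fun y => ENNReal.ofReal (tail μ (y + 0)))
  rw [h.withDensity_eq le_rfl] at h1
  have h2 := h1 h0
  rw [Measure.smul_apply, smul_eq_mul, mul_eq_zero, ENNReal.ofReal_eq_zero] at h2
  exact h2.resolve_left hp.not_ge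

lemma null_Iio (h : MinDiffIndep μ ν ρ δ) {z : ℝ} (h0 : ρ (Set.Iio z) = 0) :
    μ (Set.Iio z) = 0 := by
  have hmeas : Measurable fun p : ℝ × ℝ => (min p.1 p.2, p.1 - p.2) := by fun_prop
  have h1 : (ρ.prod δ) (Set.Iio z ×ˢ Set.univ) = 0 := by simp [h0]
  rw [← h, Measure.map_apply hmeas (measurableSet_Iio.prod MeasurableSet.univ)] at h1
  have h2 : (μ.prod ν) (Set.Iio z ×ˢ Set.univ) = 0 :=
    measure_mono_null (fun p hp => by
      simp only [Set.mem_prod, Set.mem_Iio, Set.mem_univ, and_true, Set.mem_preimage] at hp ⊢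
      exact (min_le_left _ _).trans_lt hp) h1
  simpa using h2

end MinDiffIndep

end

/-! ### Exponential and geometric laws, and their characterization. -/

section

section Laws

lemma sExp_Ici {l : ℝ} (hl : 0 < l) (c a : ℝ) :
    sExp l c (Set.Ici a) = ENNReal.ofReal (Real.exp (-(l * (max a c - c)))) := by
  have hderiv : ∀ x ∈ Set.Ici (max a c),
      HasDerivAt (fun y => -Real.exp (-(l * (y - c)))) (l * Real.exp (-(l * (x - c)))) x := by
    intro x _
    have h1 : HasDerivAt (fun y => -(l * (y - c))) (-l) x := by
      simpa using (((hasDerivAt_id x).sub_const c).const_mul l).fun_neg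
    have e : l * Real.exp (-(l * (x - c))) = -(Real.exp (-(l * (x - c))) * -l) := by ring
    rw [e]
    exact h1.exp.fun_neg
  have hpos : ∀ x ∈ Set.Ioi (max a c), 0 ≤ l * Real.exp (-(l * (x - c))) := fun x _ => by positivity
  have hlim : Tendsto (fun y => -Real.exp (-(l * (y - c)))) atTop (𝓝 0) := by
    have h1 : Tendsto (fun y : ℝ => l * (y - c)) atTop atTop :=
      (tendsto_atTop_add_const_right atTop (-c) tendsto_id).const_mul_atTop hl
    simpa using (Real.tendsto_exp_neg_atTop_nhds_zero.comp h1).neg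
  have hint := integral_Ioi_of_hasDerivAt_of_nonneg' hderiv hpos hlim
  have hintg := integrableOn_Ioi_deriv_of_nonneg' hderiv hpos hlim
  have e : (fun y => ENNReal.ofReal (if c ≤ y then l * Real.exp (-(l * (y - c))) else 0)) =
      (Set.Ici c).indicator fun y => ENNReal.ofReal (l * Real.exp (-(l * (y - c)))) := by
    funext y
    by_cases hy : c ≤ y <;> simp [hy]
  rw [sExp, withDensity_apply _ measurableSet_Ici, e, setLIntegral_indicator measurableSet_Ici,
    Set.Ici_inter_Ici, sup_comm, ← restrict_Ioi_eq_restrict_Ici,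
    ← ofReal_integral_eq_lintegral_ofReal hintg
      ((ae_restrict_iff' measurableSet_Ioi).2 (ae_of_all _ hpos)), hint]
  simp

lemma sExp_univ {l : ℝ} (hl : 0 < l) (c : ℝ) : sExp l c Set.univ = 1 := by
  have h1 := tendsto_measure_Ici_atBot (sExp l c)
  refine tendsto_nhds_unique h1 (tendsto_const_nhds.congr' ?_)
  filter_upwards [eventually_le_atBot c] with a ha
  rw [sExp_Ici hl, max_eq_right ha]; simp

lemma isProbabilityMeasure_sExp {l : ℝ} (hl : 0 < l) (c : ℝ) : IsProbabilityMeasure (sExp l c) :=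
  ⟨sExp_univ hl c⟩

lemma eq_sExp {μ : Measure ℝ} [IsProbabilityMeasure μ] {l c : ℝ} (hl : 0 < l)
    (h : ∀ t, 0 ≤ t → tail μ (c + t) = Real.exp (-(l * t))) : μ = sExp l c := by
  refine Measure.ext_of_Ici _ _ fun a => ?_
  rw [sExp_Ici hl, ← ofReal_tail]
  congr 1
  rcases le_total a c with hac | hac
  · rw [max_eq_right hac]
    have h1 := h 0 le_rfl
    have h2 := tail_antitone μ hac
    have h3 := tail_le_one μ a
    simp at h1 ⊢
    linarith
  · rw [max_eq_left hac, ← h _ (sub_nonneg.2 hac)]; congr 1; ring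

lemma eq_ssGeo {μ : Measure ℝ} [IsProbabilityMeasure μ] {θ M m : ℝ} (hm : 0 < m)
    (h1 : ∀ᵐ x ∂μ, ∃ k : ℕ, x = m * (M + k))
    (h2 : ∀ k : ℕ, tail μ (m * (M + k)) = θ ^ k) : μ = ssGeo (1 - θ) M m := by
  let φ : ℕ → ℝ := fun k => m * (M + k)
  have hφ : StrictMono φ := fun a b hab => by
    have : (a : ℝ) < b := by exact_mod_cast hab
    simp only [φ]; gcongr
  have hatom : ∀ k, μ {φ k} = ENNReal.ofReal ((1 - θ) * θ ^ k) := by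
    intro k
    have e1 : (Set.Ici (φ k) : Set ℝ) =ᵐ[μ] ({φ k} ∪ Set.Ici (φ (k + 1)) : Set ℝ) := by
      refine eventuallyEq_set.2 ?_
      filter_upwards [h1] with x hx
      obtain ⟨j, rfl⟩ := hx
      change φ k ≤ φ j ↔ φ j = φ k ∨ φ (k + 1) ≤ φ j
      rw [hφ.le_iff_le, hφ.le_iff_le, hφ.injective.eq_iff]; omega
    have e2 : Disjoint {φ k} (Set.Ici (φ (k + 1))) := by
      rw [Set.disjoint_singleton_left, Set.mem_Ici, not_le]; exact hφ k.lt_succ_self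
    have e3 := measureReal_congr e1
    rw [measureReal_union e2 measurableSet_Ici] at e3
    have e4 : tail μ (φ k) = μ.real {φ k} + tail μ (φ (k + 1)) := e3
    rw [show tail μ (φ k) = θ ^ k from h2 k, show tail μ (φ (k + 1)) = θ ^ (k + 1) from h2 (k + 1)]
      at e4
    rw [← ofReal_measureReal]
    congr 1; rw [pow_succ] at e4; linarith
  ext s hs
  have e1 : μ s = μ (⋃ k, s ∩ {φ k}) := by
    refine measure_congr (eventuallyEq_set.2 ?_)
    filter_upwards [h1] with x hx
    obtain ⟨j, rfl⟩ := hx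
    simp only [Set.mem_iUnion, Set.mem_inter_iff, Set.mem_singleton_iff]
    exact ⟨fun hxs => ⟨j, hxs, rfl⟩, fun ⟨_, hxs, _⟩ => hxs⟩
  rw [e1, measure_iUnion (fun i j hij => Set.disjoint_left.2 fun x hx hx' =>
      hij (hφ.injective (hx.2.symm.trans hx'.2)))
    (fun k => hs.inter (measurableSet_singleton _)), ssGeo, Measure.sum_apply _ hs]
  congr 1; funext k
  rw [sub_sub_cancel, Measure.smul_apply, Measure.dirac_apply' _ hs, smul_eq_mul, ← hatom]
  by_cases hk : φ k ∈ s
  · rw [Set.indicator_of_mem (show m * (M + k) ∈ s from hk), Pi.one_apply, mul_one,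
      Set.inter_eq_right.2 (Set.singleton_subset_iff.2 hk)]
  · rw [Set.indicator_of_notMem (show m * (M + k) ∉ s from hk), mul_zero,
      Set.inter_singleton_eq_empty.2 hk, measure_empty]

end Laws

/-- `ℓ` is the essential infimum of the law `μ`. -/
def Bottom (μ : Measure ℝ) (ℓ : ℝ) : Prop :=
  μ (Set.Iio ℓ) = 0 ∧ ∀ z, ℓ < z → μ (Set.Iio z) ≠ 0

variable {μ ν ρ δ : Measure ℝ} [IsProbabilityMeasure μ] [IsProbabilityMeasure ν]
  [IsProbabilityMeasure ρ] [IsProbabilityMeasure δ] {ℓ : ℝ}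

lemma Bottom.tail_eq_one (h : Bottom μ ℓ) : tail μ ℓ = 1 := (tail_eq_one_iff μ ℓ).2 h.1

lemma Bottom.ae_le (h : Bottom μ ℓ) : ∀ᵐ x ∂μ, ℓ ≤ x := by
  rw [ae_iff]; simpa [Set.Iio, not_le] using h.1

lemma Bottom.exists_between (h : Bottom μ ℓ) (h0 : μ {ℓ} = 0) {p : ℝ → Prop}
    (hp : ∀ᵐ x ∂μ, p x) {z : ℝ} (hz : ℓ < z) : ∃ x, ℓ < x ∧ x < z ∧ p x := by
  by_contra! hcon
  refine h.2 z hz (measure_mono_null (t := {ℓ} ∪ Set.Iio ℓ ∪ {x | ¬p x}) ?_ ?_)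
  · intro x hx
    rcases lt_trichotomy x ℓ with h1 | h1 | h1
    · exact Or.inl (Or.inr h1)
    · exact Or.inl (Or.inl h1)
    · exact Or.inr (hcon x h1 hx)
  · exact measure_union_null (measure_union_null h0 h.1) hp

lemma Bottom.measureReal_Ioi (h : Bottom μ ℓ) : μ.real (Set.Ioi ℓ) = 1 - μ.real {ℓ} := by
  have h1 := h.tail_eq_one
  rw [tail, ← Set.Ioi_insert, Set.insert_eq,
    measureReal_union (by simp) measurableSet_Ioi] at h1
  linarith

namespace MinDiffIndep

/-- If `ρ` charged every left half-line, so would `ν`; letting `y → -∞` in the tail identity then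
makes `tail δ` constant on `[0, ∞)`. The essential infimum of `ρ` passes to both laws through the
comparison of null sets. -/
lemma exists_bottom (h : MinDiffIndep μ ν ρ δ) (hμ : ∀ x, μ ≠ Measure.dirac x)
    (hν : ∀ x, ν ≠ Measure.dirac x) : ∃ ℓ, Bottom μ ℓ ∧ Bottom ν ℓ := by
  have : IsProbabilityMeasure (δ.map Neg.neg) := Measure.isProbabilityMeasure_map (by fun_prop)
  have hp := h.tail_zero_pos hμ
  have hp' := h.symm.tail_zero_pos hν
  let Z : Set ℝ := {z | ρ (Set.Iio z) = 0}
  have hne : Z.Nonempty := by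
    by_contra hcon
    have hν0 : ∀ z, ν (Set.Iio z) ≠ 0 := fun z hz =>
      hcon ⟨z, h.null_of_null' hp hz⟩
    have hfreq : ∃ᶠ y in atBot, ∀ t, 0 ≤ t → tail δ 0 * tail μ (y + t) = tail δ t * tail μ y := by
      rw [Filter.frequently_atBot]
      intro a
      by_contra! hc
      refine hν0 a (measure_mono_null (fun y hy => ?_) h.ae_tail_add)
      obtain ⟨t, ht, hne⟩ := hc y (le_of_lt hy)
      exact fun hgood => hne (hgood t ht)
    have hconst : ∀ t, 0 ≤ t → tail δ t = tail δ 0 := fun t ht => by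
      have l1 : Tendsto (fun y => tail δ 0 * tail μ (y + t)) atBot (𝓝 (tail δ 0 * 1)) :=
        ((tendsto_tail_atBot μ).comp (tendsto_atBot_add_const_right atBot t tendsto_id)).const_mul _
      have l2 : Tendsto (fun y => tail δ t * tail μ y) atBot (𝓝 (tail δ t * 1)) :=
        (tendsto_tail_atBot μ).const_mul _
      have := tendsto_nhds_unique_of_frequently_eq l1 l2 (hfreq.mono fun y hy => hy t ht)
      linarith
    have h1 : Tendsto (tail δ) atTop (𝓝 (tail δ 0)) := tendsto_const_nhds.congr' (by
      filter_upwards [eventually_ge_atTop 0] with t ht using (hconst t ht).symm)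
    have := tendsto_nhds_unique h1 (tendsto_tail_atTop δ)
    linarith
  have hbdd : BddAbove Z := by
    obtain ⟨b, hb⟩ := ((tendsto_tail_atTop ρ).eventually (gt_mem_nhds zero_lt_one)).exists
    refine ⟨b, fun z hz => ?_⟩
    by_contra! hlt
    have h1 := (tail_eq_one_iff ρ z).2 hz
    have h2 := tail_antitone ρ hlt.le
    linarith
  have hmem : ρ (Set.Iio (sSup Z)) = 0 := by
    rw [← tail_eq_one_iff]
    refine tendsto_nhds_unique (tendsto_tail_left ρ (sSup Z)) (tendsto_const_nhds.congr' ?_)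
    filter_upwards [self_mem_nhdsWithin] with z hz
    obtain ⟨z', hz', hlt⟩ := exists_lt_of_lt_csSup hne hz
    exact ((tail_eq_one_iff ρ z).2 (measure_mono_null (Set.Iio_subset_Iio hlt.le) hz')).symm
  have hnot : ∀ z, sSup Z < z → ρ (Set.Iio z) ≠ 0 := fun z hz h0 =>
    hz.not_ge (le_csSup hbdd h0)
  exact ⟨sSup Z, ⟨h.null_Iio hmem, fun z hz h0 => hnot z hz (h.symm.null_of_null' hp' h0)⟩,
    ⟨h.symm.null_Iio hmem, fun z hz h0 => hnot z hz (h.null_of_null' hp h0)⟩⟩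

lemma atom_null (h : MinDiffIndep μ ν ρ δ) (hν : ∀ x, ν ≠ Measure.dirac x) (hb : Bottom μ ℓ)
    (h0 : μ {ℓ} = 0) : ν {ℓ} = 0 := by
  have : IsProbabilityMeasure (δ.map Neg.neg) := Measure.isProbabilityMeasure_map (by fun_prop)
  refine h.null_of_null (measurableSet_singleton _) ?_
    (h.symm.null_of_null' (h.symm.tail_zero_pos hν) h0)
  rintro y rfl
  rw [hb.tail_eq_one]; exact one_pos

/-- The tail identity at `y = ℓ`. If `ℓ` is an atom of `ν`, it is one of the almost sure points.
Otherwise `y` decreases to `ℓ`, which yields open tails, and a left limit in `t` restores the closed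
ones. -/
lemma tail_bottom (h : MinDiffIndep μ ν ρ δ) (hbμ : Bottom μ ℓ) (hbν : Bottom ν ℓ) (hat : ν {ℓ} = 0 → μ {ℓ} = 0) :
    ∀ t, 0 ≤ t → tail δ 0 * tail μ (ℓ + t) = tail δ t := by
  by_cases h0 : ν {ℓ} = 0
  · have hμ0 := hat h0
    have hIoi : μ.real (Set.Ioi ℓ) = 1 := by
      rw [hbμ.measureReal_Ioi, measureReal_def, hμ0]; simp
    have hfreq : ∃ᶠ y in 𝓝[>] ℓ, ∀ t, 0 ≤ t →
        tail δ 0 * tail μ (y + t) = tail δ t * tail μ y := by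
      rw [Filter.frequently_iff]
      intro V hV
      obtain ⟨z, hz, hzV⟩ := (mem_nhdsGT_iff_exists_Ioo_subset' (lt_add_one ℓ)).1 hV
      obtain ⟨y, hy1, hy2, hy3⟩ := hbν.exists_between h0 h.ae_tail_add hz
      exact ⟨y, hzV ⟨hy1, hy2⟩, hy3⟩
    have hright : ∀ t, 0 ≤ t → tail δ 0 * μ.real (Set.Ioi (ℓ + t)) = tail δ t := by
      intro t ht
      have l1 : Tendsto (fun y => tail δ 0 * tail μ (y + t)) (𝓝[>] ℓ)
          (𝓝 (tail δ 0 * μ.real (Set.Ioi (ℓ + t)))) := by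
        refine ((tendsto_tail_right μ (ℓ + t)).comp ?_).const_mul _
        refine tendsto_nhdsWithin_iff.2 ⟨tendsto_nhdsWithin_of_tendsto_nhds ?_, ?_⟩
        · have : Continuous fun r : ℝ => r + t := by fun_prop
          exact this.tendsto ℓ
        · filter_upwards [self_mem_nhdsWithin] with r hr
          simpa using hr
      have l2 : Tendsto (fun y => tail δ t * tail μ y) (𝓝[>] ℓ) (𝓝 (tail δ t * 1)) := by
        rw [← hIoi]; exact (tendsto_tail_right μ ℓ).const_mul _
      have := tendsto_nhds_unique_of_frequently_eq l1 l2 (hfreq.mono fun y hy => hy t ht)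
      linarith
    intro t ht
    rcases ht.eq_or_lt with rfl | ht
    · rw [add_zero, hbμ.tail_eq_one, mul_one]
    have l1 : Tendsto (fun s => tail δ 0 * tail μ (ℓ + s)) (𝓝[<] t)
        (𝓝 (tail δ 0 * tail μ (ℓ + t))) := by
      refine ((tendsto_tail_left μ (ℓ + t)).comp ?_).const_mul _
      refine tendsto_nhdsWithin_iff.2 ⟨tendsto_nhdsWithin_of_tendsto_nhds ?_, ?_⟩
      · have : Continuous fun r : ℝ => ℓ + r := by fun_prop
        exact this.tendsto t
      · filter_upwards [self_mem_nhdsWithin] with r hr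
        simpa using hr
    refine le_antisymm ?_ ?_
    · refine ge_of_tendsto (tendsto_tail_left δ t) ?_
      filter_upwards [self_mem_nhdsWithin, Ioo_mem_nhdsLT ht] with s hs hs'
      rw [← hright s hs'.1.le]
      refine mul_le_mul_of_nonneg_left (measureReal_mono fun x (hx : ℓ + t ≤ x) => ?_)
        (tail_nonneg _ _)
      have : s < t := hs
      exact lt_of_lt_of_le (by linarith) hx
    · refine le_of_tendsto_of_tendsto (tendsto_tail_left δ t) l1 ?_
      filter_upwards [Ioo_mem_nhdsLT ht] with s hs
      rw [← hright s hs.1.le]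
      exact mul_le_mul_of_nonneg_left (measureReal_mono Set.Ioi_subset_Ici_self) (tail_nonneg _ _)
  · have : ∃ y ∈ ({ℓ} : Set ℝ), ∀ t, 0 ≤ t →
        tail δ 0 * tail μ (y + t) = tail δ t * tail μ y := by
      by_contra! hcon
      refine h0 (measure_mono_null (fun y hy => ?_) h.ae_tail_add)
      obtain ⟨t, ht, hne⟩ := hcon y hy
      exact fun hgood => hne (hgood t ht)
    obtain ⟨y, rfl, hy⟩ := this
    intro t ht
    rw [hy t ht, hbμ.tail_eq_one, mul_one]

lemma ae_memoryless (h : MinDiffIndep μ ν ρ δ) (hμ : ∀ x, μ ≠ Measure.dirac x)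
    (hbμ : Bottom μ ℓ) (hbν : Bottom ν ℓ) (hat : ν {ℓ} = 0 → μ {ℓ} = 0) :
    ∀ᵐ y ∂ν, y - ℓ ∈ memoryless fun t => tail μ (ℓ + t) := by
  filter_upwards [h.ae_tail_add, hbν.ae_le] with y hy hle
  refine ⟨sub_nonneg.2 hle, fun t ht => ?_⟩
  have h1 := h.tail_bottom hbμ hbν hat t ht
  have h2 := hy t ht
  rw [← h1, mul_assoc] at h2
  have h3 := mul_left_cancel₀ (h.tail_zero_pos hμ).ne' h2
  have e1 : ℓ + (y - ℓ + t) = y + t := by ring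
  have e2 : ℓ + (y - ℓ) = y := by ring
  simp only [e1, e2, h3, mul_comm]

end MinDiffIndep

section ShiftedTail

variable (μ ℓ)

lemma shifted_antitone : Antitone fun t => tail μ (ℓ + t) := fun a b hab =>
  tail_antitone μ (by linarith)

lemma shifted_left (t : ℝ) :
    Tendsto (fun t => tail μ (ℓ + t)) (𝓝[<] t) (𝓝 (tail μ (ℓ + t))) := by
  refine (tendsto_tail_left μ (ℓ + t)).comp ?_
  refine tendsto_nhdsWithin_iff.2 ⟨tendsto_nhdsWithin_of_tendsto_nhds ?_, ?_⟩
  · have : Continuous fun r : ℝ => ℓ + r := by fun_prop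
    exact this.tendsto t
  · filter_upwards [self_mem_nhdsWithin] with r hr
    simpa using hr

lemma shifted_atTop : Tendsto (fun t => tail μ (ℓ + t)) atTop (𝓝 0) :=
  (tendsto_tail_atTop μ).comp (tendsto_atTop_add_const_left atTop ℓ tendsto_id)

end ShiftedTail

namespace MinDiffIndep

/-- With no atom at the bottom, `ν` charges points arbitrarily close to `ℓ`, so there are
arbitrarily small multiplicative points. -/
lemma eq_sExp_of_no_atom (h : MinDiffIndep μ ν ρ δ) (hμ : ∀ x, μ ≠ Measure.dirac x)
    (hbμ : Bottom μ ℓ) (hbν : Bottom ν ℓ) (hμ0 : μ {ℓ} = 0) (hν0 : ν {ℓ} = 0) :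
    ∃ l, 0 < l ∧ μ = sExp l ℓ := by
  have hIoi : μ.real (Set.Ioi ℓ) = 1 := by
    rw [hbμ.measureReal_Ioi, measureReal_def, hμ0]; simp
  obtain ⟨l, hl, hexp⟩ := eq_exp_of_memoryless (shifted_antitone μ ℓ)
    (by simpa using hbμ.tail_eq_one) (shifted_left μ ℓ) (shifted_atTop μ ℓ) (by
      intro ε hε
      have h1 : ∀ᶠ y in 𝓝[>] ℓ, 0 < tail μ y := (tendsto_tail_right μ ℓ).eventually
        (lt_mem_nhds (by rw [hIoi]; exact one_pos))
      obtain ⟨z, hz, hzV⟩ := (mem_nhdsGT_iff_exists_Ioo_subset' (lt_add_one ℓ)).1 h1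
      obtain ⟨y, hy1, hy2, hy3⟩ := hbν.exists_between hν0
        (h.ae_memoryless hμ hbμ hbν fun _ => hμ0) (lt_min hz (lt_add_of_pos_right ℓ hε))
      rw [lt_min_iff] at hy2
      refine ⟨y - ℓ, hy3, by linarith, by linarith, ?_⟩
      simpa using hzV ⟨hy1, hy2.1⟩)
  exact ⟨l, hl, eq_sExp hl hexp⟩

lemma prod_null (h : MinDiffIndep μ ν ρ δ) (h0 : ρ (Set.Ioi ℓ) = 0) :
    μ (Set.Ioi ℓ) = 0 ∨ ν (Set.Ioi ℓ) = 0 := by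
  have hmeas : Measurable fun p : ℝ × ℝ => (min p.1 p.2, p.1 - p.2) := by fun_prop
  have h1 : (ρ.prod δ) (Set.Ioi ℓ ×ˢ Set.univ) = 0 := by simp [h0]
  rw [← h, Measure.map_apply hmeas (measurableSet_Ioi.prod MeasurableSet.univ)] at h1
  have h2 : (μ.prod ν) (Set.Ioi ℓ ×ˢ Set.Ioi ℓ) = 0 :=
    measure_mono_null (fun p hp => by
      simp only [Set.mem_prod, Set.mem_Ioi, Set.mem_univ, and_true, Set.mem_preimage] at hp ⊢
      exact lt_min hp.1 hp.2) h1
  simpa using h2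

end MinDiffIndep

lemma Bottom.Ioi_ne_zero (hb : Bottom μ ℓ) (hμ : ∀ x, μ ≠ Measure.dirac x) :
    μ (Set.Ioi ℓ) ≠ 0 := fun h0 => hμ ℓ (eq_dirac_of_ae (by
  have h1 : ∀ᵐ x ∂μ, ¬ ℓ < x := by rw [ae_iff]; simpa [Set.Ioi] using h0
  filter_upwards [hb.ae_le, h1] with x h2 h3
  exact le_antisymm (not_lt.1 h3) h2))

namespace MinDiffIndep

/-- Otherwise the density of `ρ` vanishes above `ℓ`, so `X` and `Y` almost surely do not both exceed
`ℓ`; by independence one of them is constant. -/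
lemma exists_memoryless_pos (h : MinDiffIndep μ ν ρ δ) (hμ : ∀ x, μ ≠ Measure.dirac x)
    (hν : ∀ x, ν ≠ Measure.dirac x)
    (hbμ : Bottom μ ℓ) (hbν : Bottom ν ℓ) (hat : ν {ℓ} = 0 → μ {ℓ} = 0) :
    ∃ a ∈ memoryless (fun t => tail μ (ℓ + t)), 0 < a ∧ 0 < tail μ (ℓ + a) := by
  by_contra! hcon
  have hp := h.tail_zero_pos hμ
  have h1 : ρ (Set.Ioi ℓ) = 0 := by
    have h2 := congrArg (fun m => m (Set.Ioi ℓ)) (h.withDensity_eq le_rfl)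
    simp only [Measure.smul_apply, add_zero, smul_eq_mul] at h2
    rw [withDensity_apply _ measurableSet_Ioi] at h2
    have h3 : ∫⁻ y in Set.Ioi ℓ, ENNReal.ofReal (tail μ y) ∂ν = 0 := by
      rw [← lintegral_zero (μ := ν.restrict (Set.Ioi ℓ))]
      refine lintegral_congr_ae ((ae_restrict_iff' measurableSet_Ioi).2 ?_)
      filter_upwards [h.ae_memoryless hμ hbμ hbν hat] with y hy hlt
      have := hcon _ hy (sub_pos.2 hlt)
      rw [add_sub_cancel] at this
      simpa using this
    rw [h3] at h2
    have := h2.symm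
    rw [mul_eq_zero, ENNReal.ofReal_eq_zero] at this
    exact this.resolve_left hp.not_ge
  rcases h.prod_null h1 with h2 | h2
  · exact hbμ.Ioi_ne_zero hμ h2
  · exact hbν.Ioi_ne_zero hν h2

/-- A characterization of exponential and geometric laws: if `X`, `Y` are independent, not almost
surely constant, and `min X Y` is independent of `X - Y`, then both are shifted exponential with
the same shift, or both are shifted geometric on the same lattice. -/
theorem classification (h : MinDiffIndep μ ν ρ δ) (hμ : ∀ x, μ ≠ Measure.dirac x)
    (hν : ∀ x, ν ≠ Measure.dirac x) :
    (∃ l₁ l₂ c : ℝ, 0 < l₁ ∧ 0 < l₂ ∧ μ = sExp l₁ c ∧ ν = sExp l₂ c) ∨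
    (∃ θ₁ θ₂ M m : ℝ, 0 < θ₁ ∧ θ₁ < 1 ∧ 0 < θ₂ ∧ θ₂ < 1 ∧ 0 < m ∧
      μ = ssGeo (1 - θ₁) M m ∧ ν = ssGeo (1 - θ₂) M m) := by
  have hprob : IsProbabilityMeasure (δ.map Neg.neg) :=
    Measure.isProbabilityMeasure_map (by fun_prop)
  obtain ⟨ℓ, hbμ, hbν⟩ := h.exists_bottom hμ hν
  have hat : ν {ℓ} = 0 → μ {ℓ} = 0 := h.symm.atom_null hμ hbν
  have hat' : μ {ℓ} = 0 → ν {ℓ} = 0 := h.atom_null hν hbμ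
  by_cases hν0 : ν {ℓ} = 0
  · left
    obtain ⟨l₁, h1, h2⟩ := h.eq_sExp_of_no_atom hμ hbμ hbν (hat hν0) hν0
    obtain ⟨l₂, h3, h4⟩ := h.symm.eq_sExp_of_no_atom hν hbν hbμ hν0 (hat hν0)
    exact ⟨l₁, l₂, ℓ, h1, h3, h2, h4⟩
  right
  have hμ0 : μ {ℓ} ≠ 0 := fun h0 => hν0 (hat' h0)
  obtain ⟨a, ha, ha0, hfa⟩ := h.exists_memoryless_pos hμ hν hbμ hbν hat
  obtain ⟨b, hb, hb0, hgb⟩ := h.symm.exists_memoryless_pos hν hμ hbν hbμ hat'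
  have hf0 : tail μ (ℓ + 0) = 1 := by simpa using hbμ.tail_eq_one
  have hg0 : tail ν (ℓ + 0) = 1 := by simpa using hbν.tail_eq_one
  have hfpos : ∀ t, 0 < tail μ (ℓ + t) :=
    pos_of_memoryless (shifted_antitone μ ℓ) hf0 ha ha0 hfa
  have hgpos : ∀ t, 0 < tail ν (ℓ + t) :=
    pos_of_memoryless (shifted_antitone ν ℓ) hg0 hb hb0 hgb
  have hjump : ∀ {η : Measure ℝ} [IsProbabilityMeasure η], Bottom η ℓ → η {ℓ} ≠ 0 →
      ∀ t, 0 < t → tail η (ℓ + t) ≤ 1 - η.real {ℓ} := by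
    intro η _ hbη _ t ht
    rw [← hbη.measureReal_Ioi]
    exact measureReal_mono fun x (hx : ℓ + t ≤ x) => lt_of_lt_of_le (by linarith) hx
  have hreal : ∀ {η : Measure ℝ} [IsProbabilityMeasure η], η {ℓ} ≠ 0 → 1 - η.real {ℓ} < 1 := by
    intro η _ h0
    have : 0 < η.real {ℓ} := ENNReal.toReal_pos h0 (measure_ne_top _ _)
    linarith
  obtain ⟨m, hm, hm0, hlat⟩ := exists_lattice_of_memoryless (shifted_antitone μ ℓ) hf0 hfpos
    (hreal hμ0) (hjump hbμ hμ0) ha ha0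
  -- `ρ` is absolutely continuous with respect to `ν`, and `μ` with respect to `ρ` because `tail ν`
  -- never vanishes. This carries the lattice from `ν` to `μ`.
  have hnul : ∀ A : Set ℝ, MeasurableSet A → ν A = 0 → μ A = 0 := fun A hA h0 =>
    h.symm.null_of_null hA (fun y _ => by simpa using hgpos (y - ℓ))
      (h.null_of_null' (h.tail_zero_pos hμ) h0)
  let M := ℓ / m
  have hpt : ∀ k : ℕ, m * (M + k) = ℓ + k * m := fun k => by
    simp only [M]; field_simp
  have hνlat : ∀ᵐ y ∂ν, ∃ k : ℕ, y = m * (M + k) := by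
    filter_upwards [h.ae_memoryless hμ hbμ hbν hat] with y hy
    obtain ⟨k, hk⟩ := hlat _ hy
    exact ⟨k, by rw [hpt]; linarith⟩
  have hmeasl : MeasurableSet {y : ℝ | ∃ k : ℕ, y = m * (M + k)} :=
    Set.Countable.measurableSet ((Set.countable_range fun k : ℕ => m * (M + k)).mono (by
      rintro y ⟨k, hk⟩; exact ⟨k, hk.symm⟩))
  have hμlat : ∀ᵐ y ∂μ, ∃ k : ℕ, y = m * (M + k) := hnul _ hmeasl.compl hνlat
  have hfk : ∀ k : ℕ, tail μ (m * (M + k)) = tail μ (ℓ + m) ^ k := fun k => by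
    rw [hpt]; exact (memoryless_nsmul (f := fun t => tail μ (ℓ + t)) hf0 hm k).2
  have hθ₁ : tail μ (ℓ + m) < 1 := (hjump hbμ hμ0 m hm0).trans_lt (hreal hμ0)
  have hμgeo := eq_ssGeo hm0 hμlat hfk
  -- Without this atom the tail at `ℓ + m` would equal its value at `ℓ + 2m`, its own square,
  -- although it lies strictly between `0` and `1`.
  have hmμ : μ {ℓ + m} ≠ 0 := by
    intro h0
    have e1 : (Set.Ici (ℓ + m) : Set ℝ) =ᵐ[μ] (Set.Ici (ℓ + (2 : ℕ) * m) : Set ℝ) := by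
      refine eventuallyEq_set.2 ?_
      have h0' : ∀ᵐ y ∂μ, y ≠ ℓ + m := by rw [ae_iff]; simpa using h0
      filter_upwards [hμlat, h0'] with y hy hne
      obtain ⟨k, rfl⟩ := hy
      rw [hpt] at hne ⊢
      simp only [Set.mem_Ici]
      constructor
      · intro hle
        have h1 : (1 : ℝ) ≤ k := by
          by_contra! hlt
          nlinarith
        have h2 : k ≠ 1 := by rintro rfl; simp at hne
        have h3 : 2 ≤ k := by
          have : 1 ≤ k := by exact_mod_cast h1
          omega
        have h4 : ((2 : ℕ) : ℝ) ≤ k := by exact_mod_cast h3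
        gcongr
      · intro hle; push_cast at hle; linarith
    have e2 : tail μ (ℓ + m) = tail μ (ℓ + (2 : ℕ) * m) := measureReal_congr e1
    have e3 := (memoryless_nsmul (f := fun t => tail μ (ℓ + t)) hf0 hm 2).2
    have e4 := hfpos m
    rw [e3] at e2
    nlinarith
  -- An atom of `μ` cannot be exceptional, so the spacing found from `μ` is also multiplicative for
  -- the tail of `ν`.
  have hm' : m ∈ memoryless fun t => tail ν (ℓ + t) := by
    have : ∃ y ∈ ({ℓ + m} : Set ℝ), y - ℓ ∈ memoryless fun t => tail ν (ℓ + t) := by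
      by_contra! hcon
      exact hmμ (measure_mono_null (fun y hy => hcon y hy)
        (h.symm.ae_memoryless hν hbν hbμ hat'))
    obtain ⟨y, rfl, hy⟩ := this
    simpa using hy
  have hgk : ∀ k : ℕ, tail ν (m * (M + k)) = tail ν (ℓ + m) ^ k := fun k => by
    rw [hpt]; exact (memoryless_nsmul (f := fun t => tail ν (ℓ + t)) hg0 hm' k).2
  exact ⟨tail μ (ℓ + m), tail ν (ℓ + m), M, m, hfpos m, hθ₁, hgpos m,
    (hjump hbν hν0 m hm0).trans_lt (hreal hν0), hm0, hμgeo, eq_ssGeo hm0 hνlat hgk⟩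

end MinDiffIndep

end

/-! ### Drift from balance; the exponential and degenerate families. -/

section

section Drift

variable {μ ν ρ : Measure ℝ} [IsProbabilityMeasure μ] [IsProbabilityMeasure ν]
  [IsProbabilityMeasure ρ]

lemma Balanced.map_min (hb : Balanced μ ν ρ) :
    ((μ.prod ν).prod ρ).map (fun p => min p.2 p.1.2) = μ := by
  have h1 := congrArg (Measure.map fun p : (ℝ × ℝ) × ℝ => p.1.1) hb
  rw [Measure.map_map (by fun_prop) measurable_site] at h1
  have h2 : ((μ.prod ν).prod ρ).map (fun p => p.1.1) = μ :=
    (measurePreserving_fst.comp measurePreserving_fst).map_eq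
  rw [h2] at h1
  exact h1

/-- Under balance `μ` is the law of `min U E ≤ E`. Equality of the means would force `min U E = E`
almost surely, that is `μ = ν`. -/
lemma Balanced.hasDrift (hb : Balanced μ ν ρ) {c : ℝ} (hν : ∀ᵐ y ∂ν, c ≤ y)
    (hρ : ∀ᵐ y ∂ρ, c ≤ y) (hint : Integrable id ν) (hne : μ ≠ ν) : HasDrift μ ν := by
  let e : (ℝ × ℝ) × ℝ → ℝ := fun p => p.1.2
  let f : (ℝ × ℝ) × ℝ → ℝ := fun p => min p.2 p.1.2
  have he : MeasurePreserving e ((μ.prod ν).prod ρ) ν :=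
    measurePreserving_snd.comp measurePreserving_fst
  have hu : MeasurePreserving (fun p : (ℝ × ℝ) × ℝ => p.2) ((μ.prod ν).prod ρ) ρ :=
    measurePreserving_snd
  have hf : MeasurePreserving f ((μ.prod ν).prod ρ) μ := ⟨by fun_prop, hb.map_min⟩
  have hei : Integrable e ((μ.prod ν).prod ρ) := he.integrable_comp_of_integrable hint
  have hfi : Integrable f ((μ.prod ν).prod ρ) := by
    refine (hei.abs.add (integrable_const |c|)).mono' (by fun_prop) ?_
    filter_upwards [he.quasiMeasurePreserving.ae hν, hu.quasiMeasurePreserving.ae hρ] with p h1 h2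
    simp only [f, Pi.add_apply, Real.norm_eq_abs]
    have h3 : c ≤ min p.2 p.1.2 := le_min h2 h1
    have h4 : min p.2 p.1.2 ≤ p.1.2 := min_le_right _ _
    refine abs_le.2 ⟨?_, ?_⟩
    · have := neg_abs_le c; have := abs_nonneg (e p); linarith
    · have := le_abs_self (e p); have := abs_nonneg c
      simp only [e] at *; linarith
  have hμi : Integrable id μ := by
    rw [← hf.map_eq, integrable_map_measure (by fun_prop) (by fun_prop)]; exact hfi
  refine ⟨hμi, id, measurable_id, fun _ => le_rfl, hint, ?_⟩
  have e1 : ∫ y, y ∂μ = ∫ p, f p ∂((μ.prod ν).prod ρ) := by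
    rw [← hf.map_eq, integral_map hf.measurable.aemeasurable (by fun_prop), hf.map_eq]
  have e2 : ∫ y, id y ∂ν = ∫ p, e p ∂((μ.prod ν).prod ρ) := by
    rw [← he.map_eq, integral_map he.measurable.aemeasurable (by fun_prop), he.map_eq]; rfl
  rw [e1, e2]
  have hle : f ≤ᵐ[(μ.prod ν).prod ρ] e := ae_of_all _ fun p => min_le_right _ _
  refine lt_of_le_of_ne (integral_mono_ae hfi hei hle) fun heq => hne ?_
  have := (integral_eq_iff_of_ae_le hfi hei hle).1 heq
  exact hf.map_eq.symm.trans ((Measure.map_congr this).trans he.map_eq)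

end Drift

section Exponential

lemma measurable_sExp_density (l c : ℝ) : Measurable fun y : ℝ =>
    ENNReal.ofReal (if c ≤ y then l * Real.exp (-(l * (y - c))) else 0) :=
  ENNReal.measurable_ofReal.comp (Measurable.ite measurableSet_Ici (by fun_prop) (by fun_prop))

lemma measurePreserving_minDiff : MeasurePreserving
    (fun p : ℝ × ℝ => (min p.2 p.1, p.1 - p.2)) (volume.prod volume) (volume.prod volume) := by
  have s1 : MeasurePreserving (fun p : ℝ × ℝ => (p.1, p.2 - p.1)) (volume.prod volume)
      (volume.prod volume) :=
    (MeasurePreserving.id volume).skew_product (g := fun u b : ℝ => b - u) (by fun_prop)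
      (ae_of_all _ fun u => (measurePreserving_sub_right volume u).map_eq)
  have s2 : MeasurePreserving (fun p : ℝ × ℝ => (p.1, p.2 - max (-p.1) 0)) (volume.prod volume)
      (volume.prod volume) :=
    (MeasurePreserving.id volume).skew_product (g := fun d u : ℝ => u - max (-d) 0) (by fun_prop)
      (ae_of_all _ fun d => (measurePreserving_sub_right volume (max (-d) 0)).map_eq)
  have := ((Measure.measurePreserving_swap.comp s2).comp Measure.measurePreserving_swap).comp
    (s1.comp Measure.measurePreserving_swap)
  convert this using 1
  funext p
  simp only [Function.comp_apply, Prod.swap]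
  congr 1
  rcases le_total p.2 p.1 with h | h
  · rw [min_eq_left h, max_eq_right (by linarith)]; ring
  · rw [min_eq_right h, max_eq_left (by linarith)]; ring

lemma measurePreserving_unMinDiff : MeasurePreserving
    (fun p : ℝ × ℝ => (p.1 + max p.2 0, p.1 + max (-p.2) 0)) (volume.prod volume)
      (volume.prod volume) := by
  have s1 : MeasurePreserving (fun p : ℝ × ℝ => (p.1, p.2 + max (-p.1) 0)) (volume.prod volume)
      (volume.prod volume) :=
    (MeasurePreserving.id volume).skew_product (g := fun d m : ℝ => m + max (-d) 0) (by fun_prop)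
      (ae_of_all _ fun d => (measurePreserving_add_right volume (max (-d) 0)).map_eq)
  have s2 : MeasurePreserving (fun p : ℝ × ℝ => (p.1, p.2 + p.1)) (volume.prod volume)
      (volume.prod volume) :=
    (MeasurePreserving.id volume).skew_product (g := fun u d : ℝ => d + u) (by fun_prop)
      (ae_of_all _ fun u => (measurePreserving_add_right volume u).map_eq)
  have := ((Measure.measurePreserving_swap.comp s2).comp Measure.measurePreserving_swap).comp
    (s1.comp Measure.measurePreserving_swap)
  convert this using 1
  funext p
  simp only [Function.comp_apply, Prod.swap]
  congr 1
  rcases le_total 0 p.2 with h | h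
  · rw [max_eq_left h, max_eq_right (by linarith)]; ring
  · rw [max_eq_right h, max_eq_left (by linarith)]; ring

/-- Up to reordering, `site` replaces `(E, U)` by minimum and difference and then rebuilds a pair
from `Q` and the difference; both are compositions of shears. -/
lemma measurePreserving_site : MeasurePreserving site
    (((volume : Measure ℝ).prod volume).prod volume) ((volume.prod volume).prod volume) := by
  have a1 := measurePreserving_prodAssoc (volume : Measure ℝ) (volume : Measure ℝ)
    (volume : Measure ℝ)
  have a2 := (MeasurePreserving.id (volume : Measure ℝ)).prod measurePreserving_minDiff
  have a3 := a1.symm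
  have a4 := (Measure.measurePreserving_swap (μ := (volume : Measure ℝ))
    (ν := (volume : Measure ℝ))).prod (MeasurePreserving.id (volume : Measure ℝ))
  have a5 := (MeasurePreserving.id (volume : Measure ℝ)).prod measurePreserving_unMinDiff
  have := a3.comp (a5.comp (a1.comp (a4.comp (a3.comp (a2.comp a1)))))
  convert this using 1
  funext p
  obtain ⟨⟨a, b⟩, u⟩ := p
  simp only [site, out, upd, Function.comp_apply, MeasurableEquiv.prodAssoc, Prod.map,
    MeasurableEquiv.coe_mk, Equiv.prodAssoc_apply, MeasurableEquiv.symm_mk,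
    Equiv.prodAssoc_symm_apply, Prod.swap, id, neg_sub]
  refine Prod.ext (Prod.ext rfl ?_) rfl
  rcases le_total u b with h | h
  · simp only [min_eq_left h, max_eq_left (sub_nonneg.2 h)]; ring
  · simp only [min_eq_right h, max_eq_right (sub_nonpos.2 h)]; ring

/-- The joint density is invariant: `site` preserves the exponent `(l₁ + l₂) Q + l₁ E + l₂ U` and
the octant with all entries at least `c`. Lebesgue measure is invariant as well. -/
lemma balanced_sExp {l₁ l₂ : ℝ} (h₁ : 0 < l₁) (h₂ : 0 < l₂) (c : ℝ) :
    Balanced (sExp (l₁ + l₂) c) (sExp l₁ c) (sExp l₂ c) := by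
  let d : ℝ → ℝ → ENNReal := fun l y =>
    ENNReal.ofReal (if c ≤ y then l * Real.exp (-(l * (y - c))) else 0)
  have hd : ∀ l, Measurable (d l) := fun l => measurable_sExp_density l c
  have hs : ∀ l, 0 < l → SFinite ((volume : Measure ℝ).withDensity (d l)) := fun l hl => by
    have := isProbabilityMeasure_sExp hl c
    change SFinite (sExp l c)
    infer_instance
  have i1 := hs _ (add_pos h₁ h₂)
  have i2 := hs _ h₁
  have i3 := hs _ h₂
  let f : (ℝ × ℝ) × ℝ → ENNReal := fun p => (d (l₁ + l₂) p.1.1 * d l₁ p.1.2) * d l₂ p.2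
  have hf : Measurable f := by
    have := hd (l₁ + l₂); have := hd l₁; have := hd l₂
    fun_prop
  have hprod : ((sExp (l₁ + l₂) c).prod (sExp l₁ c)).prod (sExp l₂ c) =
      ((volume.prod volume).prod volume).withDensity f := by
    change (((volume : Measure ℝ).withDensity (d (l₁ + l₂))).prod
      ((volume : Measure ℝ).withDensity (d l₁))).prod ((volume : Measure ℝ).withDensity (d l₂)) = _
    rw [prod_withDensity (hd _) (hd _), prod_withDensity (by
      have := hd (l₁ + l₂); have := hd l₁
      fun_prop) (hd _)]
  have hinv : ∀ p, f (site p) = f p := by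
    rintro ⟨⟨a, b⟩, u⟩
    simp only [f, d, site, out, upd]
    have key : ∀ x y z : ℝ, (if c ≤ x then (l₁ + l₂) * Real.exp (-((l₁ + l₂) * (x - c))) else 0) *
        (if c ≤ y then l₁ * Real.exp (-(l₁ * (y - c))) else 0) *
        (if c ≤ z then l₂ * Real.exp (-(l₂ * (z - c))) else 0) =
        if c ≤ x ∧ c ≤ y ∧ c ≤ z then (l₁ + l₂) * l₁ * l₂ *
          Real.exp (-((l₁ + l₂) * (x - c) + l₁ * (y - c) + l₂ * (z - c))) else 0 := by
      intro x y z
      by_cases hx : c ≤ x <;> by_cases hy : c ≤ y <;> by_cases hz : c ≤ z <;>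
        simp only [hx, hy, hz, if_true, if_false, and_true, and_false, mul_zero,
          zero_mul]
      rw [neg_add, neg_add, Real.exp_add, Real.exp_add]; ring
    have hn : ∀ l x : ℝ, 0 < l → 0 ≤ if c ≤ x then l * Real.exp (-(l * (x - c))) else 0 := by
      intro l x hl; split_ifs <;> positivity
    have hl := add_pos h₁ h₂
    rw [← ENNReal.ofReal_mul (hn _ _ hl), ← ENNReal.ofReal_mul (mul_nonneg (hn _ _ hl) (hn _ _ h₁)),
      ← ENNReal.ofReal_mul (hn _ _ hl), ← ENNReal.ofReal_mul (mul_nonneg (hn _ _ hl) (hn _ _ h₁)),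
      key, key]
    congr 1
    rcases le_total u b with h | h
    · rw [min_eq_left h, max_eq_right (by linarith)]
      have e1 : (c ≤ u ∧ c ≤ a + b - u ∧ c ≤ a + 0) ↔ (c ≤ a ∧ c ≤ b ∧ c ≤ u) :=
        ⟨fun ⟨x, y, z⟩ => ⟨by linarith, by linarith, x⟩,
          fun ⟨x, y, z⟩ => ⟨z, by linarith, by linarith⟩⟩
      simp only [e1]
      congr 3; ring
    · rw [min_eq_right h, max_eq_left (by linarith)]
      have e1 : (c ≤ b ∧ c ≤ a + b - b ∧ c ≤ a + (u - b)) ↔ (c ≤ a ∧ c ≤ b ∧ c ≤ u) :=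
        ⟨fun ⟨x, y, z⟩ => ⟨by linarith, by linarith, by linarith⟩,
          fun ⟨x, y, z⟩ => ⟨y, by linarith, by linarith⟩⟩
      simp only [e1]
      congr 3; ring
  rw [Balanced, hprod]
  ext s hs
  rw [Measure.map_apply measurable_site hs, withDensity_apply _ (measurable_site hs),
    withDensity_apply _ hs, ← measurePreserving_site.setLIntegral_comp_preimage hs hf]
  simp only [hinv]

lemma ae_le_sExp (l c : ℝ) : ∀ᵐ y ∂sExp l c, c ≤ y := by
  rw [sExp, ae_withDensity_iff (measurable_sExp_density l c)]
  refine ae_of_all _ fun y hy => ?_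
  by_contra hlt
  simp [hlt] at hy

lemma integrable_id_sExp {l : ℝ} (hl : 0 < l) (c : ℝ) : Integrable id (sExp l c) := by
  have := isProbabilityMeasure_sExp hl c
  have h1 : Integrable (fun y => y - c) (sExp l c) := by
    have hderiv : ∀ x ∈ Set.Ici c, HasDerivAt
        (fun y => -((y - c) * Real.exp (-(l * (y - c))) + l⁻¹ * Real.exp (-(l * (y - c)))))
        ((x - c) * (l * Real.exp (-(l * (x - c))))) x := by
      intro x _
      have h0 : HasDerivAt (fun y => y - c) 1 x := (hasDerivAt_id x).sub_const c
      have h1 : HasDerivAt (fun y => -(l * (y - c))) (-l) x := by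
        simpa using (h0.const_mul l).fun_neg
      have h2 := ((h0.fun_mul h1.exp).fun_add (h1.exp.const_mul l⁻¹)).fun_neg
      have e : ∀ E : ℝ, (x - c) * (l * E) = -(1 * E + (x - c) * (E * -l) + l⁻¹ * (E * -l)) := by
        intro E; field_simp; ring
      rw [e]
      exact h2
    have hpos : ∀ x ∈ Set.Ioi c, 0 ≤ (x - c) * (l * Real.exp (-(l * (x - c)))) := fun x hx => by
      have : 0 ≤ x - c := sub_nonneg.2 (le_of_lt hx)
      positivity
    have hlim : Tendsto (fun y => -((y - c) * Real.exp (-(l * (y - c))) +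
        l⁻¹ * Real.exp (-(l * (y - c))))) atTop (𝓝 0) := by
      have h1 : Tendsto (fun y : ℝ => l * (y - c)) atTop atTop :=
        (tendsto_atTop_add_const_right atTop (-c) tendsto_id).const_mul_atTop hl
      have h2 := ((Real.tendsto_pow_mul_exp_neg_atTop_nhds_zero 1).comp h1).const_mul l⁻¹
      have h3 := (Real.tendsto_exp_neg_atTop_nhds_zero.comp h1).const_mul l⁻¹
      have h4 := (h2.add h3).neg
      simp only [mul_zero, add_zero, neg_zero] at h4
      refine h4.congr fun y => ?_
      simp only [Function.comp_apply, pow_one]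
      field_simp
    have hint := integrableOn_Ioi_deriv_of_nonneg' hderiv hpos hlim
    rw [sExp, integrable_withDensity_iff (measurable_sExp_density l c)
      (ae_of_all _ fun _ => ENNReal.ofReal_lt_top)]
    rw [← integrableOn_Ici_iff_integrableOn_Ioi, ← integrable_indicator_iff measurableSet_Ici]
      at hint
    refine hint.congr (ae_of_all _ fun y => ?_)
    by_cases hy : c ≤ y
    · rw [Set.indicator_of_mem (show y ∈ Set.Ici c from hy)]
      simp only [hy, if_true]
      rw [ENNReal.toReal_ofReal (by positivity)]
    · rw [Set.indicator_of_notMem (show y ∉ Set.Ici c from hy)]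
      simp [hy]
  have := h1.add (integrable_const c)
  refine this.congr (ae_of_all _ fun y => ?_)
  simp

lemma hasDrift_sExp {l₁ l₂ : ℝ} (h₁ : 0 < l₁) (h₂ : 0 < l₂) (c : ℝ) :
    HasDrift (sExp (l₁ + l₂) c) (sExp l₁ c) := by
  have := isProbabilityMeasure_sExp h₁ c
  have := isProbabilityMeasure_sExp h₂ c
  have := isProbabilityMeasure_sExp (add_pos h₁ h₂) c
  refine (balanced_sExp h₁ h₂ c).hasDrift (ae_le_sExp _ _) (ae_le_sExp _ _)
    (integrable_id_sExp h₁ c) fun h => ?_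
  have h3 := congrArg (fun m => m (Set.Ici (c + 1))) h
  simp only [sExp_Ici h₁, sExp_Ici (add_pos h₁ h₂)] at h3
  rw [ENNReal.ofReal_eq_ofReal_iff (by positivity) (by positivity), Real.exp_eq_exp,
    max_eq_left (by linarith)] at h3
  linarith

end Exponential

section Degenerate

lemma balanced_dirac {c : ℝ} {ν : Measure ℝ} [IsProbabilityMeasure ν] (hν : ∀ᵐ y ∂ν, c ≤ y) :
    Balanced (Measure.dirac c) ν (Measure.dirac c) := by
  have h1 : ∀ᵐ p ∂(((Measure.dirac c).prod ν).prod (Measure.dirac c)), p.1.1 = c :=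
    (measurePreserving_fst.comp measurePreserving_fst).quasiMeasurePreserving.ae
      (p := fun y => y = c) (by simp [ae_dirac_eq])
  have h2 : ∀ᵐ p ∂(((Measure.dirac c).prod ν).prod (Measure.dirac c)), c ≤ p.1.2 :=
    (measurePreserving_snd.comp measurePreserving_fst).quasiMeasurePreserving.ae
      (p := fun y => c ≤ y) hν
  have h3 : ∀ᵐ p ∂(((Measure.dirac c).prod ν).prod (Measure.dirac c)), p.2 = c :=
    measurePreserving_snd.quasiMeasurePreserving.ae
      (p := fun y => y = c) (by simp [ae_dirac_eq])
  rw [Balanced]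
  refine Eq.trans (Measure.map_congr (g := id) ?_) Measure.map_id
  filter_upwards [h1, h2, h3] with p e1 e2 e3
  obtain ⟨⟨a, b⟩, u⟩ := p
  simp only at e1 e2 e3
  subst e1 e3
  simp [site, out, upd, e2]

/-- `ν` may have no mean; the truncation at `c + 1` is bounded and still has mean above `c`. -/
lemma hasDrift_dirac {c : ℝ} {ν : Measure ℝ} [IsProbabilityMeasure ν] (hν : ∀ᵐ y ∂ν, c ≤ y)
    (hne : ν ≠ Measure.dirac c) : HasDrift (Measure.dirac c) ν := by
  have hint : Integrable (fun y => min y (c + 1)) ν := by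
    refine (integrable_const (|c| + 1)).mono' (by fun_prop) ?_
    filter_upwards [hν] with y hy
    have h1 : c ≤ min y (c + 1) := le_min hy (by linarith)
    have h2 : min y (c + 1) ≤ c + 1 := min_le_right _ _
    rw [Real.norm_eq_abs, abs_le]
    constructor
    · have := neg_abs_le c; linarith
    · have := le_abs_self c; linarith
  refine ⟨integrable_dirac (by simp), fun y => min y (c + 1), by fun_prop,
    fun y => min_le_left _ _, hint, ?_⟩
  rw [integral_dirac]
  have hle : (fun _ => c) ≤ᵐ[ν] fun y => min y (c + 1) := by
    filter_upwards [hν] with y hy using le_min hy (by linarith)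
  have h1 := integral_mono_ae (integrable_const c) hint hle
  have h0 : ∫ _, c ∂ν = c := by simp
  rw [h0] at h1
  refine lt_of_le_of_ne h1 fun heq => hne (eq_dirac_of_ae ?_)
  have := (integral_eq_iff_of_ae_le (integrable_const c) hint hle).1 (by rw [h0]; exact heq)
  filter_upwards [this] with y hy
  rcases min_choice y (c + 1) with h | h <;> rw [h] at hy <;> linarith

end Degenerate

end

/-! ### The geometric family. -/

section

section Geometric

/-- The geometric law on `ℕ` with mass `(1 - θ) θ ^ k` at `k`. -/
def geoNat (θ : ℝ) : Measure ℕ :=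
  Measure.sum fun k : ℕ => ENNReal.ofReal ((1 - θ) * θ ^ k) • Measure.dirac k

lemma ssGeo_eq_map (θ M m : ℝ) :
    ssGeo (1 - θ) M m = (geoNat θ).map fun k : ℕ => m * (M + (k : ℝ)) := by
  rw [geoNat, Measure.map_sum (measurable_from_nat).aemeasurable, ssGeo]
  congr 1; funext k
  rw [Measure.map_smul, Measure.map_dirac, sub_sub_cancel]

lemma geoNat_singleton (θ : ℝ) (k : ℕ) :
    geoNat θ {k} = ENNReal.ofReal ((1 - θ) * θ ^ k) := by
  rw [geoNat, Measure.sum_apply _ (measurableSet_singleton k), tsum_eq_single k]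
  · simp
  · intro j hj; simp [hj]

lemma isProbabilityMeasure_geoNat {θ : ℝ} (h0 : 0 < θ) (h1 : θ < 1) :
    IsProbabilityMeasure (geoNat θ) := by
  constructor
  rw [geoNat, Measure.sum_apply _ MeasurableSet.univ]
  simp only [Measure.smul_apply, measure_univ, smul_eq_mul, mul_one]
  rw [← ENNReal.ofReal_tsum_of_nonneg (fun k => mul_nonneg (by linarith) (by positivity))
    ((summable_geometric_of_lt_one h0.le h1).mul_left _), tsum_mul_left,
    tsum_geometric_of_lt_one h0.le h1, mul_inv_cancel₀ (by linarith), ENNReal.ofReal_one]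

lemma isProbabilityMeasure_ssGeo {θ : ℝ} (h0 : 0 < θ) (h1 : θ < 1) (M m : ℝ) :
    IsProbabilityMeasure (ssGeo (1 - θ) M m) := by
  have := isProbabilityMeasure_geoNat h0 h1
  rw [ssGeo_eq_map]
  exact Measure.isProbabilityMeasure_map (measurable_from_nat).aemeasurable

/-- The one-site evolution on the natural numbers. -/
def siteNat (p : (ℕ × ℕ) × ℕ) : (ℕ × ℕ) × ℕ :=
  ((min p.2 p.1.2, p.1.1 + (p.1.2 - p.2)), p.1.1 + (p.2 - p.1.2))

lemma siteNat_siteNat (p : (ℕ × ℕ) × ℕ) : siteNat (siteNat p) = p := by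
  obtain ⟨⟨a, b⟩, u⟩ := p
  simp only [siteNat, Prod.mk.injEq]
  omega

/-- `siteNat` is an involution of a countable set, so invariance of point masses suffices: the
exponents of `θ₁` and `θ₂`, namely `Q + E` and `Q + U`, are conserved. -/
lemma map_siteNat {θ₁ θ₂ : ℝ} (h₁ : 0 < θ₁) (h₁' : θ₁ < 1) (h₂ : 0 < θ₂) (h₂' : θ₂ < 1) :
    (((geoNat (θ₁ * θ₂)).prod (geoNat θ₁)).prod (geoNat θ₂)).map siteNat =
      ((geoNat (θ₁ * θ₂)).prod (geoNat θ₁)).prod (geoNat θ₂) := by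
  have i1 := isProbabilityMeasure_geoNat h₁ h₁'
  have i2 := isProbabilityMeasure_geoNat h₂ h₂'
  have hlt : θ₁ * θ₂ < 1 := by nlinarith
  have i3 := isProbabilityMeasure_geoNat (mul_pos h₁ h₂) hlt
  have hmass : ∀ p : (ℕ × ℕ) × ℕ, (((geoNat (θ₁ * θ₂)).prod (geoNat θ₁)).prod (geoNat θ₂)) {p} =
      ENNReal.ofReal (((1 - θ₁ * θ₂) * (1 - θ₁) * (1 - θ₂)) *
        ((θ₁ * θ₂) ^ p.1.1 * θ₁ ^ p.1.2 * θ₂ ^ p.2)) := by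
    rintro ⟨⟨a, b⟩, u⟩
    rw [← Set.singleton_prod_singleton, Measure.prod_prod, ← Set.singleton_prod_singleton,
      Measure.prod_prod, geoNat_singleton, geoNat_singleton, geoNat_singleton]
    have n1 : 0 ≤ (1 - θ₁ * θ₂) * (θ₁ * θ₂) ^ a :=
      mul_nonneg (by linarith) (by positivity)
    have n2 : 0 ≤ (1 - θ₁) * θ₁ ^ b := mul_nonneg (by linarith) (by positivity)
    rw [← ENNReal.ofReal_mul n1, ← ENNReal.ofReal_mul (mul_nonneg n1 n2)]
    congr 1; ring
  refine Measure.ext_of_singleton fun p => ?_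
  have hmeas : Measurable siteNat := measurable_of_countable _
  rw [Measure.map_apply hmeas (measurableSet_singleton p)]
  have e : siteNat ⁻¹' {p} = {siteNat p} := by
    ext x
    simp only [Set.mem_preimage, Set.mem_singleton_iff]
    exact ⟨fun h => by rw [← h, siteNat_siteNat], fun h => by rw [h, siteNat_siteNat]⟩
  rw [e, hmass, hmass]
  congr 2
  obtain ⟨⟨a, b⟩, u⟩ := p
  simp only [siteNat, mul_pow, pow_add]
  rcases le_total u b with h | h
  · obtain ⟨d, rfl⟩ := Nat.exists_eq_add_of_le h
    simp only [min_eq_left h, Nat.add_sub_cancel_left, Nat.sub_eq_zero_of_le h, pow_add, pow_zero]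
    ring
  · obtain ⟨d, rfl⟩ := Nat.exists_eq_add_of_le h
    simp only [min_eq_right h, Nat.add_sub_cancel_left, Nat.sub_eq_zero_of_le h, pow_add, pow_zero]
    ring

/-- The embedding `k ↦ m * (M + k)` intertwines `siteNat` with `site`, truncated subtraction playing
the role of the positive part. -/
lemma balanced_ssGeo {θ₁ θ₂ M m : ℝ} (h₁ : 0 < θ₁) (h₁' : θ₁ < 1) (h₂ : 0 < θ₂) (h₂' : θ₂ < 1)
    (hm : 0 < m) :
    Balanced (ssGeo (1 - θ₁ * θ₂) M m) (ssGeo (1 - θ₁) M m) (ssGeo (1 - θ₂) M m) := by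
  have i1 := isProbabilityMeasure_geoNat h₁ h₁'
  have i2 := isProbabilityMeasure_geoNat h₂ h₂'
  have hlt : θ₁ * θ₂ < 1 := by nlinarith
  have i3 := isProbabilityMeasure_geoNat (mul_pos h₁ h₂) hlt
  let φ : ℕ → ℝ := fun k => m * (M + (k : ℝ))
  have hφ : Measurable φ := measurable_from_nat
  have hφ2 : Measurable (Prod.map φ φ) := measurable_of_countable _
  have hφ3 : Measurable (Prod.map (Prod.map φ φ) φ) := measurable_of_countable _
  have hsN : Measurable siteNat := measurable_of_countable _
  have hprod : ((ssGeo (1 - θ₁ * θ₂) M m).prod (ssGeo (1 - θ₁) M m)).prod (ssGeo (1 - θ₂) M m) =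
      (((geoNat (θ₁ * θ₂)).prod (geoNat θ₁)).prod (geoNat θ₂)).map
        (Prod.map (Prod.map φ φ) φ) := by
    rw [ssGeo_eq_map, ssGeo_eq_map, ssGeo_eq_map, Measure.map_prod_map _ _ hφ hφ,
      Measure.map_prod_map _ _ hφ2 hφ]
  rw [Balanced, hprod, Measure.map_map measurable_site hφ3]
  conv_rhs => rw [← map_siteNat h₁ h₁' h₂ h₂', Measure.map_map hφ3 hsN]
  congr 1
  funext p
  obtain ⟨⟨a, b⟩, u⟩ := p
  simp only [Function.comp_apply, Prod.map, siteNat, site, out, upd, φ]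
  rcases le_total u b with h | h
  · obtain ⟨d, rfl⟩ := Nat.exists_eq_add_of_le h
    have hle : m * (M + (u : ℝ)) ≤ m * (M + ((u + d : ℕ) : ℝ)) := by gcongr
    rw [min_eq_left hle, min_eq_left h, max_eq_right (by linarith)]
    simp only [Nat.add_sub_cancel_left, Nat.sub_eq_zero_of_le h]
    push_cast
    refine Prod.ext (Prod.ext rfl ?_) ?_ <;> ring
  · obtain ⟨d, rfl⟩ := Nat.exists_eq_add_of_le h
    have hle : m * (M + (b : ℝ)) ≤ m * (M + ((b + d : ℕ) : ℝ)) := by gcongr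
    rw [min_eq_right hle, min_eq_right h, max_eq_left (by linarith)]
    simp only [Nat.add_sub_cancel_left, Nat.sub_eq_zero_of_le h]
    push_cast
    refine Prod.ext (Prod.ext rfl ?_) ?_ <;> ring

lemma ae_le_ssGeo (θ M : ℝ) {m : ℝ} (hm : 0 < m) : ∀ᵐ y ∂ssGeo (1 - θ) M m, m * M ≤ y := by
  rw [ssGeo_eq_map, ae_map_iff (measurable_from_nat).aemeasurable measurableSet_Ici]
  refine ae_of_all _ fun k => ?_
  have : (0 : ℝ) ≤ k := Nat.cast_nonneg k
  gcongr; linarith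

lemma integrable_id_ssGeo {θ : ℝ} (h0 : 0 < θ) (h1 : θ < 1) (M : ℝ) {m : ℝ} (hm : 0 < m) :
    Integrable id (ssGeo (1 - θ) M m) := by
  rw [ssGeo_eq_map, integrable_map_measure (by fun_prop) (measurable_from_nat).aemeasurable]
  refine ⟨(measurable_from_nat).aestronglyMeasurable, ?_⟩
  rw [HasFiniteIntegral, geoNat, lintegral_sum_measure]
  simp only [lintegral_smul_measure, lintegral_dirac, smul_eq_mul, Function.comp_apply, id]
  have hs : Summable fun k : ℕ => (1 - θ) * m * (|M| * θ ^ k + (k : ℝ) ^ 1 * θ ^ k) :=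
    (((summable_geometric_of_lt_one h0.le h1).mul_left _).add
      (summable_pow_mul_geometric_of_norm_lt_one 1 (by rwa [Real.norm_of_nonneg h0.le]))).mul_left _
  refine lt_of_le_of_lt (ENNReal.tsum_le_tsum fun k => ?_) hs.tsum_ofReal_lt_top
  rw [← ofReal_norm, ← ENNReal.ofReal_mul (mul_nonneg (by linarith) (by positivity))]
  refine ENNReal.ofReal_le_ofReal ?_
  rw [norm_mul, Real.norm_of_nonneg hm.le, pow_one]
  have hk : ‖M + (k : ℝ)‖ ≤ |M| + k := by
    refine (norm_add_le _ _).trans ?_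
    simp
  have hθ : 0 < 1 - θ := by linarith
  calc (1 - θ) * θ ^ k * (m * ‖M + (k : ℝ)‖) ≤ (1 - θ) * θ ^ k * (m * (|M| + k)) := by gcongr
    _ = _ := by ring

lemma hasDrift_ssGeo {θ₁ θ₂ M m : ℝ} (h₁ : 0 < θ₁) (h₁' : θ₁ < 1) (h₂ : 0 < θ₂) (h₂' : θ₂ < 1)
    (hm : 0 < m) : HasDrift (ssGeo (1 - θ₁ * θ₂) M m) (ssGeo (1 - θ₁) M m) := by
  have hlt : θ₁ * θ₂ < 1 := by nlinarith
  have i1 := isProbabilityMeasure_ssGeo h₁ h₁' M m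
  have i2 := isProbabilityMeasure_ssGeo h₂ h₂' M m
  have i3 := isProbabilityMeasure_ssGeo (mul_pos h₁ h₂) hlt M m
  refine (balanced_ssGeo h₁ h₁' h₂ h₂' hm).hasDrift (ae_le_ssGeo _ _ hm) (ae_le_ssGeo _ _ hm)
    (integrable_id_ssGeo h₁ h₁' M hm) fun h => ?_
  have hinj : ∀ k : ℕ, m * (M + (k : ℝ)) = m * M ↔ k = 0 := fun k => by
    constructor
    · intro h; have h' := mul_left_cancel₀ hm.ne' h; simpa using h'
    · rintro rfl; simp
  have hpre : ∀ θ : ℝ, ssGeo (1 - θ) M m {m * M} = ENNReal.ofReal (1 - θ) := fun θ => by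
    rw [ssGeo_eq_map, Measure.map_apply measurable_from_nat (measurableSet_singleton _)]
    have e : (fun k : ℕ => m * (M + (k : ℝ))) ⁻¹' {m * M} = {0} := by
      ext k; simp only [Set.mem_preimage, Set.mem_singleton_iff, hinj]
    rw [e, geoNat_singleton]; simp
  have h3 := congrArg (fun η => η {m * M}) h
  simp only [hpre] at h3
  rw [ENNReal.ofReal_eq_ofReal_iff (by linarith) (by linarith)] at h3
  nlinarith

end Geometric

end

/-! ### The converse: invariance forces the three families. -/

section

variable {μ ν ρ δ : Measure ℝ} [IsProbabilityMeasure μ] [IsProbabilityMeasure ν]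
  [IsProbabilityMeasure ρ] [IsProbabilityMeasure δ]

lemma Balanced.map_min_prod (hb : Balanced μ ν ρ) :
    (ν.prod ρ).map (fun p => min p.1 p.2) = μ := by
  have h : MeasurePreserving (fun p : (ℝ × ℝ) × ℝ => (p.1.2, p.2)) ((μ.prod ν).prod ρ)
      (ν.prod ρ) :=
    (measurePreserving_snd (μ := μ) (ν := ν)).prod (MeasurePreserving.id ρ)
  rw [← h.map_eq, Measure.map_map (by fun_prop) (by fun_prop)]
  conv_rhs => rw [← hb.map_min]
  congr 1; funext p; simp [min_comm]

/-- The law of the canonical carrier at the origin. -/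
def carrierLaw (μ ν : Measure ℝ) [IsProbabilityMeasure μ] [IsProbabilityMeasure ν] : Measure ℝ :=
  (iidLaw μ ν).map fun w => carrier w 0

lemma measurable_carrier (n : ℤ) : Measurable fun w : Config => carrier w n :=
  Measurable.carrier n fun k _ => measurable_pi_apply k

instance : IsProbabilityMeasure (carrierLaw μ ν) :=
  Measure.isProbabilityMeasure_map (measurable_carrier 0).aemeasurable

/-- The environment at the origin is independent of the canonical carrier there. -/
lemma map_eval_carrier : (iidLaw μ ν).map (fun w => (w 0, carrier w 0)) =
    (μ.prod ν).prod (carrierLaw μ ν) := by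
  have hi : iIndep (fun k : ℤ => MeasurableSpace.comap (fun w : Config => w k) inferInstance)
      (iidLaw μ ν) :=
    iIndepFun_infinitePi (P := fun _ : ℤ => μ.prod ν) (X := fun _ w => w) (fun _ => measurable_id)
  have hind := indep_iSup_of_disjoint (fun k : ℤ => (measurable_pi_apply k).comap_le) hi
    (S := {0}) (T := Set.Iio 0) (by simp)
  rw [iSup_singleton] at hind
  have hmeas : Measurable[⨆ k ∈ Set.Iio (0 : ℤ),
      MeasurableSpace.comap (fun w : Config => w k) inferInstance] fun w : Config => carrier w 0 :=
    @Measurable.carrier _ (⨆ k ∈ Set.Iio (0 : ℤ),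
      MeasurableSpace.comap (fun w : Config => w k) inferInstance) (fun w => w) 0 fun k hk =>
      (Measurable.of_comap_le le_rfl).mono (le_iSup₂ (f := fun k (_ : k ∈ Set.Iio (0 : ℤ)) =>
        MeasurableSpace.comap (fun w : Config => w k) inferInstance) k hk) le_rfl
  have hIF : IndepFun (fun w : Config => w 0) (fun w => carrier w 0) (iidLaw μ ν) :=
    indep_of_indep_of_le_right hind hmeas.comap_le
  rw [(indepFun_iff_map_prod_eq_prod_map_map (measurable_pi_apply 0).aemeasurable
    (measurable_carrier 0).aemeasurable).1 hIF, Measure.infinitePi_map_eval]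
  rfl

lemma exists_eq_dirac_of_prod (h : μ.prod ν {p | p.1 ≠ p.2} = 0) :
    ∃ c, μ = Measure.dirac c ∧ ν = Measure.dirac c := by
  have hae : ∀ᵐ p ∂μ.prod ν, p.1 = p.2 := h
  have h1 := Measure.ae_ae_of_ae_prod hae
  obtain ⟨c, hc⟩ := h1.exists
  refine ⟨c, eq_dirac_of_ae ?_, eq_dirac_of_ae (hc.mono fun y hy => hy.symm)⟩
  filter_upwards [h1] with x hx
  obtain ⟨y, hy1, hy2⟩ := (hx.and hc).exists
  exact hy1.trans hy2.symm

/-- When `Q = E = c` everywhere, every constant carrier `U ≥ c` is a solution. -/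
lemma const_notMem_uniquelySolvable (c : ℝ) : (fun _ => (c, c) : Config) ∉ uniquelySolvable := by
  intro h
  have hs : ∀ w : ℝ, 0 ≤ w → IsSolution (fun _ => (c, c)) (fun _ _ => c) (fun _ _ => c)
      (fun _ _ => c + w) := fun w hw =>
    { init_Q := fun _ => rfl
      init_E := fun _ => rfl
      step_Q := fun _ _ => by rw [min_eq_right (by linarith)]
      step_E := fun _ _ => by ring
      step_U := fun _ _ => by ring }
  have h' : ∃! s : (ℤ → ℤ → ℝ) × (ℤ → ℤ → ℝ) × (ℤ → ℤ → ℝ),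
    IsSolution (fun _ => (c, c)) s.1 s.2.1 s.2.2 := h
  have := h'.unique (y₁ := (_, _, _)) (y₂ := (_, _, _)) (hs 0 le_rfl) (hs 1 zero_le_one)
  have h2 := congrFun (congrFun (congrArg (fun s => s.2.2) this) 0) 0
  simp at h2

section Converse

variable {Ω : Type*} [MeasurableSpace Ω] {P : Measure Ω} [IsProbabilityMeasure P] {X : Ω → Config}

lemma prod_ne_zero_of_solvable (hX : Measurable X) (hlaw : P.map X = iidLaw μ ν)
    (hsol : ∀ᵐ ω ∂P, X ω ∈ uniquelySolvable) : μ.prod ν {p | p.1 ≠ p.2} ≠ 0 := by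
  intro h0
  obtain ⟨c, rfl, rfl⟩ := exists_eq_dirac_of_prod h0
  have h1 : iidLaw (Measure.dirac c) (Measure.dirac c) = Measure.dirac (fun _ => (c, c)) := by
    have : ((Measure.dirac c).prod (Measure.dirac c) : Measure (ℝ × ℝ)) = Measure.dirac (c, c) :=
      Measure.dirac_prod_dirac
    simp only [iidLaw, this]
    exact Measure.infinitePi_dirac (fun _ : ℤ => ((c, c) : ℝ × ℝ))
  rw [h1] at hlaw
  have h2 : ∀ᵐ ω ∂P, X ω = fun _ => (c, c) := by
    apply ae_of_ae_map (p := fun x => x = fun _ => (c, c)) hX.aemeasurable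
    rw [hlaw]
    simp [ae_dirac_eq]
  obtain ⟨ω, h3, h4⟩ := (hsol.and h2).exists
  rw [h4] at h3
  exact const_notMem_uniquelySolvable c h3

/-- For an invariant i.i.d. law, the values and carriers at the origin satisfy the independence
property of the local evolution. -/
lemma minDiffIndep_of_invariant (hX : Measurable X) (hlaw : P.map X = iidLaw μ ν)
    (hsol : ∀ᵐ ω ∂P, X ω ∈ uniquelySolvable)
    (hinv : IdentDistrib (fun ω => dynamics (X ω)) X P P) :
    MinDiffIndep ν (carrierLaw μ ν) μ ((ν.prod (carrierLaw μ ν)).map fun p => p.1 - p.2) := by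
  have hosc := ae_oscillating (prod_ne_zero_of_solvable hX hlaw hsol)
  have hlaw' : P.map (fun ω => dynamics (X ω)) = iidLaw μ ν := hinv.map_eq.trans hlaw
  have h1 : ∀ᵐ ω ∂P, Oscillating (stagger (X ω)) := by
    apply ae_of_ae_map (p := fun x => Oscillating (stagger x)) hX.aemeasurable
    rw [hlaw]
    exact (measurePreserving_stagger μ ν).quasiMeasurePreserving.ae hosc
  have h2 : ∀ᵐ ω ∂P, Oscillating (reflect (dynamics (X ω))) := by
    apply ae_of_ae_map (p := fun x => Oscillating (reflect x)) hinv.aemeasurable_fst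
    rw [hlaw']
    exact (measurePreserving_reflect μ ν).quasiMeasurePreserving.ae hosc
  have hmin : Measurable fun p : ℝ × ℝ => (min p.1 p.2, p.1 - p.2) := by fun_prop
  let f : Config → ℝ × ℝ := fun x => ((x 0).2, carrier (stagger x) 0)
  let g : Config → ℝ × ℝ := fun y => ((y 0).1, (y 0).2 - carrier (reflect y) 0)
  have hst : Measurable stagger := (measurePreserving_stagger μ ν).measurable
  have hre : Measurable reflect := (measurePreserving_reflect μ ν).measurable
  have hf : Measurable f :=
    (measurable_pi_apply 0).snd.prodMk ((measurable_carrier 0).comp hst)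
  have hg : Measurable g :=
    (measurable_pi_apply 0).fst.prodMk
      ((measurable_pi_apply 0).snd.sub ((measurable_carrier 0).comp hre))
  have hpair : Measurable fun w : Config => (w 0, carrier w 0) :=
    (measurable_pi_apply 0).prodMk (measurable_carrier 0)
  have hm1 : Measurable fun p : (ℝ × ℝ) × ℝ => (p.1.2, p.2) := by fun_prop
  have hm2 : Measurable fun p : (ℝ × ℝ) × ℝ => (p.1.1, p.1.2 - p.2) := by fun_prop
  -- The two sides are `(min E_0 U_0, E_0 - U_0)` and `(Q'_0, E'_0 - U_1)`. Steps at times `1` and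
  -- `-1` make the step at time `0` canonical in both directions, so `U_0` comes from the old
  -- configuration and `U_1` from the new one.
  have hfg : (fun ω => ((fun p : ℝ × ℝ => (min p.1 p.2, p.1 - p.2)) ∘ f) (X ω)) =ᵐ[P]
      fun ω => g (dynamics (X ω)) := by
    filter_upwards [hsol, h1, h2] with ω hω ho1 ho2
    obtain ⟨Q, E, U, hs, hd⟩ := exists_isSolution_dynamics hω
    obtain ⟨h0, hst⟩ := isSolution_iff.1 hs
    have s0 := hst 0
    have s1 := hst 1
    have sm := hst (-1)
    simp only [zero_add, neg_add_cancel] at s0 sm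
    rw [h0] at s0 sm
    rw [← hd] at s0 s1
    have c1 := s0.eq_carrier s1.1 ho1
    have c2 := s0.eq_bwdCarrier sm ho2
    have e1 : dynamics (X ω) 0 = out (stagger (X ω) 0) (U 0 0) := congrFun s0.2 0
    have e2 : U 0 1 = upd (stagger (X ω) 0) (U 0 0) := s0.1 0
    have e3 : U 0 1 = carrier (reflect (dynamics (X ω))) 0 := by rw [c2]; rfl
    have e4 : U 0 0 = carrier (stagger (X ω)) 0 := by rw [c1]
    simp only [Function.comp_apply, f, g]
    rw [← e3, ← e4, e2, e1]
    simp only [out, upd, stagger]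
    refine Prod.ext (min_comm _ _) ?_
    rcases le_total (U 0 0) (X ω 0).2 with h | h
    · simp only [min_eq_left h, max_eq_right (sub_nonpos.2 h)]; ring
    · simp only [min_eq_right h, max_eq_left (sub_nonneg.2 h)]; ring
  have hL : P.map (fun ω => f (X ω)) = ν.prod (carrierLaw μ ν) := by
    have h3 : P.map (fun ω => f (X ω)) = (iidLaw μ ν).map f := by
      rw [← hlaw, Measure.map_map hf hX]; rfl
    have h4 : (iidLaw μ ν).map f = ((iidLaw μ ν).map (fun w => (w 0, carrier w 0))).map
        (fun p => (p.1.2, p.2)) := by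
      rw [Measure.map_map (by fun_prop) hpair]
      conv_rhs => rw [← (measurePreserving_stagger μ ν).map_eq]
      rw [Measure.map_map (hm1.comp hpair) hst]
      rfl
    rw [h3, h4, map_eval_carrier]
    exact ((measurePreserving_snd (μ := μ) (ν := ν)).prod
      (MeasurePreserving.id (carrierLaw μ ν))).map_eq
  -- By invariance the new configuration is i.i.d., so `Q'_0`, `E'_0` and the carrier coming from
  -- the right are independent.
  have hR : P.map (fun ω => g (dynamics (X ω))) =
      μ.prod ((ν.prod (carrierLaw μ ν)).map fun p => p.1 - p.2) := by
    have h3 : P.map (fun ω => g (dynamics (X ω))) = (iidLaw μ ν).map g := by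
      rw [← hlaw', AEMeasurable.map_map_of_aemeasurable hg.aemeasurable hinv.aemeasurable_fst]; rfl
    have h4 : (iidLaw μ ν).map g = ((iidLaw μ ν).map (fun w => (w 0, carrier w 0))).map
        (fun p => (p.1.1, p.1.2 - p.2)) := by
      rw [Measure.map_map (by fun_prop) hpair]
      conv_rhs => rw [← (measurePreserving_reflect μ ν).map_eq]
      rw [Measure.map_map (hm2.comp hpair) hre]
      rfl
    have h5 : MeasurePreserving (fun p : ℝ × ℝ => p.1 - p.2) (ν.prod (carrierLaw μ ν))
        ((ν.prod (carrierLaw μ ν)).map fun p => p.1 - p.2) := ⟨by fun_prop, rfl⟩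
    have i5 : IsProbabilityMeasure ((ν.prod (carrierLaw μ ν)).map fun p => p.1 - p.2) :=
      Measure.isProbabilityMeasure_map (by fun_prop)
    rw [h3, h4, map_eval_carrier]
    exact (((MeasurePreserving.id μ).prod h5).comp
      (measurePreserving_prodAssoc μ ν (carrierLaw μ ν))).map_eq
  rw [MinDiffIndep, ← hR, ← hL, ← Measure.map_congr hfg]
  exact Measure.map_map hmin (hf.comp hX)

end Converse

namespace MinDiffIndep

lemma map_min (h : MinDiffIndep μ ν ρ δ) : (μ.prod ν).map (fun p => min p.1 p.2) = ρ := by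
  have h1 := congrArg (Measure.map Prod.fst) h
  rw [Measure.map_map (by fun_prop) (by fun_prop), measurePreserving_fst.map_eq] at h1
  exact h1

/-- A variable that is a function of another one independent of it is constant. This settles the
cases where `X` or `Y` is a point mass. -/
lemma eq_dirac_of_ae_eq (h : MinDiffIndep μ ν ρ δ) {φ : ℝ → ℝ} (hφ : Measurable φ)
    (hae : ∀ᵐ p ∂μ.prod ν, min p.1 p.2 = φ (p.1 - p.2)) : ∃ q, ρ = Measure.dirac q := by
  have h1 : ∀ᵐ p ∂ρ.prod δ, p.1 = φ p.2 := by
    rw [← h, ae_map_iff (by fun_prop) (measurableSet_eq_fun (by fun_prop) (by fun_prop))]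
    exact hae
  have h2 := Measure.ae_ae_of_ae_prod h1
  obtain ⟨q, hq⟩ := h2.exists
  refine ⟨q, eq_dirac_of_ae ?_⟩
  filter_upwards [h2] with x hx
  obtain ⟨y, hy1, hy2⟩ := (hx.and hq).exists
  exact hy1.trans hy2.symm

lemma eq_dirac_of_left (h : MinDiffIndep μ ν ρ δ) {x : ℝ} (hμ : μ = Measure.dirac x) :
    ∃ q, ρ = Measure.dirac q := by
  refine h.eq_dirac_of_ae_eq (φ := fun d => x - max d 0) (by fun_prop) ?_
  have h1 : ∀ᵐ p ∂μ.prod ν, p.1 = x := measurePreserving_fst.quasiMeasurePreserving.ae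
    (p := fun y => y = x) (by rw [hμ]; simp [ae_dirac_eq])
  filter_upwards [h1] with p hp
  rw [hp]
  rcases le_total x p.2 with h | h
  · rw [min_eq_left h, max_eq_right (by linarith)]; ring
  · rw [min_eq_right h, max_eq_left (by linarith)]; ring

lemma eq_dirac_of_right (h : MinDiffIndep μ ν ρ δ) {y : ℝ} (hν : ν = Measure.dirac y) :
    ∃ q, ρ = Measure.dirac q := by
  have : IsProbabilityMeasure (δ.map Neg.neg) := Measure.isProbabilityMeasure_map (by fun_prop)
  exact h.symm.eq_dirac_of_left hν

lemma ae_le_of_eq_dirac (h : MinDiffIndep μ ν ρ δ) {q : ℝ} (hρ : ρ = Measure.dirac q) :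
    ∀ᵐ x ∂μ, q ≤ x := by
  have h1 : ∀ᵐ p ∂μ.prod ν, min p.1 p.2 = q := by
    apply ae_of_ae_map (p := fun y => y = q) (f := fun p : ℝ × ℝ => min p.1 p.2) (by fun_prop)
    rw [h.map_min, hρ]; simp [ae_dirac_eq]
  rw [← (measurePreserving_fst (μ := μ) (ν := ν)).map_eq,
    ae_map_iff (by fun_prop) measurableSet_Ici]
  filter_upwards [h1] with p hp
  rw [← hp]; exact min_le_left _ _

end MinDiffIndep

/-- The three families of marginals. -/
def IsInvariantMarginal (μ ν : Measure ℝ) : Prop :=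
  (∃ l₁ l₂ c : ℝ, 0 < l₁ ∧ 0 < l₂ ∧ μ = sExp (l₁ + l₂) c ∧ ν = sExp l₁ c) ∨
  (∃ θ₁ θ₂ M m : ℝ, 0 < θ₁ ∧ θ₁ < 1 ∧ 0 < θ₂ ∧ θ₂ < 1 ∧ 0 < m ∧
    μ = ssGeo (1 - θ₁ * θ₂) M m ∧ ν = ssGeo (1 - θ₁) M m) ∨
  (∃ (c : ℝ) (m : Measure ℝ), IsProbabilityMeasure m ∧ m (Set.Iio 0) = 0 ∧
    m ≠ Measure.dirac 0 ∧ μ = Measure.dirac c ∧ ν = m.map (fun y => y + c))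

lemma isInvariantMarginal_of_dirac {q : ℝ} (hμ : μ = Measure.dirac q) (hle : ∀ᵐ x ∂ν, q ≤ x)
    (hne : μ.prod ν {p | p.1 ≠ p.2} ≠ 0) : IsInvariantMarginal μ ν := by
  have hmeas : Measurable fun x : ℝ => x - q := by fun_prop
  have hν : ν = (ν.map fun x => x - q).map fun y => y + q := by
    rw [Measure.map_map (by fun_prop) hmeas]
    simp [Function.comp_def]
  refine Or.inr (Or.inr ⟨q, ν.map fun x => x - q, Measure.isProbabilityMeasure_map (by fun_prop),
    ?_, fun h => hne ?_, hμ, hν⟩)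
  · rw [Measure.map_apply hmeas measurableSet_Iio]
    refine measure_mono_null (fun x hx => ?_) hle
    simp only [Set.mem_preimage, Set.mem_Iio] at hx
    exact not_le.2 (sub_neg.1 hx)
  · rw [h, Measure.map_dirac, zero_add] at hν
    simp [hμ, hν, Measure.dirac_prod_dirac]

/-- Here `ν` is the law of `E` and `ρ` that of the carrier. The law of `Q` is that of their minimum,
which the balance identities already evaluate in the exponential and geometric cases. -/
lemma MinDiffIndep.isInvariantMarginal (h : MinDiffIndep ν ρ μ δ)
    (hne : μ.prod ν {p | p.1 ≠ p.2} ≠ 0) : IsInvariantMarginal μ ν := by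
  by_cases h1 : ∃ x, ν = Measure.dirac x
  · obtain ⟨x, hx⟩ := h1
    obtain ⟨q, hq⟩ := h.eq_dirac_of_left hx
    exact isInvariantMarginal_of_dirac hq (h.ae_le_of_eq_dirac hq) hne
  by_cases h2 : ∃ x, ρ = Measure.dirac x
  · obtain ⟨x, hx⟩ := h2
    obtain ⟨q, hq⟩ := h.eq_dirac_of_right hx
    exact isInvariantMarginal_of_dirac hq (h.ae_le_of_eq_dirac hq) hne
  push Not at h1 h2
  rcases h.classification h1 h2 with
    ⟨l₁, l₂, c, hl₁, hl₂, hν, hρ⟩ | ⟨θ₁, θ₂, M, m, a1, a2, a3, a4, hm, hν, hρ⟩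
  · refine Or.inl ⟨l₁, l₂, c, hl₁, hl₂, ?_, hν⟩
    have i1 := isProbabilityMeasure_sExp hl₁ c
    have i2 := isProbabilityMeasure_sExp hl₂ c
    have i3 := isProbabilityMeasure_sExp (add_pos hl₁ hl₂) c
    rw [← h.map_min, ← (balanced_sExp hl₁ hl₂ c).map_min_prod, hν, hρ]
  · refine Or.inr (Or.inl ⟨θ₁, θ₂, M, m, a1, a2, a3, a4, hm, ?_, hν⟩)
    have i1 := isProbabilityMeasure_ssGeo a1 a2 M m
    have i2 := isProbabilityMeasure_ssGeo a3 a4 M m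
    have i3 := isProbabilityMeasure_ssGeo (mul_pos a1 a3) (by nlinarith : θ₁ * θ₂ < 1) M m
    rw [← h.map_min, ← (balanced_ssGeo a1 a2 a3 a4 hm).map_min_prod, hν, hρ]

lemma IsInvariantMarginal.exists_balanced (h : IsInvariantMarginal μ ν) :
    HasDrift μ ν ∧ ∃ ρ : Measure ℝ, IsProbabilityMeasure ρ ∧ Balanced μ ν ρ := by
  rcases h with ⟨l₁, l₂, c, h₁, h₂, rfl, rfl⟩ | ⟨θ₁, θ₂, M, m, a1, a2, a3, a4, hm, rfl, rfl⟩ |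
    ⟨c, m, hm, h0, hne, rfl, rfl⟩
  · exact ⟨hasDrift_sExp h₁ h₂ c, _, isProbabilityMeasure_sExp h₂ c, balanced_sExp h₁ h₂ c⟩
  · exact ⟨hasDrift_ssGeo a1 a2 a3 a4 hm, _, isProbabilityMeasure_ssGeo a3 a4 M m,
      balanced_ssGeo a1 a2 a3 a4 hm⟩
  · have hmeas : Measurable fun y : ℝ => y + c := by fun_prop
    have hle : ∀ᵐ y ∂m.map (fun y => y + c), c ≤ y := by
      rw [ae_map_iff hmeas.aemeasurable measurableSet_Ici, ae_iff]
      refine measure_mono_null (fun y hy => ?_) h0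
      simp only [Set.mem_ofPred_eq, not_le] at hy
      exact show y < 0 by linarith
    refine ⟨hasDrift_dirac hle fun h => hne ?_, _, Measure.dirac.isProbabilityMeasure,
      balanced_dirac hle⟩
    have h1 := congrArg (Measure.map fun y : ℝ => y - c) h
    rw [Measure.map_map (by fun_prop) hmeas, Measure.map_dirac] at h1
    simpa [Function.comp_def] using h1

end

end UDToda

end

/-! ### The theorem. -/

theorem mainTheorem10 {Ω : Type*} [MeasurableSpace Ω] (P : Measure Ω) [IsProbabilityMeasure P]
    (Q E : ℤ → Ω → ℝ) (hQ : ∀ n, Measurable (Q n)) (hE : ∀ n, Measurable (E n))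
    (hindep : iIndepFun (fun (n : ℤ) (ω : Ω) => (Q n ω, E n ω)) P)
    (hident : ∀ n : ℤ,
      IdentDistrib (fun ω => (Q n ω, E n ω)) (fun ω => (Q 0 ω, E 0 ω)) P P)
    (hQE : IndepFun (Q 0) (E 0) P) :
    ((∀ᵐ ω ∂P, (fun n => (Q n ω, E n ω)) ∈ UDToda.uniquelySolvable) ∧
      IdentDistrib (fun ω => UDToda.dynamics (fun n => (Q n ω, E n ω)))
        (fun ω => (fun n => (Q n ω, E n ω) : UDToda.Config)) P P) ↔
    ((∃ l₁ l₂ c : ℝ, 0 < l₁ ∧ 0 < l₂ ∧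
        P.map (Q 0) = UDToda.sExp (l₁ + l₂) c ∧ P.map (E 0) = UDToda.sExp l₁ c) ∨
      (∃ θ₁ θ₂ M m : ℝ, 0 < θ₁ ∧ θ₁ < 1 ∧ 0 < θ₂ ∧ θ₂ < 1 ∧ 0 < m ∧
        P.map (Q 0) = UDToda.ssGeo (1 - θ₁ * θ₂) M m ∧
        P.map (E 0) = UDToda.ssGeo (1 - θ₁) M m) ∨
      (∃ (c : ℝ) (m : Measure ℝ), IsProbabilityMeasure m ∧ m (Set.Iio 0) = 0 ∧
        m ≠ Measure.dirac 0 ∧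
        P.map (Q 0) = Measure.dirac c ∧ P.map (E 0) = m.map (fun y => y + c))) := by
  have i1 : IsProbabilityMeasure (P.map (Q 0)) :=
    Measure.isProbabilityMeasure_map (hQ 0).aemeasurable
  have i2 : IsProbabilityMeasure (P.map (E 0)) :=
    Measure.isProbabilityMeasure_map (hE 0).aemeasurable
  have hX : Measurable fun ω => (fun n => (Q n ω, E n ω) : UDToda.Config) :=
    measurable_pi_iff.2 fun n => (hQ n).prodMk (hE n)
  have hlaw : P.map (fun ω => (fun n => (Q n ω, E n ω) : UDToda.Config)) =
      UDToda.iidLaw (P.map (Q 0)) (P.map (E 0)) := by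
    rw [(iIndepFun_iff_map_fun_eq_infinitePi_map fun n => (hQ n).prodMk (hE n)).1 hindep]
    congr 1; funext n
    rw [(hident n).map_eq]
    exact (indepFun_iff_map_prod_eq_prod_map_map (hQ 0).aemeasurable (hE 0).aemeasurable).1 hQE
  change _ ↔ UDToda.IsInvariantMarginal _ _
  constructor
  · rintro ⟨hsol, hinv⟩
    have : IsProbabilityMeasure (((P.map (E 0)).prod
        (UDToda.carrierLaw (P.map (Q 0)) (P.map (E 0)))).map fun p => p.1 - p.2) :=
      Measure.isProbabilityMeasure_map (by fun_prop)
    exact (UDToda.minDiffIndep_of_invariant hX hlaw hsol hinv).isInvariantMarginal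
      (UDToda.prod_ne_zero_of_solvable hX hlaw hsol)
  · intro h
    obtain ⟨hd, ρ, hρ, hb⟩ := h.exists_balanced
    exact hb.invariant hd hX hlaw
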